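/- **Setting.** Fix $\sigma>0$ and consider the BI-AWGN channel $Y=X+Z$, $X\in\{+1,-1\}$, $Z\sim\mathcal N(0,\sigma^2)$, with output laws $P_+,P_-$ given $X=+1$ and $X=-1$, and capacity $C$ (in nats; all logarithms are natural). Let $\Lambda(y)=\log\frac{P_+(y)}{P_-(y)}$ (ratio of densities), let $\mu_\pm$ be the law of $\Lambda(Y)$ under $Y\sim P_\pm$, and put $\mu=2/\sigma^2$, $s=2/\sigma$, $\Psi(t)=\mu_+(\{\lambda:|\lambda|\ge t\})$, and $\kappa_{\mathrm{AWGN}}=\mathbb E\big[(1+e^{\mu+sG})^{-2}\big]$ with $G\sim\mathcal N(0,1)$. With $\Phi$ the standard normal distribution function, let $$\ell_{\mathrm{tail}}(t)=\log\frac{1-\Phi((t-\mu)/s)}{1-\Phi((t+\mu)/s)},\qquad \ell(u,v)=\log\frac{\mu_+([u,v))}{\mu_-([u,v))}.$$ **Construction.** Let $B=2L+1$. Choose $T_B\in[\mu+\frac4\sigma\sqrt{\log B},\ \mu+\frac4\sigma\sqrt{\log B}+1]$ and an integer $L_{\mathrm{tail}}\ge L$ with $(L-\frac12)\,\ell_{\mathrm{tail}}(T_B)/T_B=L_{\mathrm{tail}}$;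 put $\delta_B=T_B/(L-\frac12)$, $a_L=T_B$, and for $k=L-1,\dots,1$ let $a_k$ be the solution of $\ell(a_k,a_{k+1})=k\delta_B$. The quantizer maps $Y$ to the symbol $\widetilde Y=k\in\{0,\pm1,\dots,\pm(L-1),\pm L_{\mathrm{tail}}\}$ with $\Lambda(Y)\in I_k$, where $I_0=(-a_1,a_1)$, $I_k=[a_k,a_{k+1})$ for $1\le k\le L-1$, $I_{L_{\mathrm{tail}}}=[a_L,\infty)$, and $I_{-k}=-I_k$. Let $C_{B,\delta_B}=I(X;\widetilde Y)$ with $X$ uniform on $\{+1,-1\}$. **Claim.** (a) For all sufficiently large odd $B$ such a pair $(T_B,L_{\mathrm{tail}})$ exists, and for every such pair the cutoffs $a_1,\dots,a_L$ exist, are unique, satisfy $0<a_1<\dots<a_L$, and the quantizer satisfies the exact induced-lattice constraint: $\log\frac{\mu_+(I_k)}{\mu_-(I_k)}=k\delta_B$ for every symbol $k$ with $\mu_+(I_k)>0$. (b) For every family of quantizers so constructed for all large odd $B$ (whatever the choices of $(T_B,L_{\mathrm{tail}})$), as $B\to\infty$ along the odd integers: $T_B\in\big[\mu+\frac4\sigma\sqrt{\log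 B},\ \mu+\frac4\sigma\sqrt{\log B}+1\big]$, $$\delta_B=\frac{T_B}{L-\frac12}=\frac8\sigma\,\frac{\sqrt{\log B}}{B}\,(1+o(1)),\qquad (1+T_B)\,\delta_B=O\Big(\frac{\log B}{B}\Big)\to0,\qquad \Psi(T_B)=O\Big(\frac1{B^2\sqrt{\log B}}\Big)=o(\delta_B^2),$$ and $$C-C_{B,\delta_B}=\frac{8\,\kappa_{\mathrm{AWGN}}}{3\sigma^2}\cdot\frac{\log B}{B^2}\,(1+o(1))=\Theta\Big(\frac{\log B}{B^2}\Big).$$ -/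

import Mathlib

open MeasureTheory ProbabilityTheory Filter Topology Asymptotics

noncomputable section

/-! ### Binary-input channels

A (memoryless) binary-input channel is given by its two output laws `Pp = P_{Y|X=+}` and
`Pm = P_{Y|X=-}`. -/

/-- The output law when the input is `+` with probability `p` and `-` with probability `1 - p`. -/
def outputLaw {𝒴 : Type*} [MeasurableSpace 𝒴] (Pp Pm : Measure 𝒴) (p : ℝ) : Measure 𝒴 :=
  ENNReal.ofReal p • Pp + ENNReal.ofReal (1 - p) • Pm

/-- Mutual information `I(X;Y) = p D(P₊‖P_Y) + (1 - p) D(P₋‖P_Y)` in nats, for the input law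
`P(X = +) = p`. -/
def mutualInfo {𝒴 : Type*} [MeasurableSpace 𝒴] (Pp Pm : Measure 𝒴) (p : ℝ) : ENNReal :=
  ENNReal.ofReal p * InformationTheory.klDiv Pp (outputLaw Pp Pm p) +
    ENNReal.ofReal (1 - p) * InformationTheory.klDiv Pm (outputLaw Pp Pm p)

/-- Channel capacity: the supremum of the mutual information over all input laws. -/
def channelCapacity {𝒴 : Type*} [MeasurableSpace 𝒴] (Pp Pm : Measure 𝒴) : ENNReal :=
  ⨆ p ∈ Set.Icc (0 : ℝ) 1, mutualInfo Pp Pm p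

/-! ### The BI-AWGN channel `Y = X + Z`, `X ∈ {+1, -1}`, `Z ∼ N(0, σ²)` -/

namespace BIAWGN

/-- The law of `Y` given `X = x`. -/
def law (σ x : ℝ) : Measure ℝ := gaussianReal x (σ ^ 2).toNNReal

/-- The log-likelihood ratio `Λ(y) = log (P₊(y) / P₋(y))`. -/
def LLR (σ y : ℝ) : ℝ :=
  Real.log (gaussianPDFReal 1 (σ ^ 2).toNNReal y / gaussianPDFReal (-1) (σ ^ 2).toNNReal y)

/-- `μ₊`, the law of `Λ(Y)` under `Y ∼ P₊`. -/
def muPlus (σ : ℝ) : Measure ℝ := (law σ 1).map (LLR σ)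

/-- `μ₋`, the law of `Λ(Y)` under `Y ∼ P₋`. -/
def muMinus (σ : ℝ) : Measure ℝ := (law σ (-1)).map (LLR σ)

/-- `μ = 2/σ²`, the mean of `Λ` under `X = +1`. -/
def mean (σ : ℝ) : ℝ := 2 / σ ^ 2

/-- `s = 2/σ`, the standard deviation of `Λ` under `X = +1`. -/
def sd (σ : ℝ) : ℝ := 2 / σ

/-- The standard normal distribution function `Φ`. -/
def Phi (x : ℝ) : ℝ := cdf (gaussianReal 0 1) x

/-- The capacity `C` of the BI-AWGN channel, in nats. -/
def capacity (σ : ℝ) : ℝ := (channelCapacity (law σ 1) (law σ (-1))).toReal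

/-- The channel constant `κ = E[(1 + exp(μ + s G))⁻²]`, `G ∼ N(0,1)`. -/
def kappa (σ : ℝ) : ℝ :=
  ∫ x, 1 / (1 + Real.exp (mean σ + sd σ * x)) ^ 2 ∂(gaussianReal 0 1)

/-- The two-sided tail probability `Ψ(t) = μ₊(|Λ| ≥ t)`. -/
def tailProb (σ t : ℝ) : ℝ := (muPlus σ).real {x | t ≤ |x|}

/-- The interval LLR `ℓ(u,v) = log (μ₊([u,v)) / μ₋([u,v)))`. -/
def intervalLLR (σ u v : ℝ) : ℝ :=
  Real.log ((muPlus σ).real (Set.Ico u v) / (muMinus σ).real (Set.Ico u v))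

/-- The LLR of the positive tail cell `[t, ∞)`. -/
def tailLLR (σ t : ℝ) : ℝ :=
  Real.log ((1 - Phi ((t - mean σ) / sd σ)) / (1 - Phi ((t + mean σ) / sd σ)))

/-! ### Symmetric quantizers of the LLR -/

/-- The symbols `{0, ±1, …, ±(L-1), ±Ltail}`. -/
def symbols (L : ℕ) (Ltail : ℤ) : Finset ℤ :=
  Finset.Ioo (-(L : ℤ)) L ∪ {-Ltail, Ltail}

/-- The bin of a positive symbol `j`: `[a_j, a_{j+1})` for `j < L`, and `[a_L, ∞)` for
`j = Ltail`. -/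
def posBin (L : ℕ) (Ltail : ℤ) (a : ℕ → ℝ) (j : ℕ) : Set ℝ :=
  if j < L then Set.Ico (a j) (a (j + 1))
  else if (j : ℤ) = Ltail then Set.Ici (a L)
  else ∅

/-- The bins `I_k` with cutoffs `a_1 < ⋯ < a_L`, where `I_{-k} = -I_k`. The central bin is taken
open, so that the bins form an antisymmetric partition exactly (endpoints have probability 0). -/
def bin (L : ℕ) (Ltail : ℤ) (a : ℕ → ℝ) (k : ℤ) : Set ℝ :=
  if k = 0 then Set.Ioo (-a 1) (a 1)
  else if 0 < k then posBin L Ltail a k.natAbs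
  else {x | -x ∈ posBin L Ltail a k.natAbs}

open Classical in
/-- The quantizer: it maps an LLR value `x` to the symbol `k` with `x ∈ I_k` (the sum has one
nonzero term at most when the bins are disjoint). -/
def quantize (L : ℕ) (Ltail : ℤ) (a : ℕ → ℝ) (x : ℝ) : ℤ :=
  ∑ k ∈ symbols L Ltail, if x ∈ bin L Ltail a k then k else 0

/-- The law of the quantized output `Ỹ = quantize (Λ(Y))` given `X = x`. -/
def quantLaw (σ : ℝ) (L : ℕ) (Ltail : ℤ) (a : ℕ → ℝ) (x : ℝ) : Measure ℤ :=
  (law σ x).map (fun y => quantize L Ltail a (LLR σ y))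

/-- The induced capacity `I(X;Ỹ)`, with `X` uniform on `{+1, -1}`, in nats. -/
def inducedCapacity (σ : ℝ) (L : ℕ) (Ltail : ℤ) (a : ℕ → ℝ) : ℝ :=
  (mutualInfo (quantLaw σ L Ltail a 1) (quantLaw σ L Ltail a (-1)) (1 / 2)).toReal

/-- The exact induced-lattice constraint with spacing `δ`. -/
def ExactLattice (σ δ : ℝ) (L : ℕ) (Ltail : ℤ) (a : ℕ → ℝ) : Prop :=
  ∀ k ∈ symbols L Ltail, 0 < (muPlus σ).real (bin L Ltail a k) →
    Real.log ((muPlus σ).real (bin L Ltail a k) / (muMinus σ).real (bin L Ltail a k)) = k * δ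

/-! ### The exact-lattice construction with `B = 2L + 1` levels -/

/-- The number of levels `B = 2L + 1`, as a real number. -/
def levels (L : ℕ) : ℝ := 2 * (L : ℝ) + 1

/-- `T_B⋆ = μ + (4/σ) √(log B)`. -/
def Tstar (σ : ℝ) (L : ℕ) : ℝ := mean σ + 4 / σ * √(Real.log (levels L))

/-- `J_B(t) = (L - 1/2) ℓ_tail(t) / t`. -/
def J (σ : ℝ) (L : ℕ) (t : ℝ) : ℝ := ((L : ℝ) - 1 / 2) * (tailLLR σ t / t)

/-- The spacing `δ_B = T_B / (L - 1/2)`. -/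
def spacing (L : ℕ) (T : ℝ) : ℝ := T / ((L : ℝ) - 1 / 2)

/-- An admissible choice of `T_B` and `L_tail`. -/
structure IsTailChoice (σ : ℝ) (L : ℕ) (T : ℝ) (Ltail : ℤ) : Prop where
  mem : T ∈ Set.Icc (Tstar σ L) (Tstar σ L + 1)
  le : (L : ℤ) ≤ Ltail
  eq : J σ L T = Ltail

/-- The cutoffs `a_1, …, a_L`: `a_L = T_B`, and `ℓ(a_k, a_{k+1}) = k δ_B` for
`k = L - 1, …, 1`. -/
structure IsCutoffs (σ : ℝ) (L : ℕ) (T : ℝ) (a : ℕ → ℝ) : Prop where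
  last : a L = T
  step : ∀ k : ℕ, 1 ≤ k → k < L → intervalLLR σ (a k) (a (k + 1)) = k * spacing L T

end BIAWGN

end

noncomputable section

/-! ### Mutual information and capacity of binary-input channels as integrals of the log-likelihood
ratio. -/

section Info

open InformationTheory

variable {𝒴 : Type*} [MeasurableSpace 𝒴]

/-! Write `m` for `mean σ`. The loss is computed cell by cell. For a channel with log-likelihood
ratio `ℒ`, mutual information is an integral in `ℒ` alone, and for this symmetric channel the
uniform input is optimal (`channelCapacity_eq_mutualInfo_half`). An exact-lattice quantizer is again
such a channel, with `ℒ = k δ` at symbol `k`, so the loss is half the `μ₊`-integral of the pointwise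
quantity `gap x (k δ)` (`capacity_sub_inducedCapacity`). To second order `gap x c` is `postMinus x *
(x - c)² / 2`. A central cell is an interval around `k δ` with both half-widths close to `δ / 2`,
over which the mean of `(x - k δ)²` is about `δ² / 12`. Summing, and using that the `μ₊`-mean of
`postMinus` is `2 κ_AWGN`, the loss is about `κ_AWGN δ² / 24`; with `δ ~ (8/σ) √(log B) / B` this is
the stated constant. The two tail cells cost at most a multiple of `Ψ(T)`, which is `o(δ²)` because
the Gaussian exponent at `T` is at least `2 log B`.

The delicate point is that the cutoffs are produced by a backward recursion of about `L` steps, so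
errors might accumulate. Centre cell `k` at `c = k δ`, with half-widths `p` on the left and `q` on
the right. The lattice condition says that the integral of `dens x * (1 - exp (c - x))` over the
cell vanishes; after shifting, this is the balance equation `wint S (-b) p = wint S b q` with `S =
kern σ` and `b = c / (2 m)` (`intervalLLR_eq_iff`). Near zero `S t` is `t / 2` up to a relative
error `κ = O(δ²)`. The map from `q` to `p` is then Lipschitz with constant `1 + 8 κ`, uniformly in
`b ≥ 0` (`NearLinear.lipschitz`). The next right half-width is `δ - p`, and for each `b` this map
has a fixed point that is monotone in `b` and lies within `O((κ + b δ) δ)` of `δ / 2`. Following the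
recursion against the moving fixed points, the drift telescopes and the Lipschitz factors multiply
to at most 3, since `κ L = O(T δ)`. Hence every half-width is `δ / 2 + O((1 + T) δ) δ`
(`NearLinear.abs_rightWidth_sub_le`), which yields existence, order and accuracy of the cutoffs;
uniqueness comes from strict monotonicity of `wint`.

An admissible tail symbol exists because the excess `ℓ_tail(t) - t` is decreasing and at least a
constant over `t`. Thus `J` drops by at least 1 across the unit window and takes an integer value
there, with that value at least `L` (`exists_isTailChoice`). -/

theorem klDiv_withDensity_right {P : Measure 𝒴} [IsProbabilityMeasure P] {r : 𝒴 → ℝ}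
    (hr : Measurable r) (hpos : ∀ y, 0 < r y)
    [IsProbabilityMeasure (P.withDensity fun y => ENNReal.ofReal (r y))]
    (hint : Integrable (fun y => -Real.log (r y)) P) :
    klDiv P (P.withDensity fun y => ENNReal.ofReal (r y)) =
      ENNReal.ofReal (∫ y, -Real.log (r y) ∂P) := by
  have hac : P ≪ P.withDensity fun y => ENNReal.ofReal (r y) :=
    withDensity_absolutelyContinuous' (by fun_prop)
      (ae_of_all _ fun y => (ENNReal.ofReal_pos.2 (hpos y)).ne')
  have hllr : llr P (P.withDensity fun y => ENNReal.ofReal (r y)) =ᵐ[P]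
      fun y => -Real.log (r y) := by
    filter_upwards [neg_llr hac, Measure.rnDeriv_withDensity P
      (f := fun y => ENNReal.ofReal (r y)) (by fun_prop)] with y h1 h2
    rw [Pi.neg_apply, llr_def (P.withDensity _) P] at h1
    simp only at h1
    rw [← neg_eq_iff_eq_neg, h1, h2, ENNReal.toReal_ofReal (hpos y).le]
  rw [klDiv_of_ac_of_integrable hac (hint.congr hllr.symm), integral_congr_ae hllr]
  simp

/-- Reduces to the one-sided case by taking the first law as base measure: the second then has
density `b / a`. -/
theorem klDiv_withDensity_withDensity {P : Measure 𝒴} [SigmaFinite P] {a b : 𝒴 → ℝ}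
    (ha : Measurable a) (hb : Measurable b) (ha0 : ∀ y, 0 < a y) (hb0 : ∀ y, 0 < b y)
    [IsProbabilityMeasure (P.withDensity fun y => ENNReal.ofReal (a y))]
    [IsProbabilityMeasure (P.withDensity fun y => ENNReal.ofReal (b y))]
    (hint : Integrable (fun y => a y * Real.log (a y / b y)) P) :
    klDiv (P.withDensity fun y => ENNReal.ofReal (a y))
      (P.withDensity fun y => ENNReal.ofReal (b y)) =
      ENNReal.ofReal (∫ y, a y * Real.log (a y / b y) ∂P) := by
  have hb' : (P.withDensity fun y => ENNReal.ofReal (b y)) =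
      (P.withDensity fun y => ENNReal.ofReal (a y)).withDensity
        fun y => ENNReal.ofReal (b y / a y) := by
    rw [← withDensity_mul _ (by fun_prop) (by fun_prop)]
    congr 1
    ext y
    rw [Pi.mul_apply, ← ENNReal.ofReal_mul (ha0 y).le, mul_div_cancel₀ _ (ha0 y).ne']
  have hlog : ∀ y, -Real.log (b y / a y) = Real.log (a y / b y) := fun y => by
    rw [← Real.log_inv, inv_div]
  have hsm : ∀ g : 𝒴 → ℝ, (fun y => (a y).toNNReal • g y) = fun y => a y * g y := fun g => by
    ext y
    rw [NNReal.smul_def, Real.coe_toNNReal _ (ha0 y).le, smul_eq_mul]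
  have : IsProbabilityMeasure ((P.withDensity fun y => ENNReal.ofReal (a y)).withDensity
        fun y => ENNReal.ofReal (b y / a y)) := by rw [← hb']; infer_instance
  rw [hb', klDiv_withDensity_right (by fun_prop) (fun y => div_pos (hb0 y) (ha0 y))]
  · simp_rw [hlog]
    congr 1
    have := integral_withDensity_eq_integral_smul (μ := P) (f := fun y => (a y).toNNReal)
      (by fun_prop) (fun y => Real.log (a y / b y))
    rw [hsm] at this
    exact this
  · simp_rw [hlog]
    have := integrable_withDensity_iff_integrable_smul (μ := P) (f := fun y => (a y).toNNReal)
      (by fun_prop) (g := fun y => Real.log (a y / b y))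
    rw [hsm] at this
    exact this.2 hint

/-- From below, `log u ≤ u - 1` bounds the integrand by `a - b`; from above, domination gives `a / b
≤ 1 / q`. A mixture dominates each component by its weight, so this covers every interior input law.
-/
theorem integrable_mul_log_div {P : Measure 𝒴} {a b : 𝒴 → ℝ} {q : ℝ}
    (ha : Measurable a) (hb : Measurable b) (ha0 : ∀ y, 0 < a y)
    (hq : 0 < q) (hab : ∀ y, q * a y ≤ b y) (hai : Integrable a P) (hbi : Integrable b P) :
    Integrable (fun y => a y * Real.log (a y / b y)) P := by
  refine Integrable.mono' (g := fun y => |a y - b y| + a y * |Real.log q|)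
    ((hai.sub hbi).abs.add (hai.mul_const _)) (by fun_prop) (ae_of_all _ fun y => ?_)
  have ha1 := ha0 y
  have hb0 : 0 < b y := (mul_pos hq ha1).trans_le (hab y)
  rw [Real.norm_eq_abs, abs_le]
  constructor
  · have h1 : Real.log (b y / a y) ≤ b y / a y - 1 := Real.log_le_sub_one_of_pos (by positivity)
    have h2 : Real.log (a y / b y) = -Real.log (b y / a y) := by rw [← Real.log_inv, inv_div]
    have h3 : a y - b y ≤ a y * Real.log (a y / b y) := by
      have : a y * (b y / a y - 1) = b y - a y := by field_simp
      nlinarith [mul_le_mul_of_nonneg_left h1 ha1.le]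
    have := neg_abs_le (a y - b y)
    have : 0 ≤ a y * |Real.log q| := by positivity
    linarith
  · have h1 : Real.log (a y / b y) ≤ -Real.log q := by
      rw [← Real.log_inv]
      apply Real.log_le_log (by positivity)
      rw [div_le_iff₀ hb0, inv_mul_eq_div, le_div_iff₀ hq]
      linarith [hab y]
    have h2 : a y * Real.log (a y / b y) ≤ a y * |Real.log q| :=
      mul_le_mul_of_nonneg_left (h1.trans (neg_le_abs _)) ha1.le
    have := abs_nonneg (a y - b y)
    linarith

/-- The density of the mixture output law with respect to the law of the input `+`, as a function
of the log-likelihood ratio. -/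
def mixDensity (p x : ℝ) : ℝ := p + (1 - p) * Real.exp (-x)

theorem mixDensity_pos {p : ℝ} (hp : p ∈ Set.Icc (0 : ℝ) 1) (x : ℝ) : 0 < mixDensity p x := by
  unfold mixDensity
  have := Real.exp_pos (-x)
  rcases hp.1.eq_or_lt with h | h
  · rw [← h]; linarith
  · have : 0 ≤ (1 - p) * Real.exp (-x) := mul_nonneg (by linarith [hp.2]) this.le
    linarith

@[fun_prop]
theorem measurable_mixDensity (p : ℝ) : Measurable (mixDensity p) := by
  unfold mixDensity; fun_prop

theorem integrable_exp_neg {P : Measure 𝒴} {ℒ : 𝒴 → ℝ} (hℒ : Measurable ℒ)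
    [IsProbabilityMeasure (P.withDensity fun y => ENNReal.ofReal (Real.exp (-ℒ y)))] :
    Integrable (fun y => Real.exp (-ℒ y)) P := by
  refine (lintegral_ofReal_ne_top_iff_integrable (by fun_prop)
    (ae_of_all _ fun y => (Real.exp_pos _).le)).1 ?_
  have := measure_univ (μ := P.withDensity fun y => ENNReal.ofReal (Real.exp (-ℒ y)))
  rw [withDensity_apply _ MeasurableSet.univ, Measure.restrict_univ] at this
  rw [this]; simp

theorem integral_exp_neg {P : Measure 𝒴} {ℒ : 𝒴 → ℝ} (hℒ : Measurable ℒ)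
    [IsProbabilityMeasure (P.withDensity fun y => ENNReal.ofReal (Real.exp (-ℒ y)))] :
    ∫ y, Real.exp (-ℒ y) ∂P = 1 := by
  rw [integral_eq_lintegral_of_nonneg_ae (ae_of_all _ fun y => (Real.exp_pos _).le) (by fun_prop)]
  have := measure_univ (μ := P.withDensity fun y => ENNReal.ofReal (Real.exp (-ℒ y)))
  rw [withDensity_apply _ MeasurableSet.univ, Measure.restrict_univ] at this
  rw [this]; simp

section

variable {P : Measure 𝒴} {ℒ : 𝒴 → ℝ} {p : ℝ}

theorem outputLaw_eq_withDensity (hℒ : Measurable ℒ) (hp : p ∈ Set.Icc (0 : ℝ) 1) :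
    outputLaw P (P.withDensity fun y => ENNReal.ofReal (Real.exp (-ℒ y))) p =
      P.withDensity fun y => ENNReal.ofReal (mixDensity p (ℒ y)) := by
  unfold outputLaw mixDensity
  have h1 : (fun y => ENNReal.ofReal (p + (1 - p) * Real.exp (-ℒ y))) =
      (fun _ => ENNReal.ofReal p) +
        ENNReal.ofReal (1 - p) • fun y => ENNReal.ofReal (Real.exp (-ℒ y)) := by
    ext y
    have := Real.exp_pos (-ℒ y)
    rw [Pi.add_apply, Pi.smul_apply, smul_eq_mul, ← ENNReal.ofReal_mul (by linarith [hp.2]),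
      ENNReal.ofReal_add hp.1 (mul_nonneg (by linarith [hp.2]) this.le)]
  rw [h1, withDensity_add_left (by fun_prop), withDensity_const,
    withDensity_smul _ (by fun_prop)]

variable [IsProbabilityMeasure P]
  [IsProbabilityMeasure (P.withDensity fun y => ENNReal.ofReal (Real.exp (-ℒ y)))]

theorem isProbabilityMeasure_mix (hℒ : Measurable ℒ) (hp : p ∈ Set.Icc (0 : ℝ) 1) :
    IsProbabilityMeasure (P.withDensity fun y => ENNReal.ofReal (mixDensity p (ℒ y))) := by
  rw [← outputLaw_eq_withDensity hℒ hp]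
  constructor
  simp only [outputLaw, Measure.coe_add, Measure.coe_smul, Pi.add_apply, Pi.smul_apply,
    measure_univ, smul_eq_mul, mul_one]
  rw [← ENNReal.ofReal_add hp.1 (by linarith [hp.2])]
  simp

theorem integrable_mixDensity (hℒ : Measurable ℒ) :
    Integrable (fun y => mixDensity p (ℒ y)) P :=
  (integrable_const _).add ((integrable_exp_neg hℒ).const_mul _)

theorem integral_mixDensity (hℒ : Measurable ℒ) : ∫ y, mixDensity p (ℒ y) ∂P = 1 := by
  unfold mixDensity
  rw [integral_add (integrable_const _) ((integrable_exp_neg hℒ).const_mul _),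
    integral_const_mul, integral_exp_neg hℒ]
  simp

theorem integrable_log_inv_mixDensity (hℒ : Measurable ℒ) (hp : p ∈ Set.Ioo (0 : ℝ) 1) :
    Integrable (fun y => Real.log (1 / mixDensity p (ℒ y))) P := by
  have := integrable_mul_log_div (P := P) (a := fun _ => 1) (b := fun y => mixDensity p (ℒ y))
    (q := p) (by fun_prop) (by fun_prop) (fun _ => one_pos) hp.1 (fun y => by
      have : 0 ≤ (1 - p) * Real.exp (-ℒ y) :=
        mul_nonneg (by linarith [hp.2]) (Real.exp_pos _).le
      unfold mixDensity
      linarith) (integrable_const _) (integrable_mixDensity hℒ)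
  simpa using this

theorem integrable_exp_mul_log_mixDensity (hℒ : Measurable ℒ) (hp : p ∈ Set.Ioo (0 : ℝ) 1) :
    Integrable (fun y => Real.exp (-ℒ y) * Real.log (Real.exp (-ℒ y) / mixDensity p (ℒ y))) P :=
  integrable_mul_log_div (P := P) (a := fun y => Real.exp (-ℒ y))
    (b := fun y => mixDensity p (ℒ y)) (q := 1 - p) (by fun_prop) (by fun_prop)
    (fun _ => Real.exp_pos _) (by linarith [hp.2]) (fun y => by
      unfold mixDensity
      linarith [hp.1]) (integrable_exp_neg hℒ) (integrable_mixDensity hℒ)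

theorem mutualInfo_withDensity (hℒ : Measurable ℒ) (hp : p ∈ Set.Ioo (0 : ℝ) 1) :
    mutualInfo P (P.withDensity fun y => ENNReal.ofReal (Real.exp (-ℒ y))) p =
      ENNReal.ofReal p * ENNReal.ofReal (∫ y, Real.log (1 / mixDensity p (ℒ y)) ∂P) +
      ENNReal.ofReal (1 - p) * ENNReal.ofReal
        (∫ y, Real.exp (-ℒ y) * Real.log (Real.exp (-ℒ y) / mixDensity p (ℒ y)) ∂P) := by
  have hp' : p ∈ Set.Icc (0 : ℝ) 1 := ⟨hp.1.le, hp.2.le⟩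
  have := isProbabilityMeasure_mix (P := P) (p := p) hℒ hp'
  unfold mutualInfo
  have hl : ∀ y, -Real.log (mixDensity p (ℒ y)) = Real.log (1 / mixDensity p (ℒ y)) := fun y => by
    rw [one_div, Real.log_inv]
  rw [outputLaw_eq_withDensity hℒ hp', klDiv_withDensity_right (by fun_prop)
    (fun y => mixDensity_pos hp' _), klDiv_withDensity_withDensity (by fun_prop) (by fun_prop)
    (fun y => Real.exp_pos _) (fun y => mixDensity_pos hp' _)
    (integrable_exp_mul_log_mixDensity hℒ hp)]
  · simp_rw [hl]
  · simp_rw [hl]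
    exact integrable_log_inv_mixDensity hℒ hp

theorem integral_log_inv_mixDensity_nonneg (hℒ : Measurable ℒ) (hp : p ∈ Set.Ioo (0 : ℝ) 1) :
    0 ≤ ∫ y, Real.log (1 / mixDensity p (ℒ y)) ∂P := by
  have h1 : ∫ y, (1 - mixDensity p (ℒ y)) ∂P ≤ ∫ y, Real.log (1 / mixDensity p (ℒ y)) ∂P := by
    refine integral_mono ((integrable_const _).sub (integrable_mixDensity hℒ))
      (integrable_log_inv_mixDensity hℒ hp) fun y => ?_
    have := Real.log_le_sub_one_of_pos (mixDensity_pos ⟨hp.1.le, hp.2.le⟩ (ℒ y))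
    simp only [one_div, Real.log_inv]
    linarith
  rw [integral_sub (integrable_const _) (integrable_mixDensity hℒ), integral_mixDensity hℒ] at h1
  simpa using h1

theorem integral_exp_mul_log_mixDensity_nonneg (hℒ : Measurable ℒ)
    (hp : p ∈ Set.Ioo (0 : ℝ) 1) :
    0 ≤ ∫ y, Real.exp (-ℒ y) * Real.log (Real.exp (-ℒ y) / mixDensity p (ℒ y)) ∂P := by
  have h1 : ∫ y, (Real.exp (-ℒ y) - mixDensity p (ℒ y)) ∂P ≤
      ∫ y, Real.exp (-ℒ y) * Real.log (Real.exp (-ℒ y) / mixDensity p (ℒ y)) ∂P := by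
    refine integral_mono ((integrable_exp_neg hℒ).sub (integrable_mixDensity hℒ))
      (integrable_exp_mul_log_mixDensity hℒ hp) fun y => ?_
    have hm := mixDensity_pos ⟨hp.1.le, hp.2.le⟩ (ℒ y)
    have he := Real.exp_pos (-ℒ y)
    have := Real.log_le_sub_one_of_pos (div_pos hm he)
    have h2 : Real.exp (-ℒ y) * (mixDensity p (ℒ y) / Real.exp (-ℒ y) - 1) =
      mixDensity p (ℒ y) - Real.exp (-ℒ y) := by field_simp
    have h3 : Real.log (Real.exp (-ℒ y) / mixDensity p (ℒ y)) =
        -Real.log (mixDensity p (ℒ y) / Real.exp (-ℒ y)) := by rw [← Real.log_inv, inv_div]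
    simp only
    rw [h3]
    nlinarith [mul_le_mul_of_nonneg_left this he.le]
  rw [integral_sub (integrable_exp_neg hℒ) (integrable_mixDensity hℒ), integral_mixDensity hℒ,
    integral_exp_neg hℒ] at h1
  simpa using h1

theorem toReal_mutualInfo_withDensity (hℒ : Measurable ℒ) (hp : p ∈ Set.Ioo (0 : ℝ) 1) :
    mutualInfo P (P.withDensity fun y => ENNReal.ofReal (Real.exp (-ℒ y))) p =
      ENNReal.ofReal (p * (∫ y, Real.log (1 / mixDensity p (ℒ y)) ∂P) + (1 - p) *
        ∫ y, Real.exp (-ℒ y) * Real.log (Real.exp (-ℒ y) / mixDensity p (ℒ y)) ∂P) := by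
  have h1 := integral_log_inv_mixDensity_nonneg (P := P) hℒ hp
  have h2 := integral_exp_mul_log_mixDensity_nonneg (P := P) hℒ hp
  have hp1 : 0 ≤ 1 - p := by linarith [hp.2]
  rw [mutualInfo_withDensity hℒ hp, ENNReal.ofReal_add (mul_nonneg hp.1.le h1)
    (mul_nonneg hp1 h2), ENNReal.ofReal_mul hp.1.le, ENNReal.ofReal_mul hp1]

/-- A binary-input channel whose two divergences from the uniform output law agree has the uniform
input law as capacity achieving input. -/
theorem channelCapacity_eq_mutualInfo_half (hℒ : Measurable ℒ)
    (hsymm : ∫ y, Real.log (1 / mixDensity (1 / 2) (ℒ y)) ∂P =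
      ∫ y, Real.exp (-ℒ y) * Real.log (Real.exp (-ℒ y) / mixDensity (1 / 2) (ℒ y)) ∂P) :
    channelCapacity P (P.withDensity fun y => ENNReal.ofReal (Real.exp (-ℒ y))) =
      mutualInfo P (P.withDensity fun y => ENNReal.ofReal (Real.exp (-ℒ y))) (1 / 2) := by
  have hhalf : (1 / 2 : ℝ) ∈ Set.Ioo (0 : ℝ) 1 := by norm_num
  apply le_antisymm
  · refine iSup₂_le fun p hp => ?_
    rcases hp.1.eq_or_lt with h0 | h0
    · rw [← h0]; simp [mutualInfo, outputLaw]
    rcases hp.2.eq_or_lt with h1 | h1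
    · rw [h1]; simp [mutualInfo, outputLaw]
    have hpo : p ∈ Set.Ioo (0 : ℝ) 1 := ⟨h0, h1⟩
    rw [toReal_mutualInfo_withDensity hℒ hpo, toReal_mutualInfo_withDensity hℒ hhalf]
    apply ENNReal.ofReal_le_ofReal
    -- Gibbs' inequality in pointwise form: measuring divergence from the uniform mixture instead of
    -- the true mixture can only increase the weighted sum. The correction term integrates to `1 - 1
    -- = 0`, and by `hsymm` the resulting bound does not depend on `p`.
    have key : ∀ y, p * Real.log (1 / mixDensity p (ℒ y)) + (1 - p) *
        (Real.exp (-ℒ y) * Real.log (Real.exp (-ℒ y) / mixDensity p (ℒ y))) ≤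
        (p * Real.log (1 / mixDensity (1 / 2) (ℒ y)) + (1 - p) *
        (Real.exp (-ℒ y) * Real.log (Real.exp (-ℒ y) / mixDensity (1 / 2) (ℒ y)))) +
        (mixDensity (1 / 2) (ℒ y) - mixDensity p (ℒ y)) := fun y => by
      have hm := mixDensity_pos hp (ℒ y)
      have hm' := mixDensity_pos ⟨hhalf.1.le, hhalf.2.le⟩ (ℒ y)
      have he := Real.exp_pos (-ℒ y)
      rw [Real.log_div one_ne_zero hm.ne', Real.log_div one_ne_zero hm'.ne',
        Real.log_div he.ne' hm.ne', Real.log_div he.ne' hm'.ne']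
      have h2 := Real.log_le_sub_one_of_pos (div_pos hm' hm)
      rw [Real.log_div hm'.ne' hm.ne'] at h2
      have h3 : mixDensity p (ℒ y) * (mixDensity (1 / 2) (ℒ y) / mixDensity p (ℒ y) - 1) =
        mixDensity (1 / 2) (ℒ y) - mixDensity p (ℒ y) := by field_simp
      have h4 := mul_le_mul_of_nonneg_left h2 hm.le
      rw [h3] at h4
      have h5 : mixDensity p (ℒ y) = p + (1 - p) * Real.exp (-ℒ y) := rfl
      rw [h5] at h4 ⊢
      linarith
    have i1 := integrable_log_inv_mixDensity (P := P) hℒ hpo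
    have i2 := integrable_exp_mul_log_mixDensity (P := P) hℒ hpo
    have i3 := integrable_log_inv_mixDensity (P := P) hℒ hhalf
    have i4 := integrable_exp_mul_log_mixDensity (P := P) hℒ hhalf
    have i5 := integrable_mixDensity (P := P) (p := p) hℒ
    have i6 := integrable_mixDensity (P := P) (p := 1 / 2) hℒ
    have j1 : Integrable (fun y => p * Real.log (1 / mixDensity (1 / 2) (ℒ y)) + (1 - p) *
        (Real.exp (-ℒ y) * Real.log (Real.exp (-ℒ y) / mixDensity (1 / 2) (ℒ y)))) P :=
      (i3.const_mul p).add (i4.const_mul (1 - p))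
    have j2 : Integrable (fun y => mixDensity (1 / 2) (ℒ y) - mixDensity p (ℒ y)) P := i6.sub i5
    have := integral_mono ((i1.const_mul p).add (i2.const_mul (1 - p))) (j1.add j2) key
    simp only [Pi.add_apply] at this
    rw [integral_add (i1.const_mul p) (i2.const_mul (1 - p)), integral_add j1 j2,
      integral_add (i3.const_mul p) (i4.const_mul (1 - p)), integral_sub i6 i5,
      integral_mixDensity hℒ, integral_mixDensity hℒ] at this
    simp only [integral_const_mul] at this
    rw [← hsymm] at this ⊢
    linarith
  · exact le_iSup₂ (f := fun (p : ℝ) (_ : p ∈ Set.Icc (0 : ℝ) 1) => mutualInfo P _ p) (1 / 2)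
      ⟨hhalf.1.le, hhalf.2.le⟩

end

/-- `log (1 + exp (-x))`. -/
def softlog (x : ℝ) : ℝ := Real.log (1 + Real.exp (-x))

theorem log_inv_mixDensity_half (x : ℝ) :
    Real.log (1 / mixDensity (1 / 2) x) = Real.log 2 - softlog x := by
  have : mixDensity (1 / 2) x = (1 + Real.exp (-x)) / 2 := by unfold mixDensity; ring
  have h := Real.exp_pos (-x)
  rw [this, one_div_div, Real.log_div two_ne_zero (by positivity), softlog]

theorem log_exp_div_mixDensity_half (x : ℝ) :
    Real.log (Real.exp (-x) / mixDensity (1 / 2) x) = Real.log 2 - softlog (-x) := by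
  have h := Real.exp_pos x
  have : Real.exp (-x) / mixDensity (1 / 2) x = 2 / (1 + Real.exp x) := by
    unfold mixDensity
    rw [Real.exp_neg]
    field_simp
    ring
  rw [this, Real.log_div two_ne_zero (by positivity), softlog, neg_neg]

end Info

/-! ### Balanced cells -/

section Balance

/-- The exponentially weighted integral `∫₀ˣ exp (-b t) S(t) dt`. -/
def wint (S : ℝ → ℝ) (b x : ℝ) : ℝ := ∫ t in (0 : ℝ)..x, Real.exp (-b * t) * S t

theorem wint_zero (S : ℝ → ℝ) (b : ℝ) : wint S b 0 = 0 := by simp [wint]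

/-- A continuous weight, positive on the positive half line and within a factor `1 ± κ` of `t / 2`
on `[0, δ]`. -/
structure NearLinear (S : ℝ → ℝ) (κ δ : ℝ) : Prop where
  cont : Continuous S
  pos : ∀ t, 0 < t → 0 < S t
  lower : ∀ t ∈ Set.Icc 0 δ, (1 - κ) * (t / 2) ≤ S t
  upper : ∀ t ∈ Set.Icc 0 δ, S t ≤ (1 + κ) * (t / 2)
  κ_pos : 0 < κ
  κ_le : κ ≤ 1 / 8
  δ_pos : 0 < δ

variable {S : ℝ → ℝ} {κ δ b p q : ℝ}

theorem hasDerivAt_wint (hS : Continuous S) (b x : ℝ) :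
    HasDerivAt (wint S b) (Real.exp (-b * x) * S x) x := by
  have hc : Continuous fun t => Real.exp (-b * t) * S t := by fun_prop
  exact intervalIntegral.integral_hasDerivAt_right (hc.intervalIntegrable _ _)
    (hc.stronglyMeasurableAtFilter _ _) hc.continuousAt

theorem continuous_wint (hS : Continuous S) (b : ℝ) : Continuous (wint S b) :=
  continuous_iff_continuousAt.2 fun x => (hasDerivAt_wint hS b x).continuousAt

theorem wint_strictMonoOn (hS : Continuous S) (hpos : ∀ t, 0 < t → 0 < S t) (b : ℝ) :
    StrictMonoOn (wint S b) (Set.Ici 0) := by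
  apply strictMonoOn_of_deriv_pos (convex_Ici 0) (continuous_wint hS b).continuousOn
  intro x hx
  rw [interior_Ici, Set.mem_Ioi] at hx
  rw [(hasDerivAt_wint hS b x).deriv]
  exact mul_pos (Real.exp_pos _) (hpos x hx)

theorem wint_antitone (hS : Continuous S) (hpos : ∀ t, 0 < t → 0 < S t) {b b' : ℝ} (h : b ≤ b')
    {x : ℝ} (hx : 0 ≤ x) : wint S b' x ≤ wint S b x := by
  apply intervalIntegral.integral_mono_on_of_le_Ioo hx
  · exact Continuous.intervalIntegrable (by fun_prop) _ _
  · exact Continuous.intervalIntegrable (by fun_prop) _ _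
  · intro t ht
    have := hpos t ht.1
    have := ht.1
    gcongr

/-- For `b ≥ 0` the left side carries the heavier exponential weight, so the intermediate value
theorem on `[0, q]` suffices. -/
theorem exists_balanced (hS : Continuous S) (hpos : ∀ t, 0 < t → 0 < S t) (hb : 0 ≤ b)
    (hq : 0 < q) : ∃ p, 0 < p ∧ p ≤ q ∧ wint S (-b) p = wint S b q := by
  have h0 : 0 < wint S b q := by
    rw [← wint_zero S b]
    exact wint_strictMonoOn hS hpos b Set.self_mem_Ici hq.le hq
  have h1 : wint S b q ≤ wint S (-b) q := wint_antitone hS hpos (by linarith) hq.le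
  obtain ⟨p, hp, hpq⟩ := intermediate_value_Icc hq.le (continuous_wint hS (-b)).continuousOn
    (show wint S b q ∈ Set.Icc (wint S (-b) 0) (wint S (-b) q) from
      ⟨by rw [wint_zero]; exact h0.le, h1⟩)
  refine ⟨p, hp.1.lt_of_ne fun h => ?_, hp.2, hpq⟩
  rw [← h, wint_zero] at hpq
  exact h0.ne hpq

theorem balanced_le (hS : Continuous S) (hpos : ∀ t, 0 < t → 0 < S t) (hb : 0 ≤ b)
    (hp : 0 ≤ p) (hq : 0 ≤ q) (h : wint S (-b) p = wint S b q) : p ≤ q := by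
  by_contra! hlt
  have h1 := wint_strictMonoOn hS hpos (-b) (Set.mem_Ici.2 hq) (Set.mem_Ici.2 hp) hlt
  have h2 := wint_antitone hS hpos (show -b ≤ b by linarith) hq
  linarith

theorem NearLinear.wint_ge (h : NearLinear S κ δ) (hb : 0 ≤ b) (hq : q ∈ Set.Icc 0 δ) :
    Real.exp (-b * q) * ((1 - κ) * (q ^ 2 / 4)) ≤ wint S b q := by
  have h1 : ∫ t in (0 : ℝ)..q, Real.exp (-b * q) * ((1 - κ) / 2) * t =
      Real.exp (-b * q) * ((1 - κ) * (q ^ 2 / 4)) := by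
    rw [intervalIntegral.integral_const_mul, integral_id]; ring
  rw [← h1]
  have hS := h.cont
  apply intervalIntegral.integral_mono_on hq.1
    (Continuous.intervalIntegrable (by fun_prop) _ _)
    (Continuous.intervalIntegrable (by fun_prop) _ _)
  intro t ht
  have h2 := h.lower t ⟨ht.1, ht.2.trans hq.2⟩
  have h3 : Real.exp (-b * q) ≤ Real.exp (-b * t) := Real.exp_le_exp.2 (by nlinarith [ht.2])
  have h4 : 0 ≤ (1 - κ) * (t / 2) := mul_nonneg (by linarith [h.κ_le]) (by linarith [ht.1])
  calc Real.exp (-b * q) * ((1 - κ) / 2) * t = Real.exp (-b * q) * ((1 - κ) * (t / 2)) := by ring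
    _ ≤ Real.exp (-b * t) * S t := mul_le_mul h3 h2 h4 (Real.exp_pos _).le

theorem NearLinear.wint_le (h : NearLinear S κ δ) (hb : 0 ≤ b) (hp : p ∈ Set.Icc 0 δ) :
    wint S (-b) p ≤ Real.exp (b * p) * ((1 + κ) * (p ^ 2 / 4)) := by
  have h1 : ∫ t in (0 : ℝ)..p, Real.exp (b * p) * ((1 + κ) / 2) * t =
      Real.exp (b * p) * ((1 + κ) * (p ^ 2 / 4)) := by
    rw [intervalIntegral.integral_const_mul, integral_id]; ring
  rw [← h1]
  have hS := h.cont
  apply intervalIntegral.integral_mono_on hp.1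
    (Continuous.intervalIntegrable (by fun_prop) _ _)
    (Continuous.intervalIntegrable (by fun_prop) _ _)
  intro t ht
  have h2 := h.upper t ⟨ht.1, ht.2.trans hp.2⟩
  have h3 : Real.exp (- -b * t) ≤ Real.exp (b * p) := Real.exp_le_exp.2 (by nlinarith [ht.2])
  have h4 : 0 ≤ S t := by
    rcases ht.1.eq_or_lt with h0 | h0
    · have := h.lower t ⟨ht.1, ht.2.trans hp.2⟩
      rw [← h0] at this ⊢
      linarith
    · exact (h.pos t h0).le
  calc Real.exp (- -b * t) * S t ≤ Real.exp (b * p) * ((1 + κ) * (t / 2)) :=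
        mul_le_mul h3 h2 h4 (Real.exp_pos _).le
    _ = _ := by ring

theorem NearLinear.sq_le (h : NearLinear S κ δ) (hb : 0 ≤ b) (hp : 0 ≤ p)
    (hq : q ∈ Set.Icc 0 δ) (hR : wint S (-b) p = wint S b q) :
    (1 - κ) * (q ^ 2 * Real.exp (-b * q)) ≤ (1 + κ) * (p ^ 2 * Real.exp (b * p)) := by
  have hpq := balanced_le h.cont h.pos hb hp hq.1 hR
  have h1 := h.wint_ge hb hq
  have h2 := h.wint_le hb ⟨hp, hpq.trans hq.2⟩
  rw [hR] at h2
  linarith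

/-- The ratio of the two sides is the derivative of `p` in `q` along the balance curve. Balance
compares `q² exp (-b q)` with `p² exp (b p)`, whereas the weights involve `x = q exp (-b q)` and `y
= p exp (b p)`, whose squares carry the exponentials twice. The discrepancy has the favourable sign
on both sides, so the bound loses nothing in `b`. -/
theorem NearLinear.weight_lt (h : NearLinear S κ δ) (hb : 0 ≤ b) (hp : 0 < p)
    (hq : q ∈ Set.Ioc 0 δ) (hR : wint S (-b) p = wint S b q) :
    Real.exp (-b * q) * S q < (1 + 8 * κ) * (Real.exp (b * p) * S p) := by
  have hq' : q ∈ Set.Icc 0 δ := ⟨hq.1.le, hq.2⟩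
  have hpq := balanced_le h.cont h.pos hb hp.le hq.1.le hR
  have h1 := h.sq_le hb hp.le hq' hR
  have h2 := h.lower p ⟨hp.le, hpq.trans hq.2⟩
  have h3 := h.upper q hq'
  have hκ := h.κ_pos
  have hκ' := h.κ_le
  set x := q * Real.exp (-b * q) with hx
  set y := p * Real.exp (b * p) with hy
  have hx0 : 0 < x := mul_pos hq.1 (Real.exp_pos _)
  have hy0 : 0 < y := mul_pos hp (Real.exp_pos _)
  have e1 : x ^ 2 ≤ q ^ 2 * Real.exp (-b * q) := by
    rw [hx, mul_pow]
    gcongr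
    rw [← Real.exp_nat_mul]
    apply Real.exp_le_exp.2
    push_cast
    nlinarith [mul_nonneg hb hq.1.le]
  have e2 : p ^ 2 * Real.exp (b * p) ≤ y ^ 2 := by
    rw [hy, mul_pow]
    gcongr
    rw [← Real.exp_nat_mul]
    apply Real.exp_le_exp.2
    push_cast
    nlinarith [mul_nonneg hb hp.le]
  have e3 : (1 - κ) * x ^ 2 ≤ (1 + κ) * y ^ 2 := by nlinarith
  have e4 : (1 - κ) * x ≤ (1 + κ) * y := by
    apply (sq_le_sq₀ (mul_nonneg (by linarith) hx0.le) (by positivity)).1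
    nlinarith [sq_nonneg y, sq_nonneg x, mul_pos hκ (pow_pos hy0 2)]
  have e5 : Real.exp (-b * q) * S q ≤ (1 + κ) / 2 * x := by
    rw [hx]; nlinarith [mul_le_mul_of_nonneg_left h3 (Real.exp_pos (-b * q)).le]
  have e6 : (1 - κ) / 2 * y ≤ Real.exp (b * p) * S p := by
    rw [hy]; nlinarith [mul_le_mul_of_nonneg_left h2 (Real.exp_pos (b * p)).le]
  have e7 : (1 + κ) / 2 * x < (1 + 8 * κ) * ((1 - κ) / 2 * y) := by
    have : 0 < 1 - κ := by linarith
    rw [← mul_lt_mul_iff_right₀ this]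
    have a1 : (1 - κ) * ((1 + κ) / 2 * x) ≤ (1 + κ) / 2 * ((1 + κ) * y) := by nlinarith
    have a2 : (1 + κ) * (1 + κ) < (1 - κ) * ((1 + 8 * κ) * (1 - κ)) := by
      nlinarith [mul_pos hκ hκ, mul_nonneg hκ.le (mul_nonneg hκ.le (sub_nonneg.2 hκ'))]
    nlinarith [mul_lt_mul_of_pos_right a2 hy0]
  nlinarith

/-- Obtained by comparing the two weighted integrals along straight lines, so the balance curve
itself never has to be differentiated. -/
theorem NearLinear.lipschitz (h : NearLinear S κ δ) (hb : 0 ≤ b) {p' q' : ℝ} (hp : 0 < p)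
    (hp' : 0 < p') (hq : 0 < q) (hqq : q ≤ q') (hq' : q' ≤ δ)
    (hR : wint S (-b) p = wint S b q) (hR' : wint S (-b) p' = wint S b q') :
    p ≤ p' ∧ p' - p ≤ (1 + 8 * κ) * (q' - q) := by
  have hmono := wint_strictMonoOn h.cont h.pos
  have hκ := h.κ_pos
  constructor
  · rw [← (hmono (-b)).le_iff_le (Set.mem_Ici.2 hp.le) (Set.mem_Ici.2 hp'.le), hR, hR',
      (hmono b).le_iff_le (Set.mem_Ici.2 hq.le) (Set.mem_Ici.2 (hq.le.trans hqq))]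
    exact hqq
  -- Wherever the two functions meet, `p + (1 + 8κ) x` and `q + x` form a balanced pair, so
  -- `weight_lt` gives the strict derivative inequality required there.
  have key := image_le_of_deriv_right_lt_deriv_boundary
    (f := fun x => wint S b (q + x)) (f' := fun x => Real.exp (-b * (q + x)) * S (q + x))
    (a := 0) (b := q' - q) (B := fun x => wint S (-b) (p + (1 + 8 * κ) * x))
    (B' := fun x => Real.exp (- -b * (p + (1 + 8 * κ) * x)) * S (p + (1 + 8 * κ) * x) *
      (1 + 8 * κ))
    (Continuous.continuousOn (by have := continuous_wint h.cont b; fun_prop))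
    (fun x _ => ((hasDerivAt_wint h.cont b (q + x)).comp_const_add q x).hasDerivWithinAt)
    (by simp [hR])
    (fun x => by
      have h1 : HasDerivAt (fun x => p + (1 + 8 * κ) * x) (1 + 8 * κ) x := by
        simpa using ((hasDerivAt_id x).const_mul (1 + 8 * κ)).const_add p
      exact (hasDerivAt_wint h.cont (-b) (p + (1 + 8 * κ) * x)).comp x h1)
    (fun x hx hxe => by
      have hx0 := hx.1
      have := h.weight_lt (p := p + (1 + 8 * κ) * x) (q := q + x) hb (by positivity)
        ⟨by positivity, by linarith [hx.2]⟩ hxe.symm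
      rw [neg_neg]
      linarith)
    (Set.right_mem_Icc.2 (sub_nonneg.2 hqq))
  simp only [add_sub_cancel] at key
  rw [← hR', (hmono (-b)).le_iff_le (Set.mem_Ici.2 hp'.le) (Set.mem_Ici.2 _)] at key
  · linarith
  · have := sub_nonneg.2 hqq
    positivity

theorem NearLinear.abs_sub_le (h : NearLinear S κ δ) (hb : 0 ≤ b) {p' q' : ℝ} (hp : 0 < p)
    (hp' : 0 < p') (hq : q ∈ Set.Ioc 0 δ) (hq' : q' ∈ Set.Ioc 0 δ)
    (hR : wint S (-b) p = wint S b q) (hR' : wint S (-b) p' = wint S b q') :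
    |p' - p| ≤ (1 + 8 * κ) * |q' - q| := by
  rcases le_total q q' with hle | hle
  · obtain ⟨h1, h2⟩ := h.lipschitz hb hp hp' hq.1 hle hq'.2 hR hR'
    rwa [abs_of_nonneg (sub_nonneg.2 h1), abs_of_nonneg (sub_nonneg.2 hle)]
  · obtain ⟨h1, h2⟩ := h.lipschitz hb hp' hp hq'.1 hle hq.2 hR' hR
    rwa [abs_sub_comm, abs_sub_comm q', abs_of_nonneg (sub_nonneg.2 h1),
      abs_of_nonneg (sub_nonneg.2 hle)]

/-- These are the stationary points of the recursion `q ↦ δ - p` with the slope `b` frozen. -/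
theorem NearLinear.exists_fixed (h : NearLinear S κ δ) (hb : 0 ≤ b) :
    ∃ q, δ / 2 ≤ q ∧ q < δ ∧ wint S (-b) (δ - q) = wint S b q := by
  have hδ := h.δ_pos
  have hmono := wint_strictMonoOn h.cont h.pos
  have hc : Continuous fun q => wint S b q - wint S (-b) (δ - q) := by
    have := continuous_wint h.cont b
    have := continuous_wint h.cont (-b)
    fun_prop
  have h0 : 0 < wint S b δ := by
    rw [← wint_zero S b]
    exact hmono b Set.self_mem_Ici hδ.le hδ
  have h1 := wint_antitone h.cont h.pos (show -b ≤ b by linarith) (half_pos hδ).le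
  obtain ⟨q, hq, he⟩ := intermediate_value_Icc (show δ / 2 ≤ δ by linarith) hc.continuousOn
    (show (0 : ℝ) ∈ Set.Icc _ _ from ⟨by rw [sub_half]; linarith, by
      rw [sub_self, wint_zero]; linarith⟩)
  refine ⟨q, hq.1, hq.2.lt_of_ne fun hqe => ?_, (sub_eq_zero.1 he).symm⟩
  rw [hqe] at he
  simp only [sub_self, wint_zero, sub_zero] at he
  linarith

/-- A larger slope tilts mass to the left, which must be compensated by a wider right half. -/
theorem fixed_mono (hS : Continuous S) (hpos : ∀ t, 0 < t → 0 < S t) {b' q' : ℝ} (hbb : b ≤ b')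
    (hq : q ∈ Set.Icc 0 δ) (hq' : q' ∈ Set.Icc 0 δ)
    (hR : wint S (-b) (δ - q) = wint S b q) (hR' : wint S (-b') (δ - q') = wint S b' q') :
    q ≤ q' := by
  by_contra! hlt
  have hmono := wint_strictMonoOn hS hpos
  have h1 := wint_antitone hS hpos hbb hq'.1
  have h2 := hmono b (Set.mem_Ici.2 hq'.1) (Set.mem_Ici.2 hq.1) hlt
  have h3 := hmono (-b) (Set.mem_Ici.2 (sub_nonneg.2 hq.2)) (Set.mem_Ici.2 (sub_nonneg.2 hq'.2))
    (sub_lt_sub_left hlt δ)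
  have h4 := wint_antitone hS hpos (neg_le_neg hbb) (sub_nonneg.2 hq'.2)
  linarith

/-- Multiplying the balance estimate by `exp (b q)` leaves only `exp (b δ)`, so `q / (δ - q)` is at
most `1 + ω` with `ω = 4 κ + b δ`. Since `δ - q ≤ δ / 2`, this puts `q` within `ω δ / 4` of the
midpoint. -/
theorem NearLinear.fixed_le (h : NearLinear S κ δ) (hb : 0 ≤ b) (hbδ : b * δ ≤ 1 / 2)
    (hq : q ∈ Set.Ico (δ / 2) δ) (hR : wint S (-b) (δ - q) = wint S b q) :
    q - δ / 2 ≤ (4 * κ + b * δ) * δ / 4 := by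
  have hδ := h.δ_pos
  have hκ := h.κ_pos
  have hκ' := h.κ_le
  have hq0 : 0 < q := by linarith [hq.1]
  have hp0 : 0 < δ - q := by linarith [hq.2]
  have h1 := h.sq_le hb hp0.le ⟨hq0.le, hq.2.le⟩ hR
  have hbd : 0 ≤ b * δ := by positivity
  have h2 : (1 - κ) * q ^ 2 ≤ (1 + κ) * ((δ - q) ^ 2 * Real.exp (b * δ)) := by
    have e : Real.exp (b * δ) = Real.exp (b * (δ - q)) * Real.exp (b * q) := by
      rw [← Real.exp_add]; ring_nf
    have e' : Real.exp (-b * q) * Real.exp (b * q) = 1 := by rw [← Real.exp_add]; simp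
    have := mul_le_mul_of_nonneg_right h1 (Real.exp_pos (b * q)).le
    rw [e]
    calc (1 - κ) * q ^ 2 = (1 - κ) * (q ^ 2 * Real.exp (-b * q)) * Real.exp (b * q) := by
          rw [mul_assoc, mul_assoc, e', mul_one]
      _ ≤ _ := this
      _ = _ := by ring
  have h3 : Real.exp (b * δ) ≤ 1 + 2 * (b * δ) := by
    have := Real.abs_exp_sub_one_sub_id_le (x := b * δ) (by rw [abs_of_nonneg hbd]; linarith)
    have := (abs_le.1 this).2
    nlinarith
  set ω := 4 * κ + b * δ with hω
  have hω0 : 0 < ω := by positivity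
  have h4 : (1 + κ) * (1 + 2 * (b * δ)) ≤ (1 - κ) * (1 + ω) ^ 2 := by
    rw [hω]
    nlinarith [mul_nonneg hκ.le hbd, mul_pos hκ hκ, mul_nonneg hκ.le (sub_nonneg.2 hκ'),
      mul_nonneg hκ.le (sub_nonneg.2 hbδ), mul_nonneg hbd hbd,
      mul_nonneg (mul_nonneg hbd hbd) (sub_nonneg.2 hκ'),
      mul_nonneg (mul_nonneg hκ.le hbd) (sub_nonneg.2 hκ'),
      mul_nonneg (mul_nonneg hκ.le hκ.le) (sub_nonneg.2 hκ')]
  have h5 : q ^ 2 ≤ ((1 + ω) * (δ - q)) ^ 2 := by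
    have hk : 0 < 1 - κ := by linarith
    rw [← mul_le_mul_iff_right₀ hk]
    calc (1 - κ) * q ^ 2 ≤ (1 + κ) * ((δ - q) ^ 2 * Real.exp (b * δ)) := h2
      _ ≤ (1 + κ) * ((δ - q) ^ 2 * (1 + 2 * (b * δ))) := by gcongr
      _ = (1 + κ) * (1 + 2 * (b * δ)) * (δ - q) ^ 2 := by ring
      _ ≤ (1 - κ) * (1 + ω) ^ 2 * (δ - q) ^ 2 := by gcongr
      _ = _ := by ring
  have h6 := (sq_le_sq₀ hq0.le (by positivity)).1 h5
  nlinarith [mul_le_mul_of_nonneg_left (show δ - q ≤ δ / 2 by linarith [hq.1]) hω0.le]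

open Classical in
/-- The left half-width `p` of the balanced cell with right half-width `q`. -/
def leftWidth (S : ℝ → ℝ) (b q : ℝ) : ℝ :=
  if h : ∃ p, 0 < p ∧ wint S (-b) p = wint S b q then h.choose else 0

theorem leftWidth_spec (hS : Continuous S) (hpos : ∀ t, 0 < t → 0 < S t) (hb : 0 ≤ b)
    (hq : 0 < q) : 0 < leftWidth S b q ∧ wint S (-b) (leftWidth S b q) = wint S b q := by
  obtain ⟨p, hp, -, hR⟩ := exists_balanced hS hpos hb hq
  have h : ∃ p, 0 < p ∧ wint S (-b) p = wint S b q := ⟨p, hp, hR⟩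
  unfold leftWidth
  rw [dif_pos h]
  exact h.choose_spec

theorem eq_leftWidth (hS : Continuous S) (hpos : ∀ t, 0 < t → 0 < S t) (hb : 0 ≤ b)
    (hq : 0 < q) (hp : 0 < p) (hR : wint S (-b) p = wint S b q) : p = leftWidth S b q := by
  obtain ⟨h1, h2⟩ := leftWidth_spec hS hpos hb hq
  exact (wint_strictMonoOn hS hpos (-b)).injOn (Set.mem_Ici.2 hp.le) (Set.mem_Ici.2 h1.le)
    (hR.trans h2.symm)

/-- The right half-widths of the cells `N, N - 1, …` of the lattice of spacing `δ`, where the cell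
number `k` is balanced with the slope `β k`, and the rightmost half-width is `δ / 2`. -/
def rightWidth (S : ℝ → ℝ) (β δ : ℝ) (N : ℕ) : ℕ → ℝ
  | 0 => δ / 2
  | n + 1 => δ - leftWidth S (β * ((N - n : ℕ) : ℝ)) (rightWidth S β δ N n)

/-- Let `Q n` be the fixed point for the slope used at step `n`. Slopes decrease in `n`, hence so
does `Q n`, and the total drift is at most `Q 0 - δ / 2`. Each step multiplies the distance to the
fixed point by at most `1 + 8 κ` and adds the drift `Q n - Q (n + 1)`; the invariant `main` records
this with the drift telescoped. -/
theorem NearLinear.abs_rightWidth_sub_le (h : NearLinear S κ δ) {β : ℝ} {N : ℕ} (hβ : 0 ≤ β)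
    (hN : 8 * κ * N ≤ 1) (hsmall : 4 * κ + β * N * δ ≤ 1 / 7) {n : ℕ} (hn : n ≤ N) :
    |rightWidth S β δ N n - δ / 2| ≤ 7 / 4 * (4 * κ + β * N * δ) * δ := by
  have hδ := h.δ_pos
  have hκ := h.κ_pos
  have hb0 : ∀ n : ℕ, 0 ≤ β * ((N - n : ℕ) : ℝ) := fun n => by positivity
  choose Q hQ1 hQ2 hQ3 using fun n : ℕ => h.exists_fixed (hb0 n)
  have hQanti : ∀ i j : ℕ, i ≤ j → Q j ≤ Q i := fun i j hij =>
    fixed_mono h.cont h.pos (mul_le_mul_of_nonneg_left (by gcongr) hβ)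
      ⟨by linarith [hQ1 j], (hQ2 j).le⟩ ⟨by linarith [hQ1 i], (hQ2 i).le⟩ (hQ3 j) (hQ3 i)
  have hQ0 : Q 0 - δ / 2 ≤ (4 * κ + β * N * δ) * δ / 4 := by
    have := h.fixed_le (hb0 0) (by simp only [Nat.sub_zero]; linarith) ⟨hQ1 0, hQ2 0⟩ (hQ3 0)
    simpa using this
  -- The assumption `8 κ N ≤ 1` keeps the compounded Lipschitz factor below `e`.
  have hpow : ∀ n ≤ N, (1 + 8 * κ) ^ n ≤ 3 := fun n hn => by
    calc (1 + 8 * κ) ^ n ≤ (Real.exp (8 * κ)) ^ n := by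
          gcongr
          linarith [Real.add_one_le_exp (8 * κ)]
      _ = Real.exp (n * (8 * κ)) := by rw [← Real.exp_nat_mul]
      _ ≤ Real.exp 1 := by
          apply Real.exp_le_exp.2
          have : (n : ℝ) ≤ N := by exact_mod_cast hn
          nlinarith
      _ ≤ 3 := Real.exp_one_lt_three.le
  -- The invariant gives `3 · 2` copies of `Q 0 - δ / 2`, the distance from `Q n` to `δ / 2` one
  -- more, and `fixed_le` divides by 4: hence `7 / 4`.
  have hdist : ∀ n ≤ N, |rightWidth S β δ N n - Q n| ≤
      (1 + 8 * κ) ^ n * ((Q 0 - δ / 2) + (Q 0 - Q n)) →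
      |rightWidth S β δ N n - δ / 2| ≤ 7 / 4 * (4 * κ + β * N * δ) * δ := fun n hn hle => by
    have h1 : (1 + 8 * κ) ^ n * ((Q 0 - δ / 2) + (Q 0 - Q n)) ≤ 3 * (2 * (Q 0 - δ / 2)) := by
      apply mul_le_mul (hpow n hn) (by linarith [hQ1 n])
        (by linarith [hQanti 0 n (Nat.zero_le _), hQ1 0]) (by norm_num)
    have h2 := _root_.abs_sub_le (rightWidth S β δ N n) (Q n) (δ / 2)
    have h3 : |Q n - δ / 2| ≤ Q 0 - δ / 2 := by
      rw [abs_of_nonneg (by linarith [hQ1 n])]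
      linarith [hQanti 0 n (Nat.zero_le _)]
    linarith
  have main : ∀ n ≤ N, |rightWidth S β δ N n - Q n| ≤
      (1 + 8 * κ) ^ n * ((Q 0 - δ / 2) + (Q 0 - Q n)) := by
    intro n
    induction n with
    | zero =>
      intro _
      have : rightWidth S β δ N 0 = δ / 2 := rfl
      rw [this, abs_sub_comm, abs_of_nonneg (by linarith [hQ1 0])]
      simp
    | succ n ih =>
      intro hn
      have hn' : n ≤ N := by omega
      have h1 := ih hn'
      have h2 := abs_le.1 (hdist n hn' h1)
      -- This keeps the current half-width in `[δ/4, 3δ/4]`, so that the Lipschitz estimate, valid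
      -- only on `(0, δ]`, applies at the next step.
      have h3 : 7 / 4 * (4 * κ + β * N * δ) * δ ≤ δ / 4 := by nlinarith
      obtain ⟨w1, w2⟩ := leftWidth_spec h.cont h.pos (hb0 n)
        (show 0 < rightWidth S β δ N n by linarith [h2.1])
      have h4 := h.abs_sub_le (hb0 n) (show 0 < δ - Q n by linarith [hQ2 n]) w1
        (⟨by linarith [hQ1 n], (hQ2 n).le⟩) ⟨by linarith [h2.1], by linarith [h2.2]⟩ (hQ3 n) w2
      have h5 : rightWidth S β δ N (n + 1) =
        δ - leftWidth S (β * ((N - n : ℕ) : ℝ)) (rightWidth S β δ N n) := rfl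
      have h6 := _root_.abs_sub_le (rightWidth S β δ N (n + 1)) (Q n) (Q (n + 1))
      have h7 : |rightWidth S β δ N (n + 1) - Q n| =
          |leftWidth S (β * ((N - n : ℕ) : ℝ)) (rightWidth S β δ N n) - (δ - Q n)| := by
        rw [h5, ← abs_neg]; ring_nf
      have h8 : |Q n - Q (n + 1)| = Q n - Q (n + 1) :=
        abs_of_nonneg (sub_nonneg.2 (hQanti n (n + 1) (Nat.le_succ n)))
      have h9 : (1 : ℝ) ≤ (1 + 8 * κ) ^ (n + 1) := one_le_pow₀ (by linarith)
      have h10 : Q n - Q (n + 1) ≤ (1 + 8 * κ) ^ (n + 1) * (Q n - Q (n + 1)) :=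
        le_mul_of_one_le_left (sub_nonneg.2 (hQanti n (n + 1) (Nat.le_succ n))) h9
      have h11 : (1 + 8 * κ) * |rightWidth S β δ N n - Q n| ≤
          (1 + 8 * κ) * ((1 + 8 * κ) ^ n * ((Q 0 - δ / 2) + (Q 0 - Q n))) := by gcongr
      rw [pow_succ'] at h10 ⊢
      nlinarith
  exact hdist n hn (main n hn)

end Balance

namespace BIAWGN

/-! ### The laws of the log-likelihood ratio -/

variable {σ : ℝ}

theorem mean_pos (hσ : 0 < σ) : 0 < mean σ := by unfold mean; positivity

theorem sd_pos (hσ : 0 < σ) : 0 < sd σ := by unfold sd; positivity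

theorem sd_sq (σ : ℝ) : sd σ ^ 2 = 2 * mean σ := by unfold sd mean; ring

theorem sd_sq_toNNReal_ne_zero (hσ : 0 < σ) : (sd σ ^ 2).toNNReal ≠ 0 := by
  have := sd_pos hσ
  simpa using by positivity

theorem coe_sd_sq (σ : ℝ) : ((sd σ ^ 2).toNNReal : ℝ) = 2 * mean σ := by
  rw [Real.coe_toNNReal _ (sq_nonneg _), sd_sq]

theorem gaussianPDFReal_neg_mean (m : ℝ) (v : NNReal) (hv : (v : ℝ) ≠ 0) (x : ℝ) :
    gaussianPDFReal (-m) v x = gaussianPDFReal m v x * Real.exp (-(2 * m * x / v)) := by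
  simp only [gaussianPDFReal, mul_assoc, ← Real.exp_add]
  congr 2
  field_simp
  ring

theorem LLR_eq (hσ : 0 < σ) (y : ℝ) : LLR σ y = mean σ * y := by
  have hv : ((σ ^ 2).toNNReal : ℝ) = σ ^ 2 := Real.coe_toNNReal _ (sq_nonneg _)
  have hv0 : (σ ^ 2).toNNReal ≠ 0 := by simpa using hσ.ne'
  have h := gaussianPDFReal_pos 1 (σ ^ 2).toNNReal y hv0
  unfold LLR mean
  rw [gaussianPDFReal_neg_mean 1 _ (by rw [hv]; positivity), hv, div_mul_eq_div_div,
    div_self h.ne', one_div, ← Real.exp_neg, Real.log_exp]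
  ring

theorem LLR_eq_fun (hσ : 0 < σ) : LLR σ = fun y => mean σ * y := funext (LLR_eq hσ)

theorem measurable_LLR (hσ : 0 < σ) : Measurable (LLR σ) := by
  rw [LLR_eq_fun hσ]; fun_prop

instance (σ x : ℝ) : IsProbabilityMeasure (law σ x) := by unfold law; infer_instance

theorem map_LLR_law (hσ : 0 < σ) (x : ℝ) :
    (law σ x).map (LLR σ) = gaussianReal (mean σ * x) (sd σ ^ 2).toNNReal := by
  rw [LLR_eq_fun hσ, law, gaussianReal_map_const_mul]
  congr 1
  ext
  rw [NNReal.coe_mul, Real.coe_toNNReal _ (sq_nonneg _), Real.coe_toNNReal _ (sq_nonneg _)]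
  unfold mean sd
  simp only [NNReal.coe_mk]
  field_simp

theorem muPlus_eq (hσ : 0 < σ) : muPlus σ = gaussianReal (mean σ) (sd σ ^ 2).toNNReal := by
  rw [muPlus, map_LLR_law hσ, mul_one]

theorem muMinus_eq (hσ : 0 < σ) : muMinus σ = gaussianReal (-mean σ) (sd σ ^ 2).toNNReal := by
  rw [muMinus, map_LLR_law hσ, mul_neg_one]

theorem isProbabilityMeasure_muPlus (hσ : 0 < σ) : IsProbabilityMeasure (muPlus σ) := by
  rw [muPlus_eq hσ]; infer_instance

theorem isProbabilityMeasure_muMinus (hσ : 0 < σ) : IsProbabilityMeasure (muMinus σ) := by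
  rw [muMinus_eq hσ]; infer_instance

theorem muMinus_eq_map_neg (hσ : 0 < σ) : muMinus σ = (muPlus σ).map fun x => -x := by
  rw [muMinus_eq hσ, muPlus_eq hσ, gaussianReal_map_neg]

/-- The density of `μ₊`. -/
def dens (σ x : ℝ) : ℝ := gaussianPDFReal (mean σ) (sd σ ^ 2).toNNReal x

theorem dens_pos (hσ : 0 < σ) (x : ℝ) : 0 < dens σ x :=
  gaussianPDFReal_pos _ _ _ (sd_sq_toNNReal_ne_zero hσ)

/-- The normalizing constant of `dens`. -/
def densConst (σ : ℝ) : ℝ :=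
  (√(2 * Real.pi * (2 * mean σ)))⁻¹ * Real.exp (-(mean σ / 4))

theorem densConst_pos (hσ : 0 < σ) : 0 < densConst σ := by
  have := mean_pos hσ
  unfold densConst
  positivity

theorem dens_eq (hσ : 0 < σ) (x : ℝ) :
    dens σ x = densConst σ * Real.exp (x / 2 - x ^ 2 / (4 * mean σ)) := by
  have := mean_pos hσ
  rw [dens, gaussianPDFReal, coe_sd_sq σ, densConst, mul_assoc (_⁻¹), ← Real.exp_add]
  congr 2
  field_simp
  ring

@[fun_prop]
theorem continuous_dens (σ : ℝ) : Continuous (dens σ) := by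
  have : dens σ = fun x => (√(2 * Real.pi * ((sd σ ^ 2).toNNReal : ℝ)))⁻¹ *
      Real.exp (-(x - mean σ) ^ 2 / (2 * ((sd σ ^ 2).toNNReal : ℝ))) := rfl
  rw [this]
  fun_prop

theorem muPlus_withDensity (hσ : 0 < σ) :
    muPlus σ = volume.withDensity fun x => ENNReal.ofReal (dens σ x) := by
  rw [muPlus_eq hσ, gaussianReal_of_var_ne_zero _ (sd_sq_toNNReal_ne_zero hσ)]
  rfl

/-- The log-likelihood ratio of the pair `μ₊, μ₋` at `x` is `x` itself, so the channel may be
replaced by its LLR. -/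
theorem muMinus_withDensity (hσ : 0 < σ) :
    muMinus σ = (muPlus σ).withDensity fun x => ENNReal.ofReal (Real.exp (-x)) := by
  rw [muPlus_withDensity hσ, ← withDensity_mul _ (by fun_prop) (by fun_prop), muMinus_eq hσ,
    gaussianReal_of_var_ne_zero _ (sd_sq_toNNReal_ne_zero hσ)]
  congr 1
  ext x
  have := mean_pos hσ
  rw [Pi.mul_apply, ← ENNReal.ofReal_mul (dens_pos hσ x).le, gaussianPDF,
    gaussianPDFReal_neg_mean _ _ (by rw [coe_sd_sq σ]; positivity), dens, coe_sd_sq σ]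
  congr 4
  field_simp

theorem law_neg_withDensity (hσ : 0 < σ) :
    law σ (-1) = (law σ 1).withDensity fun y => ENNReal.ofReal (Real.exp (-LLR σ y)) := by
  have hv : ((σ ^ 2).toNNReal : ℝ) = σ ^ 2 := Real.coe_toNNReal _ (sq_nonneg _)
  have hv0 : (σ ^ 2).toNNReal ≠ 0 := by simpa using hσ.ne'
  have := measurable_LLR hσ
  rw [law, law, gaussianReal_of_var_ne_zero _ hv0, gaussianReal_of_var_ne_zero _ hv0,
    ← withDensity_mul _ (by fun_prop) (by fun_prop)]
  congr 1
  ext x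
  rw [Pi.mul_apply, gaussianPDF, gaussianPDF,
    ← ENNReal.ofReal_mul (gaussianPDFReal_pos _ _ x hv0).le,
    gaussianPDFReal_neg_mean _ _ (by rw [hv]; positivity), LLR_eq hσ, hv, mean]
  congr 4
  ring

theorem integral_muPlus (hσ : 0 < σ) (g : ℝ → ℝ) : ∫ x, g x ∂muPlus σ = ∫ x, dens σ x * g x := by
  rw [muPlus_eq hσ, integral_gaussianReal_eq_integral_smul (sd_sq_toNNReal_ne_zero hσ)]
  rfl

theorem setIntegral_muPlus (hσ : 0 < σ) (g : ℝ → ℝ) {s : Set ℝ} (hs : MeasurableSet s) :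
    ∫ x in s, g x ∂muPlus σ = ∫ x in s, dens σ x * g x := by
  rw [← integral_indicator hs, integral_muPlus hσ, ← integral_indicator hs]
  congr 1
  ext x
  by_cases hx : x ∈ s <;> simp [hx]

theorem muPlus_real (hσ : 0 < σ) {s : Set ℝ} (hs : MeasurableSet s) :
    (muPlus σ).real s = ∫ x in s, dens σ x := by
  have := setIntegral_muPlus hσ (fun _ => 1) hs
  simpa using this

theorem muMinus_real_eq (hσ : 0 < σ) {s : Set ℝ} (hs : MeasurableSet s) :
    (muMinus σ).real s = ∫ x in s, Real.exp (-x) ∂muPlus σ := by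
  rw [muMinus_withDensity hσ, measureReal_def, withDensity_apply _ hs,
    integral_eq_lintegral_of_nonneg_ae (ae_of_all _ fun y => (Real.exp_pos _).le) (by fun_prop)]

theorem muMinus_real (hσ : 0 < σ) {s : Set ℝ} (hs : MeasurableSet s) :
    (muMinus σ).real s = ∫ x in s, dens σ x * Real.exp (-x) := by
  rw [muMinus_real_eq hσ hs, setIntegral_muPlus hσ _ hs]

theorem muMinus_real_eq_neg (hσ : 0 < σ) {s : Set ℝ} (hs : MeasurableSet s) :
    (muMinus σ).real s = (muPlus σ).real {x | -x ∈ s} := by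
  rw [muMinus_eq_map_neg hσ, measureReal_def, Measure.map_apply (by fun_prop) hs]
  rfl

theorem muPlus_real_Ico (hσ : 0 < σ) {u w : ℝ} (h : u ≤ w) :
    (muPlus σ).real (Set.Ico u w) = ∫ x in u..w, dens σ x := by
  rw [muPlus_real hσ measurableSet_Ico, intervalIntegral.integral_of_le h,
    integral_Ico_eq_integral_Ioc]

theorem muMinus_real_Ico (hσ : 0 < σ) {u w : ℝ} (h : u ≤ w) :
    (muMinus σ).real (Set.Ico u w) = ∫ x in u..w, dens σ x * Real.exp (-x) := by
  rw [muMinus_real hσ measurableSet_Ico, intervalIntegral.integral_of_le h,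
    integral_Ico_eq_integral_Ioc]

/-! ### Balanced cells of the lattice -/

/-- The weight `exp (-t² / (2 s²)) sinh (t / 2)`. -/
def kern (σ t : ℝ) : ℝ := Real.exp (-(t ^ 2 / (4 * mean σ))) * Real.sinh (t / 2)

@[fun_prop]
theorem continuous_kern (σ : ℝ) : Continuous (kern σ) := by unfold kern; fun_prop

theorem kern_neg (σ t : ℝ) : kern σ (-t) = -kern σ t := by
  unfold kern
  rw [neg_sq, neg_div, Real.sinh_neg]
  ring

theorem kern_pos (σ : ℝ) {t : ℝ} (ht : 0 < t) : 0 < kern σ t :=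
  mul_pos (Real.exp_pos _) (Real.sinh_pos_iff.2 (by linarith))

/-- The kernel is odd, so reflecting the interval flips the sign of the slope. This puts the left
half of a cell in the same form as the right half. -/
theorem wint_kern_neg (σ b x : ℝ) : wint (kern σ) (-b) (-x) = wint (kern σ) b x := by
  unfold wint
  have h := intervalIntegral.integral_comp_neg (a := 0) (b := x)
    (fun t => Real.exp (- -b * t) * kern σ t)
  have h' : ∫ t in (0 : ℝ)..x, Real.exp (- -b * -t) * kern σ (-t) =
      -∫ t in (0 : ℝ)..x, Real.exp (-b * t) * kern σ t := by
    rw [← intervalIntegral.integral_neg]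
    congr 1
    ext t
    rw [kern_neg]
    ring_nf
  rw [intervalIntegral.integral_symm, ← neg_zero, ← h, neg_zero, h', neg_neg]

theorem sinh_le_mul_exp {x : ℝ} (hx : 0 ≤ x) : Real.sinh x ≤ x * Real.exp (x ^ 2 / 2) := by
  have h1 : Real.sinh x ≤ x * Real.cosh x := by
    have hmono : MonotoneOn (fun x => x * Real.cosh x - Real.sinh x) (Set.Ici 0) := by
      apply monotoneOn_of_deriv_nonneg (convex_Ici 0) (Continuous.continuousOn (by fun_prop))
        (Differentiable.differentiableOn (by fun_prop))
      intro y hy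
      rw [interior_Ici, Set.mem_Ioi] at hy
      have hd : HasDerivAt (fun x => x * Real.cosh x - Real.sinh x)
          (1 * Real.cosh y + y * Real.sinh y - Real.cosh y) y :=
        ((hasDerivAt_id y).mul (Real.hasDerivAt_cosh y)).sub (Real.hasDerivAt_sinh y)
      rw [hd.deriv]
      have := Real.sinh_pos_iff.2 hy
      nlinarith [mul_pos hy this]
    have := hmono Set.self_mem_Ici (Set.mem_Ici.2 hx) hx
    simp only [zero_mul, Real.sinh_zero, sub_zero] at this
    linarith
  exact h1.trans (mul_le_mul_of_nonneg_left (Real.cosh_le_exp_half_sq x) hx)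

/-- The Gaussian factor costs `δ² / (4 m)` from below and `sinh` costs at most `δ²` from above; `κ`
is the sum of the two. -/
theorem nearLinear_kern (hσ : 0 < σ) {δ : ℝ} (hδ : 0 < δ) (hδ1 : δ ≤ 1)
    (hκ : (1 + 1 / (4 * mean σ)) * δ ^ 2 ≤ 1 / 8) :
    NearLinear (kern σ) ((1 + 1 / (4 * mean σ)) * δ ^ 2) δ := by
  have hm := mean_pos hσ
  have hi : 0 < 1 / (4 * mean σ) := by positivity
  refine ⟨continuous_kern σ, fun t ht => kern_pos σ ht, fun t ht => ?_, fun t ht => ?_,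
    by positivity, hκ, hδ⟩
  · have ht0 := ht.1
    have h1 : t / 2 ≤ Real.sinh (t / 2) := Real.self_le_sinh_iff.2 (by linarith)
    have h2 : 1 - (1 + 1 / (4 * mean σ)) * δ ^ 2 ≤ Real.exp (-(t ^ 2 / (4 * mean σ))) := by
      have e1 := Real.add_one_le_exp (-(t ^ 2 / (4 * mean σ)))
      have e2 : t ^ 2 ≤ δ ^ 2 := pow_le_pow_left₀ ht0 ht.2 2
      have e3 : t ^ 2 / (4 * mean σ) = 1 / (4 * mean σ) * t ^ 2 := by ring
      rw [e3] at e1 ⊢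
      nlinarith
    exact mul_le_mul h2 h1 (by linarith) (Real.exp_pos _).le
  · have ht0 := ht.1
    have h1 : Real.exp (-(t ^ 2 / (4 * mean σ))) ≤ 1 := Real.exp_le_one_iff.2 (by
      have : 0 ≤ t ^ 2 / (4 * mean σ) := by positivity
      linarith)
    have h2 : Real.exp ((t / 2) ^ 2 / 2) ≤ 1 + δ ^ 2 := by
      have e2 : t ^ 2 ≤ δ ^ 2 := pow_le_pow_left₀ ht0 ht.2 2
      have e4 : δ ^ 2 ≤ 1 := pow_le_one₀ hδ.le hδ1
      have e3 : |(t / 2) ^ 2 / 2| ≤ 1 := by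
        rw [abs_of_nonneg (by positivity)]; nlinarith
      have e5 := (abs_le.1 (Real.abs_exp_sub_one_le e3)).2
      rw [abs_of_nonneg (by positivity)] at e5
      nlinarith
    have h0 : 0 ≤ Real.sinh (t / 2) := Real.sinh_nonneg_iff.2 (by linarith)
    calc kern σ t ≤ 1 * Real.sinh (t / 2) := by unfold kern; gcongr
      _ ≤ t / 2 * (1 + δ ^ 2) := by
        rw [one_mul]
        exact (sinh_le_mul_exp (by linarith)).trans (by gcongr)
      _ ≤ _ := by
        rw [mul_comm]
        gcongr
        nlinarith [mul_pos hi (pow_pos hδ 2)]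

/-- With `x = c + t`, the factor `1 - exp (-t)` is `2 exp (-t/2) sinh (t/2)`, and its `exp (-t/2)`
cancels the `exp (t/2)` in the density. The linear term left in the exponent is `-c t / (2 m)`,
which is the slope. -/
theorem integral_dens_mul_sub (hσ : 0 < σ) (c p q : ℝ) :
    ∃ K : ℝ, 0 < K ∧ ∫ x in (c - p)..(c + q), dens σ x * (1 - Real.exp (c - x)) =
      K * (wint (kern σ) (c / (2 * mean σ)) q - wint (kern σ) (-(c / (2 * mean σ))) p) := by
  have hm := mean_pos hσ
  set b := c / (2 * mean σ) with hb
  refine ⟨2 * densConst σ * Real.exp (c / 2 - c ^ 2 / (4 * mean σ)),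
    by have := densConst_pos hσ; positivity, ?_⟩
  have h1 : ∀ t, dens σ (c + t) * (1 - Real.exp (c - (c + t))) =
      2 * densConst σ * Real.exp (c / 2 - c ^ 2 / (4 * mean σ)) *
        (Real.exp (-b * t) * kern σ t) := fun t => by
    have e1 : 1 - Real.exp (c - (c + t)) = 2 * (Real.exp (-(t / 2)) * Real.sinh (t / 2)) := by
      rw [Real.sinh_eq, mul_div_assoc', mul_div_cancel₀ _ two_ne_zero, mul_sub, ← Real.exp_add,
        ← Real.exp_add]
      ring_nf
      simp only [Real.exp_zero]
      ring
    have e2 : Real.exp ((c + t) / 2 - (c + t) ^ 2 / (4 * mean σ)) * Real.exp (-(t / 2)) =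
        Real.exp (c / 2 - c ^ 2 / (4 * mean σ)) *
          (Real.exp (-b * t) * Real.exp (-(t ^ 2 / (4 * mean σ)))) := by
      rw [← Real.exp_add, ← Real.exp_add, ← Real.exp_add, hb]
      congr 1
      field_simp
      ring
    rw [e1, dens_eq hσ, kern]
    linear_combination (2 * densConst σ * Real.sinh (t / 2)) * e2
  have hS := continuous_kern σ
  have hcont : Continuous fun t => Real.exp (-b * t) * kern σ t := by fun_prop
  rw [sub_eq_add_neg c p, ← intervalIntegral.integral_comp_add_left
    (fun x => dens σ x * (1 - Real.exp (c - x))) c (a := -p) (b := q)]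
  simp_rw [h1]
  rw [intervalIntegral.integral_const_mul,
    ← intervalIntegral.integral_interval_sub_left (hcont.intervalIntegrable 0 q)
      (hcont.intervalIntegrable 0 (-p))]
  have h2 : wint (kern σ) b (-p) = wint (kern σ) (-b) p := by
    have := wint_kern_neg σ (-b) p
    rwa [neg_neg] at this
  rw [← h2]
  rfl

/-- On an empty interval the ratio is `0 / 0` and its logarithm takes the default value 0, so a
nonzero lattice value forces the endpoints into order. -/
theorem lt_of_intervalLLR_ne_zero {u w : ℝ} (h : intervalLLR σ u w ≠ 0) : u < w := by
  by_contra! hle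
  apply h
  simp [intervalLLR, Set.Ico_eq_empty_of_le hle]

theorem intervalIntegral_pos_of_continuous {g : ℝ → ℝ} (hg : Continuous g) (hpos : ∀ x, 0 < g x)
    {u w : ℝ} (h : u < w) : 0 < ∫ x in u..w, g x :=
  intervalIntegral.intervalIntegral_pos_of_pos (hg.intervalIntegrable _ _) hpos h

/-- The interval LLR equals `c` exactly when `μ₊ - exp c * μ₋` vanishes on the cell. The condition
`-p < q` does not presuppose `p > 0`, which uniqueness needs. -/
theorem intervalLLR_eq_iff (hσ : 0 < σ) {c p q : ℝ} (h : -p < q) :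
    intervalLLR σ (c - p) (c + q) = c ↔
      wint (kern σ) (-(c / (2 * mean σ))) p = wint (kern σ) (c / (2 * mean σ)) q := by
  obtain ⟨K, hK, hE⟩ := integral_dens_mul_sub hσ c p q
  have hlt : c - p < c + q := by linarith
  have hP := intervalIntegral_pos_of_continuous (continuous_dens σ) (dens_pos hσ) hlt
  have hM := intervalIntegral_pos_of_continuous (g := fun x => dens σ x * Real.exp (-x))
    (by fun_prop) (fun x => mul_pos (dens_pos hσ x) (Real.exp_pos _)) hlt
  have h1 : ∫ x in (c - p)..(c + q), dens σ x * (1 - Real.exp (c - x)) =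
      (∫ x in (c - p)..(c + q), dens σ x) -
        Real.exp c * ∫ x in (c - p)..(c + q), dens σ x * Real.exp (-x) := by
    rw [← intervalIntegral.integral_const_mul, ← intervalIntegral.integral_sub
      (Continuous.intervalIntegrable (by fun_prop) _ _)
      (Continuous.intervalIntegrable (by fun_prop) _ _)]
    congr 1
    ext x
    rw [sub_eq_add_neg c x, Real.exp_add]
    ring
  rw [intervalLLR, muPlus_real_Ico hσ hlt.le, muMinus_real_Ico hσ hlt.le]
  rw [h1] at hE
  constructor
  · intro hlog
    have h2 := congrArg Real.exp hlog
    rw [Real.exp_log (div_pos hP hM), div_eq_iff hM.ne'] at h2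
    rw [h2, sub_self] at hE
    have := (mul_eq_zero.1 hE.symm).resolve_left hK.ne'
    linarith
  · intro hw
    rw [hw, sub_self, mul_zero, sub_eq_zero] at hE
    rw [hE, mul_div_cancel_right₀ _ hM.ne', Real.log_exp]

/-- Given its right endpoint and its lattice value, a cell has only one possible left endpoint; this
is the inductive step for uniqueness of the cutoffs. -/
theorem eq_sub_leftWidth (hσ : 0 < σ) {c q u : ℝ} (hc : 0 < c) (hq : 0 < q)
    (h : intervalLLR σ u (c + q) = c) :
    u = c - leftWidth (kern σ) (c / (2 * mean σ)) q := by
  have hm := mean_pos hσ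
  have hlt : u < c + q := lt_of_intervalLLR_ne_zero (by rw [h]; exact hc.ne')
  have hb : 0 ≤ c / (2 * mean σ) := by positivity
  have h' : intervalLLR σ (c - (c - u)) (c + q) = c := by rwa [sub_sub_cancel]
  rw [intervalLLR_eq_iff hσ (by linarith)] at h'
  have hmono := wint_strictMonoOn (continuous_kern σ) (fun t ht => kern_pos σ ht)
  -- A left endpoint at or beyond the centre turns balance into equality of `wint` at `u - c` and at
  -- `q`, forcing `u = c + q`.
  have hu : 0 < c - u := by
    by_contra! hneg
    rw [← neg_neg (c - u), wint_kern_neg] at h'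
    have := (hmono _).injOn (Set.mem_Ici.2 (by linarith)) (Set.mem_Ici.2 hq.le) h'
    linarith
  rw [← eq_leftWidth (continuous_kern σ) (fun t ht => kern_pos σ ht) hb hq hu h', sub_sub_cancel]

/-- The cutoffs of the exact lattice: `a (k + 1) = k δ + q_k` with the right half-widths `q_k`. -/
def cutoff (σ : ℝ) (L : ℕ) (T : ℝ) (k : ℕ) : ℝ :=
  ((k : ℝ) - 1) * spacing L T +
    rightWidth (kern σ) (spacing L T / (2 * mean σ)) (spacing L T) (L - 1) (L - k)

/-- The constant in the deviation bound of the cutoffs. -/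
def devConst (σ : ℝ) : ℝ := 4 * (1 + 1 / (4 * mean σ)) + 1 / (2 * mean σ)

theorem four_lt_devConst (hσ : 0 < σ) : 4 < devConst σ := by
  have := mean_pos hσ
  have h1 : 0 < 1 / (4 * mean σ) := by positivity
  have h2 : 0 < 1 / (2 * mean σ) := by positivity
  unfold devConst
  linarith

theorem spacing_pos {L : ℕ} (hL : 1 ≤ L) {T : ℝ} (hT : 0 < T) : 0 < spacing L T := by
  have : (1 : ℝ) ≤ L := by exact_mod_cast hL
  exact div_pos hT (by linarith)

theorem spacing_mul {L : ℕ} (hL : 1 ≤ L) (T : ℝ) : ((L : ℝ) - 1 / 2) * spacing L T = T := by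
  have : (1 : ℝ) ≤ L := by exact_mod_cast hL
  exact mul_div_cancel₀ _ (by linarith)

/-- Here `κ = (1 + 1/(4m)) δ²`, and the slope of cell `k` is `k δ / (2 m)`, so `β = δ / (2 m)` and
`N = L - 1`. Since `N δ ≤ T`, all error terms are controlled by `(1 + T) δ`, with `devConst`
collecting their constants. -/
theorem abs_rightWidth_kern_sub_le (hσ : 0 < σ) {L : ℕ} (hL : 1 ≤ L) {T : ℝ} (hT : 0 < T)
    (hsmall : 7 * devConst σ * ((1 + T) * spacing L T) ≤ 1) {n : ℕ} (hn : n ≤ L - 1) :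
    |rightWidth (kern σ) (spacing L T / (2 * mean σ)) (spacing L T) (L - 1) n - spacing L T / 2| ≤
      7 / 4 * (devConst σ * ((1 + T) * spacing L T)) * spacing L T := by
  have hm := mean_pos hσ
  have hδ := spacing_pos hL hT
  have hTδ := spacing_mul hL T
  set δ := spacing L T with hδdef
  have hN : ((L - 1 : ℕ) : ℝ) * δ ≤ T := by
    push_cast [hL]
    nlinarith
  have hD := four_lt_devConst hσ
  have hx : δ ≤ (1 + T) * δ := by nlinarith
  have hx1 : (1 + T) * δ ≤ 1 / 28 := by nlinarith [mul_pos (show 0 < 1 + T by linarith) hδ]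
  have hi : 0 < 1 / (4 * mean σ) := by positivity
  set K0 := 1 + 1 / (4 * mean σ) with hK0
  have hDK : devConst σ = 4 * K0 + 1 / (2 * mean σ) := rfl
  have hi2 : 0 < 1 / (2 * mean σ) := by positivity
  have hK0p : 1 < K0 := by linarith
  have hxx : 0 < (1 + T) * δ := by nlinarith
  have hκ : K0 * δ ^ 2 ≤ K0 * ((1 + T) * δ) := by
    apply mul_le_mul_of_nonneg_left _ (by linarith)
    nlinarith
  have hb : 28 * (K0 * ((1 + T) * δ)) ≤ 1 := by
    rw [hDK] at hsmall
    nlinarith [mul_pos hi2 hxx]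
  have hβ : δ / (2 * mean σ) * ((L - 1 : ℕ) : ℝ) * δ ≤ 1 / (2 * mean σ) * ((1 + T) * δ) := by
    calc δ / (2 * mean σ) * ((L - 1 : ℕ) : ℝ) * δ =
        1 / (2 * mean σ) * ((((L - 1 : ℕ) : ℝ) * δ) * δ) := by ring
      _ ≤ _ := by gcongr; linarith
  have hsum : 4 * (K0 * δ ^ 2) + δ / (2 * mean σ) * ((L - 1 : ℕ) : ℝ) * δ ≤
      devConst σ * ((1 + T) * δ) := by
    rw [hDK]; linarith
  have hnl := nearLinear_kern hσ hδ (by linarith) (show K0 * δ ^ 2 ≤ 1 / 8 by linarith)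
  have := hnl.abs_rightWidth_sub_le (β := δ / (2 * mean σ)) (N := L - 1) (by positivity)
    (by
      have : K0 * δ ^ 2 * ((L - 1 : ℕ) : ℝ) ≤ K0 * ((1 + T) * δ) := by
        calc K0 * δ ^ 2 * ((L - 1 : ℕ) : ℝ) = K0 * (δ * (((L - 1 : ℕ) : ℝ) * δ)) := by ring
          _ ≤ K0 * (δ * T) := by gcongr
          _ ≤ _ := by nlinarith
      linarith) (by linarith) hn
  refine this.trans ?_
  gcongr

theorem abs_cutoff_sub_le (hσ : 0 < σ) {L : ℕ} (hL : 1 ≤ L) {T : ℝ} (hT : 0 < T)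
    (hsmall : 7 * devConst σ * ((1 + T) * spacing L T) ≤ 1) {k : ℕ} (hk : k ∈ Set.Icc 1 L) :
    |cutoff σ L T k - ((k : ℝ) - 1 / 2) * spacing L T| ≤
      7 / 4 * (devConst σ * ((1 + T) * spacing L T)) * spacing L T := by
  have := abs_rightWidth_kern_sub_le hσ hL hT hsmall (n := L - k) (by have := hk.1; omega)
  convert this using 2
  unfold cutoff
  ring

theorem rightWidth_kern_pos (hσ : 0 < σ) {L : ℕ} (hL : 1 ≤ L) {T : ℝ} (hT : 0 < T)
    (hsmall : 7 * devConst σ * ((1 + T) * spacing L T) ≤ 1) {n : ℕ} (hn : n ≤ L - 1) :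
    0 < rightWidth (kern σ) (spacing L T / (2 * mean σ)) (spacing L T) (L - 1) n := by
  have h := (abs_le.1 (abs_rightWidth_kern_sub_le hσ hL hT hsmall hn)).1
  have hδ := spacing_pos hL hT
  nlinarith

theorem cutoff_eq_sub (σ : ℝ) {L : ℕ} (T : ℝ) {k : ℕ} (hk : 1 ≤ k) (hkL : k < L) :
    cutoff σ L T k = k * spacing L T - leftWidth (kern σ) (k * spacing L T / (2 * mean σ))
      (rightWidth (kern σ) (spacing L T / (2 * mean σ)) (spacing L T) (L - 1) (L - 1 - k)) := by
  have h1 : L - k = (L - 1 - k) + 1 := by omega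
  have h2 : L - 1 - (L - 1 - k) = k := by omega
  unfold cutoff
  rw [h1, rightWidth, h2]
  ring_nf

theorem cutoff_succ (σ : ℝ) {L : ℕ} (T : ℝ) (k : ℕ) :
    cutoff σ L T (k + 1) = k * spacing L T +
      rightWidth (kern σ) (spacing L T / (2 * mean σ)) (spacing L T) (L - 1) (L - 1 - k) := by
  unfold cutoff
  rw [show L - (k + 1) = L - 1 - k by omega]
  push_cast
  ring

theorem cutoff_last (σ : ℝ) {L : ℕ} (hL : 1 ≤ L) (T : ℝ) : cutoff σ L T L = T := by
  unfold cutoff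
  rw [Nat.sub_self, rightWidth]
  linarith [spacing_mul hL T]

theorem isCutoffs_cutoff (hσ : 0 < σ) {L : ℕ} (hL : 1 ≤ L) {T : ℝ} (hT : 0 < T)
    (hsmall : 7 * devConst σ * ((1 + T) * spacing L T) ≤ 1) : IsCutoffs σ L T (cutoff σ L T) := by
  refine ⟨cutoff_last σ hL T, fun k hk hkL => ?_⟩
  have hm := mean_pos hσ
  have hδ := spacing_pos hL hT
  have hq := rightWidth_kern_pos hσ hL hT hsmall (n := L - 1 - k) (by omega)
  obtain ⟨w1, w2⟩ := leftWidth_spec (continuous_kern σ) (fun t ht => kern_pos σ ht)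
    (show 0 ≤ (k : ℝ) * spacing L T / (2 * mean σ) by positivity) hq
  rw [cutoff_eq_sub σ T hk hkL, cutoff_succ, intervalLLR_eq_iff hσ (by linarith)]
  exact w2

theorem IsCutoffs.eq_cutoff (hσ : 0 < σ) {L : ℕ} (hL : 1 ≤ L) {T : ℝ} (hT : 0 < T)
    (hsmall : 7 * devConst σ * ((1 + T) * spacing L T) ≤ 1) {a : ℕ → ℝ}
    (ha : IsCutoffs σ L T a) {k : ℕ} (hk : k ∈ Set.Icc 1 L) : a k = cutoff σ L T k := by
  obtain ⟨hk1, hkL⟩ := hk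
  induction hkL using Nat.decreasingInduction with
  | self => rw [ha.last, cutoff_last σ hL]
  | of_succ k hk ih =>
    have h1 := ih (by omega)
    have h2 := ha.step k hk1 hk
    have hδ := spacing_pos hL hT
    rw [h1, cutoff_succ] at h2
    rw [eq_sub_leftWidth hσ (by have : 0 < k := hk1; positivity)
      (rightWidth_kern_pos hσ hL hT hsmall (by omega)) h2, cutoff_eq_sub σ T hk1 hk]

theorem cutoff_one_pos (hσ : 0 < σ) {L : ℕ} (hL : 1 ≤ L) {T : ℝ} (hT : 0 < T)
    (hsmall : 7 * devConst σ * ((1 + T) * spacing L T) ≤ 1) : 0 < cutoff σ L T 1 := by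
  have h := (abs_le.1 (abs_cutoff_sub_le hσ hL hT hsmall (k := 1) ⟨le_rfl, hL⟩)).1
  have hδ := spacing_pos hL hT
  push_cast at h
  nlinarith

/-- The smallness condition bounds each deviation from the midpoint grid by `δ / 4`, which is less
than half the grid step. -/
theorem strictMonoOn_cutoff (hσ : 0 < σ) {L : ℕ} (hL : 1 ≤ L) {T : ℝ} (hT : 0 < T)
    (hsmall : 7 * devConst σ * ((1 + T) * spacing L T) ≤ 1) :
    StrictMonoOn (cutoff σ L T) (Set.Icc 1 L) := by
  have hδ := spacing_pos hL hT
  intro i hi j hj hij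
  have h1 := (abs_le.1 (abs_cutoff_sub_le hσ hL hT hsmall hi)).2
  have h2 := (abs_le.1 (abs_cutoff_sub_le hσ hL hT hsmall hj)).1
  have h3 : (i : ℝ) + 1 ≤ j := by exact_mod_cast hij
  nlinarith

end BIAWGN

namespace BIAWGN

/-! ### The tail cell -/

variable {σ : ℝ}

/-- The Gaussian Laplace transform `∫₀^∞ exp (-θ y - y² / (2 s²)) dy`. -/
def tailLaplace (σ θ : ℝ) : ℝ :=
  ∫ y in Set.Ioi (0 : ℝ), Real.exp (-(θ * y) - y ^ 2 / (4 * mean σ))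

theorem integrable_exp_quadratic (hσ : 0 < σ) (θ : ℝ) :
    Integrable fun y => Real.exp (-(θ * y) - y ^ 2 / (4 * mean σ)) := by
  have hm := mean_pos hσ
  have h1 := (integrable_gaussianPDFReal (-(2 * mean σ * θ)) (sd σ ^ 2).toNNReal).const_mul
    (√(2 * Real.pi * (2 * mean σ)) * Real.exp (mean σ * θ ^ 2))
  refine h1.congr (ae_of_all _ fun y => ?_)
  have h2 : √(2 * Real.pi * (2 * mean σ)) ≠ 0 := by positivity
  simp only [gaussianPDFReal, coe_sd_sq]
  rw [mul_comm √_ (Real.exp _), mul_assoc, mul_inv_cancel_left₀ h2, ← Real.exp_add]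
  congr 1
  field_simp
  ring

theorem tailLaplace_pos (hσ : 0 < σ) (θ : ℝ) : 0 < tailLaplace σ θ := by
  apply (setIntegral_pos_iff_support_of_nonneg_ae (ae_of_all _ fun y => (Real.exp_pos _).le)
    (integrable_exp_quadratic hσ θ).integrableOn).2
  have : (Function.support fun y => Real.exp (-(θ * y) - y ^ 2 / (4 * mean σ))) = Set.univ := by
    ext y; simp [(Real.exp_pos _).ne']
  rw [this, Set.univ_inter]
  simp

theorem dens_add (hσ : 0 < σ) (t y : ℝ) :
    dens σ (t + y) = dens σ t *
      Real.exp (-((t - mean σ) / (2 * mean σ) * y) - y ^ 2 / (4 * mean σ)) := by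
  have hm := mean_pos hσ
  rw [dens_eq hσ, dens_eq hσ, mul_assoc, ← Real.exp_add]
  congr 2
  field_simp
  ring

theorem setIntegral_Ioi_eq_add (g : ℝ → ℝ) (t : ℝ) :
    ∫ x in Set.Ioi t, g x = ∫ y in Set.Ioi 0, g (t + y) := by
  rw [← (measurePreserving_add_left volume t).setIntegral_preimage_emb
    (measurableEmbedding_addLeft t) g (Set.Ioi t)]
  simp

theorem muPlus_real_Ioi (hσ : 0 < σ) (t : ℝ) :
    (muPlus σ).real (Set.Ioi t) = dens σ t * tailLaplace σ ((t - mean σ) / (2 * mean σ)) := by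
  rw [muPlus_real hσ measurableSet_Ioi, tailLaplace, ← integral_const_mul]
  rw [setIntegral_Ioi_eq_add]
  simp_rw [dens_add hσ]

theorem muMinus_real_Ioi (hσ : 0 < σ) (t : ℝ) :
    (muMinus σ).real (Set.Ioi t) =
      dens σ t * Real.exp (-t) * tailLaplace σ ((t - mean σ) / (2 * mean σ) + 1) := by
  rw [muMinus_real hσ measurableSet_Ioi, tailLaplace, ← integral_const_mul]
  rw [setIntegral_Ioi_eq_add]
  congr 1
  ext y
  rw [dens_add hσ, mul_assoc, mul_assoc (dens σ t), ← Real.exp_add, ← Real.exp_add]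
  ring_nf

theorem gaussianReal_real_Ioi (m : ℝ) {s : ℝ} (hs : 0 < s) (t : ℝ) :
    (gaussianReal m (s ^ 2).toNNReal).real (Set.Ioi t) = 1 - Phi ((t - m) / s) := by
  have h1 : gaussianReal m (s ^ 2).toNNReal = (gaussianReal 0 1).map fun x => m + s * x := by
    have : (fun x : ℝ => m + s * x) = (fun x => m + x) ∘ fun x => s * x := rfl
    rw [this, ← Measure.map_map (by fun_prop) (by fun_prop), gaussianReal_map_const_mul,
      gaussianReal_map_const_add]
    congr 1
    · ring
    · ext
      simp [sq_nonneg]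
  have h2 : (fun x => m + s * x) ⁻¹' Set.Ioi t = (Set.Iic ((t - m) / s))ᶜ := by
    ext x
    rw [Set.mem_preimage, Set.mem_Ioi, Set.mem_compl_iff, Set.mem_Iic, not_le, div_lt_iff₀ hs]
    constructor <;> intro h <;> linarith
  rw [h1, map_measureReal_apply (by fun_prop) measurableSet_Ioi, h2,
    measureReal_compl measurableSet_Iic, Phi, cdf_eq_real]
  simp

theorem tailLLR_eq_log (hσ : 0 < σ) (t : ℝ) :
    tailLLR σ t = Real.log ((muPlus σ).real (Set.Ioi t) / (muMinus σ).real (Set.Ioi t)) := by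
  rw [muPlus_eq hσ, muMinus_eq hσ, gaussianReal_real_Ioi _ (sd_pos hσ),
    gaussianReal_real_Ioi _ (sd_pos hσ), sub_neg_eq_add, tailLLR]

/-- Factoring the density at `t` out of both tails leaves Laplace transforms at `θ` and `θ + 1`; the
factor `exp (-t)` of `μ₋` supplies the leading term `t`. -/
theorem tailLLR_eq (hσ : 0 < σ) (t : ℝ) :
    tailLLR σ t = t - Real.log (tailLaplace σ ((t - mean σ) / (2 * mean σ) + 1) /
      tailLaplace σ ((t - mean σ) / (2 * mean σ))) := by
  have h1 := tailLaplace_pos hσ ((t - mean σ) / (2 * mean σ))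
  have h2 := tailLaplace_pos hσ ((t - mean σ) / (2 * mean σ) + 1)
  have h3 := dens_pos hσ t
  rw [tailLLR_eq_log hσ, muPlus_real_Ioi hσ, muMinus_real_Ioi hσ,
    Real.log_div (by positivity) (by positivity), Real.log_mul (by positivity) (by positivity),
    Real.log_mul (by positivity) (by positivity), Real.log_mul (by positivity) (by positivity),
    Real.log_exp, Real.log_div (by positivity) (by positivity)]
  ring

theorem integrable_exp_mul_exp_quadratic (hσ : 0 < σ) (a θ : ℝ) :
    Integrable fun y => Real.exp (-(a * y)) * Real.exp (-(θ * y) - y ^ 2 / (4 * mean σ)) := by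
  refine (integrable_exp_quadratic hσ (θ + a)).congr (ae_of_all _ fun y => ?_)
  simp only
  rw [← Real.exp_add]
  ring_nf

theorem setIntegral_exp_mul (σ a θ : ℝ) :
    ∫ y in Set.Ioi (0 : ℝ), Real.exp (-(a * y)) * Real.exp (-(θ * y) - y ^ 2 / (4 * mean σ)) =
      tailLaplace σ (θ + a) := by
  unfold tailLaplace
  congr 1
  ext y
  rw [← Real.exp_add]
  ring_nf

/-- Chebyshev's correlation inequality: under the weight at `θ`, the decreasing functions `exp (-d
y)` and `exp (-y)` are positively correlated. -/
theorem tailLaplace_ratio_mono (hσ : 0 < σ) {θ θ' : ℝ} (h : θ ≤ θ') :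
    tailLaplace σ (θ + 1) / tailLaplace σ θ ≤ tailLaplace σ (θ' + 1) / tailLaplace σ θ' := by
  have hN := tailLaplace_pos hσ θ
  have hN1 := tailLaplace_pos hσ (θ + 1)
  have hN' := tailLaplace_pos hσ θ'
  set c := tailLaplace σ (θ + 1) / tailLaplace σ θ with hc
  have hc0 : 0 < c := div_pos hN1 hN
  set d := θ' - θ with hd
  have hd0 : 0 ≤ d := sub_nonneg.2 h
  -- At `y0` the function `exp (-y)` equals its weighted mean `c`. Centring the other factor at the
  -- same point makes the product nonnegative everywhere, and the terms carrying `g0` integrate to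
  -- zero.
  set y0 := -Real.log c with hy0
  have hcy : c = Real.exp (-(1 * y0)) := by rw [hy0, one_mul, neg_neg, Real.exp_log hc0]
  set w : ℝ → ℝ := fun y => Real.exp (-(θ * y) - y ^ 2 / (4 * mean σ)) with hw
  have i0 : IntegrableOn w (Set.Ioi 0) := (integrable_exp_quadratic hσ θ).integrableOn
  have i1 : IntegrableOn (fun y => Real.exp (-(1 * y)) * w y) (Set.Ioi 0) :=
    (integrable_exp_mul_exp_quadratic hσ 1 θ).integrableOn
  have i2 : IntegrableOn (fun y => Real.exp (-(d * y)) * w y) (Set.Ioi 0) :=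
    (integrable_exp_mul_exp_quadratic hσ d θ).integrableOn
  have i3 : IntegrableOn (fun y => Real.exp (-((d + 1) * y)) * w y) (Set.Ioi 0) :=
    (integrable_exp_mul_exp_quadratic hσ (d + 1) θ).integrableOn
  set g0 := Real.exp (-(d * y0)) with hg0
  have key : 0 ≤ ∫ y in Set.Ioi (0 : ℝ),
      ((Real.exp (-((d + 1) * y)) * w y - c * (Real.exp (-(d * y)) * w y)) -
        (g0 * (Real.exp (-(1 * y)) * w y) - g0 * c * w y)) := by
    apply integral_nonneg
    intro y
    have e : Real.exp (-((d + 1) * y)) = Real.exp (-(d * y)) * Real.exp (-(1 * y)) := by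
      rw [← Real.exp_add]; ring_nf
    have hwy : 0 < w y := Real.exp_pos _
    have hprod : 0 ≤ (Real.exp (-(d * y)) - g0) * (Real.exp (-(1 * y)) - c) := by
      rw [hcy]
      rcases le_total y y0 with hle | hle
      · exact mul_nonneg (sub_nonneg.2 (Real.exp_le_exp.2 (by nlinarith)))
          (sub_nonneg.2 (Real.exp_le_exp.2 (by linarith)))
      · exact mul_nonneg_of_nonpos_of_nonpos (sub_nonpos.2 (Real.exp_le_exp.2 (by nlinarith)))
          (sub_nonpos.2 (Real.exp_le_exp.2 (by linarith)))
    have := mul_nonneg hprod hwy.le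
    simp only [Pi.zero_apply]
    rw [e]
    linarith
  have j1 : IntegrableOn (fun y => Real.exp (-((d + 1) * y)) * w y -
      c * (Real.exp (-(d * y)) * w y)) (Set.Ioi 0) := i3.sub (i2.const_mul c)
  have j2 : IntegrableOn (fun y => g0 * (Real.exp (-(1 * y)) * w y) - g0 * c * w y)
      (Set.Ioi 0) := (i1.const_mul g0).sub (i0.const_mul (g0 * c))
  rw [integral_sub j1 j2,
    integral_sub i3 (i2.const_mul c), integral_sub (i1.const_mul g0) (i0.const_mul (g0 * c)),
    integral_const_mul, integral_const_mul, integral_const_mul,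
    setIntegral_exp_mul, setIntegral_exp_mul, setIntegral_exp_mul] at key
  have e1 : ∫ y in Set.Ioi (0 : ℝ), w y = tailLaplace σ θ := rfl
  have e2 : θ + (d + 1) = θ' + 1 := by rw [hd]; ring
  have e3 : θ + d = θ' := by rw [hd]; ring
  have e4 : c * tailLaplace σ θ = tailLaplace σ (θ + 1) := div_mul_cancel₀ _ hN.ne'
  rw [e1, e2, e3, mul_assoc g0, e4, sub_self, sub_zero] at key
  rw [le_div_iff₀ hN']
  linarith

theorem tailLaplace_le (hσ : 0 < σ) {θ : ℝ} (hθ : 0 < θ) : tailLaplace σ θ ≤ 1 / θ := by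
  have hm := mean_pos hσ
  have h1 : ∫ y in Set.Ioi (0 : ℝ), Real.exp (-θ * y) = 1 / θ := by
    rw [integral_exp_mul_Ioi (by linarith) 0]
    simp
  rw [← h1]
  apply setIntegral_mono_on (integrable_exp_quadratic hσ θ).integrableOn
    (integrableOn_exp_mul_Ioi (by linarith) 0) measurableSet_Ioi
  intro y _
  apply Real.exp_le_exp.2
  have : 0 ≤ y ^ 2 / (4 * mean σ) := by positivity
  linarith

/-- The constant in the lower bound of the excess of `ℓ_tail`. -/
def excessConst (σ : ℝ) : ℝ := Real.exp (-1 - 1 / (4 * mean σ)) / 4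

theorem excessConst_pos (σ : ℝ) : 0 < excessConst σ := by unfold excessConst; positivity

/-- The difference of the transforms is the integral of `(1 - exp (-y)) w y`. Restricted to `[0,
1/θ]`, where `w` is bounded below and `1 - exp (-y) ≥ y / 2`, it is at least a constant times `1 /
θ²`; dividing by the transform, which is at most `1 / θ`, leaves order `1 / θ`. -/
theorem tailLaplace_ratio_le (hσ : 0 < σ) {θ : ℝ} (hθ : 1 ≤ θ) :
    excessConst σ / θ ≤ 1 - tailLaplace σ (θ + 1) / tailLaplace σ θ := by
  have hm := mean_pos hσ
  have hN := tailLaplace_pos hσ θ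
  have hθ0 : 0 < θ := by linarith
  have h1θ : 1 / θ ≤ 1 := by rw [div_le_one hθ0]; exact hθ
  have h1θ' : 0 < 1 / θ := by positivity
  set w : ℝ → ℝ := fun y => Real.exp (-(θ * y) - y ^ 2 / (4 * mean σ)) with hw
  have i0 : IntegrableOn w (Set.Ioi 0) := (integrable_exp_quadratic hσ θ).integrableOn
  have i1 : IntegrableOn (fun y => Real.exp (-(1 * y)) * w y) (Set.Ioi 0) :=
    (integrable_exp_mul_exp_quadratic hσ 1 θ).integrableOn
  have e1 : tailLaplace σ θ - tailLaplace σ (θ + 1) =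
      ∫ y in Set.Ioi (0 : ℝ), (w y - Real.exp (-(1 * y)) * w y) := by
    rw [integral_sub i0 i1, setIntegral_exp_mul]
    rfl
  have e2 : ∫ y in (0 : ℝ)..(1 / θ), 2 * excessConst σ * y ≤
      ∫ y in Set.Ioi (0 : ℝ), (w y - Real.exp (-(1 * y)) * w y) := by
    rw [intervalIntegral.integral_of_le h1θ'.le]
    calc ∫ y in Set.Ioc 0 (1 / θ), 2 * excessConst σ * y ≤
        ∫ y in Set.Ioc 0 (1 / θ), (w y - Real.exp (-(1 * y)) * w y) := by
          apply setIntegral_mono_on (Continuous.integrableOn_Ioc (by fun_prop))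
            ((i0.sub i1).mono_set Set.Ioc_subset_Ioi_self) measurableSet_Ioc
          intro y hy
          have hy0 := hy.1
          have hy1 : y ≤ 1 := hy.2.trans h1θ
          have a1 : θ * y ≤ 1 := by
            have := mul_le_mul_of_nonneg_left hy.2 hθ0.le
            rwa [mul_one_div_cancel hθ0.ne'] at this
          have a2 : Real.exp (-1 - 1 / (4 * mean σ)) ≤ w y := by
            apply Real.exp_le_exp.2
            have : y ^ 2 / (4 * mean σ) ≤ 1 / (4 * mean σ) := by
              gcongr
              nlinarith
            linarith
          have a3 : Real.exp (-(1 * y)) ≤ 1 - y / 2 := by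
            rw [one_mul, Real.exp_neg, inv_le_iff_one_le_mul₀ (Real.exp_pos _)]
            nlinarith [Real.add_one_le_exp y]
          have a4 : y / 2 * Real.exp (-1 - 1 / (4 * mean σ)) ≤
            (1 - Real.exp (-(1 * y))) * w y :=
            mul_le_mul (by linarith) a2 (Real.exp_pos _).le (by linarith)
          simp only [excessConst, Pi.sub_apply]
          linarith
      _ ≤ _ := by
          apply setIntegral_mono_set (i0.sub i1)
          · refine (ae_restrict_iff' measurableSet_Ioi).2 (ae_of_all _ fun y hy => ?_)
            have hy0 : 0 < y := hy
            have : Real.exp (-(1 * y)) ≤ 1 := Real.exp_le_one_iff.2 (by linarith)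
            have hwy : 0 < w y := Real.exp_pos _
            simp only [Pi.zero_apply, Pi.sub_apply]
            nlinarith
          · exact Set.Ioc_subset_Ioi_self.eventuallyLE
  rw [intervalIntegral.integral_const_mul, integral_id, ← e1] at e2
  have e3 := tailLaplace_le hσ hθ0
  rw [le_sub_comm, div_le_iff₀ hN]
  have hc := excessConst_pos σ
  have e4 : excessConst σ / θ * tailLaplace σ θ ≤ excessConst σ / θ * (1 / θ) := by gcongr
  have e5 : 2 * excessConst σ * (((1 / θ) ^ 2 - 0 ^ 2) / 2) = excessConst σ / θ * (1 / θ) := by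
    ring
  linarith

theorem tailLLR_sub_antitone (hσ : 0 < σ) : Antitone fun t => tailLLR σ t - t := by
  intro t t' h
  have hm := mean_pos hσ
  simp only [tailLLR_eq hσ]
  have h1 := tailLaplace_ratio_mono hσ (θ := (t - mean σ) / (2 * mean σ))
    (θ' := (t' - mean σ) / (2 * mean σ)) (by gcongr)
  have h2 := Real.log_le_log (div_pos (tailLaplace_pos hσ _) (tailLaplace_pos hσ _)) h1
  linarith

theorem le_tailLLR_sub (hσ : 0 < σ) {t : ℝ} (ht : 3 * mean σ ≤ t) :
    excessConst σ * (2 * mean σ) / t ≤ tailLLR σ t - t := by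
  have hm := mean_pos hσ
  have hc := excessConst_pos σ
  have hθ : 1 ≤ (t - mean σ) / (2 * mean σ) := by
    rw [le_div_iff₀ (by positivity)]; linarith
  rw [tailLLR_eq hσ]
  have h1 := tailLaplace_ratio_le hσ hθ
  have h2 := Real.log_le_sub_one_of_pos (div_pos
    (tailLaplace_pos hσ ((t - mean σ) / (2 * mean σ) + 1))
    (tailLaplace_pos hσ ((t - mean σ) / (2 * mean σ))))
  have h3 : excessConst σ * (2 * mean σ) / t ≤
      excessConst σ / ((t - mean σ) / (2 * mean σ)) := by
    rw [div_div_eq_mul_div]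
    apply div_le_div_of_nonneg_left (by positivity) (by linarith) (by linarith)
  linarith

theorem continuous_Phi : Continuous Phi := by
  have h : Phi = fun x => Phi 0 + ∫ t in (0 : ℝ)..x, gaussianPDFReal 0 1 t := by
    ext x
    have hi := integrable_gaussianPDFReal 0 1
    have h1 : ∀ x, Phi x = ∫ t in Set.Iic x, gaussianPDFReal 0 1 t := fun x => by
      rw [Phi, cdf_eq_real, measureReal_def, gaussianReal_apply_eq_integral _ one_ne_zero,
        ENNReal.toReal_ofReal]
      exact integral_nonneg fun t => gaussianPDFReal_nonneg _ _ _
    rw [h1, h1, ← intervalIntegral.integral_Iic_sub_Iic hi.integrableOn hi.integrableOn]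
    ring
  rw [h]
  exact continuous_const.add
    (intervalIntegral.continuous_primitive (fun a b =>
      (integrable_gaussianPDFReal 0 1).intervalIntegrable) 0)

theorem continuous_tailLLR (hσ : 0 < σ) : Continuous (tailLLR σ) := by
  have hP : ∀ t, 0 < (muPlus σ).real (Set.Ioi t) := fun t => by
    rw [muPlus_real_Ioi hσ]; exact mul_pos (dens_pos hσ t) (tailLaplace_pos hσ _)
  have hM : ∀ t, 0 < (muMinus σ).real (Set.Ioi t) := fun t => by
    rw [muMinus_real_Ioi hσ]
    exact mul_pos (mul_pos (dens_pos hσ t) (Real.exp_pos _)) (tailLaplace_pos hσ _)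
  have hc := continuous_Phi
  have h1 : Continuous fun t => 1 - Phi ((t - mean σ) / sd σ) := by fun_prop
  have h2 : Continuous fun t => 1 - Phi ((t + mean σ) / sd σ) := by fun_prop
  have e1 : ∀ t, 1 - Phi ((t - mean σ) / sd σ) ≠ 0 := fun t => by
    rw [← gaussianReal_real_Ioi _ (sd_pos hσ), ← muPlus_eq hσ]; exact (hP t).ne'
  have e2 : ∀ t, 1 - Phi ((t + mean σ) / sd σ) ≠ 0 := fun t => by
    rw [← sub_neg_eq_add, ← gaussianReal_real_Ioi _ (sd_pos hσ), ← muMinus_eq hσ]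
    exact (hM t).ne'
  exact (h1.div h2 e2).log fun t => div_ne_zero (e1 t) (e2 t)

/-- `J` is `L - 1/2` times one plus the relative excess of the tail LLR. The excess is at least `C /
t`, so both the drop of `J` over the unit window and its surplus over `L - 1/2` are of order `L /
t³` at least; hence the cubic hypothesis. -/
theorem exists_isTailChoice (hσ : 0 < σ) {L : ℕ} (hL : 1 ≤ L) (hT : 3 * mean σ ≤ Tstar σ L)
    (h1 : (Tstar σ L + 1) ^ 3 / ((L : ℝ) - 1 / 2) ≤ excessConst σ * (2 * mean σ))
    (hT1 : 1 ≤ Tstar σ L) :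
    ∃ (T : ℝ) (Ltail : ℤ), IsTailChoice σ L T Ltail := by
  have hm := mean_pos hσ
  have hc := excessConst_pos σ
  have hLr : (1 : ℝ) ≤ L := by exact_mod_cast hL
  have hl : 0 < (L : ℝ) - 1 / 2 := by linarith
  set t := Tstar σ L with ht
  set C := excessConst σ * (2 * mean σ) with hC
  have hC0 : 0 < C := by positivity
  rw [div_le_iff₀ hl] at h1
  have ht0 : 0 < t := by linarith
  have d0 := le_tailLLR_sub hσ hT
  have d1 := le_tailLLR_sub hσ (show 3 * mean σ ≤ t + 1 by linarith)
  have d2 := tailLLR_sub_antitone hσ (show t ≤ t + 1 by linarith)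
  simp only at d2
  have hJ : ∀ x, 0 < x → J σ L x = ((L : ℝ) - 1 / 2) + ((L : ℝ) - 1 / 2) * ((tailLLR σ x - x) / x) :=
    fun x hx => by
      unfold J
      field_simp
      ring
  have hdiff : J σ L (t + 1) + 1 ≤ J σ L t := by
    rw [hJ t ht0, hJ (t + 1) (by linarith)]
    have a1 : (tailLLR σ (t + 1) - (t + 1)) / (t + 1) ≤ (tailLLR σ t - t) / (t + 1) := by gcongr
    have a2 : C / (t + 1) ^ 3 ≤ (tailLLR σ t - t) / t - (tailLLR σ t - t) / (t + 1) := by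
      have : (tailLLR σ t - t) / t - (tailLLR σ t - t) / (t + 1) =
        (tailLLR σ t - t) / (t * (t + 1)) := by field_simp; ring
      rw [this]
      calc C / (t + 1) ^ 3 ≤ C / (t * (t * (t + 1))) := by
            gcongr
            nlinarith
        _ = C / t / (t * (t + 1)) := by rw [div_div]
        _ ≤ _ := by gcongr
    have a3 : 1 ≤ ((L : ℝ) - 1 / 2) * (C / (t + 1) ^ 3) := by
      rw [mul_div_assoc', le_div_iff₀ (by positivity)]
      linarith
    have a4 := mul_le_mul_of_nonneg_left (a2.trans (sub_le_sub_left a1 _)) hl.le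
    linarith
  -- A surplus of `1 / 2` over `L - 1/2` would suffice; the cubic hypothesis gives 1.
  have hge : (L : ℝ) ≤ J σ L (t + 1) := by
    rw [hJ (t + 1) (by linarith)]
    have b1 : C / (t + 1) ^ 3 ≤ (tailLLR σ (t + 1) - (t + 1)) / (t + 1) := by
      calc C / (t + 1) ^ 3 ≤ C / ((t + 1) * (t + 1)) := by
            gcongr
            nlinarith [mul_pos ht0 ht0, mul_pos (mul_pos ht0 ht0) ht0]
        _ = C / (t + 1) / (t + 1) := by rw [div_div]
        _ ≤ _ := by gcongr
    have b2 : 1 ≤ ((L : ℝ) - 1 / 2) * (C / (t + 1) ^ 3) := by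
      rw [mul_div_assoc', le_div_iff₀ (by positivity)]
      linarith
    have := mul_le_mul_of_nonneg_left b1 hl.le
    linarith
  have hcont : ContinuousOn (J σ L) (Set.Icc t (t + 1)) := by
    have := continuous_tailLLR hσ
    unfold J
    apply ContinuousOn.mul continuousOn_const
    exact this.continuousOn.div continuousOn_id fun x hx => by
      have := hx.1
      exact (show (0 : ℝ) < x by linarith).ne'
  -- The smallest integer above the right end value is at most that value plus 1, hence at most the
  -- left end value.
  have hmem : ((⌈J σ L (t + 1)⌉ : ℤ) : ℝ) ∈ Set.Icc (J σ L (t + 1)) (J σ L t) :=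
    ⟨Int.le_ceil _, (Int.ceil_lt_add_one _).le.trans hdiff⟩
  obtain ⟨T, hTm, hTe⟩ := intermediate_value_Icc' (by linarith) hcont hmem
  refine ⟨T, ⌈J σ L (t + 1)⌉, hTm, ?_, hTe⟩
  exact_mod_cast hge.trans (Int.le_ceil _)

theorem tailProb_eq (hσ : 0 < σ) {t : ℝ} (ht : 0 < t) :
    tailProb σ t = (muPlus σ).real (Set.Ici t) + (muMinus σ).real (Set.Ici t) := by
  have := isProbabilityMeasure_muPlus hσ
  have h : {x : ℝ | t ≤ |x|} = Set.Ici t ∪ {x | -x ∈ Set.Ici t} := by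
    ext x
    simp only [Set.mem_ofPred_eq, Set.mem_union, Set.mem_Ici, le_abs]
  rw [tailProb, muMinus_real_eq_neg hσ measurableSet_Ici, h, measureReal_union]
  · rw [Set.disjoint_left]
    intro x hx hx'
    simp only [Set.mem_ofPred_eq, Set.mem_Ici] at hx hx'
    linarith
  · exact (measurableSet_Ici (a := t)).preimage measurable_neg

theorem muPlus_real_Ici (hσ : 0 < σ) (t : ℝ) :
    (muPlus σ).real (Set.Ici t) = (muPlus σ).real (Set.Ioi t) := by
  rw [muPlus_real hσ measurableSet_Ioi, muPlus_real hσ measurableSet_Ici, integral_Ici_eq_integral_Ioi]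

theorem muMinus_real_Ici (hσ : 0 < σ) (t : ℝ) :
    (muMinus σ).real (Set.Ici t) = (muMinus σ).real (Set.Ioi t) := by
  rw [muMinus_real hσ measurableSet_Ioi, muMinus_real hσ measurableSet_Ici,
    integral_Ici_eq_integral_Ioi]

/-- Mills' bound at both ends. For positive `t` the `μ₋` tail is the smaller one, so a factor 2
covers it. With `u = √(log B)` the exponential is `B⁻²`, and the Mills factor supplies the further
`1 / u`. -/
theorem tailProb_le (hσ : 0 < σ) {t u : ℝ} (hu : 0 < u) (ht : mean σ + 4 / σ * u ≤ t) :
    tailProb σ t ≤ 4 * densConst σ * Real.exp (mean σ / 4) * mean σ * σ / 4 *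
      (Real.exp (-(2 * u ^ 2)) / u) := by
  have hm := mean_pos hσ
  have hc := densConst_pos hσ
  have hu' : 0 < 4 / σ * u := by positivity
  have ht0 : 0 < t := by linarith
  set θ := (t - mean σ) / (2 * mean σ) with hθ
  have hθ0 : 0 < θ := div_pos (by linarith) (by positivity)
  have h1 : (muMinus σ).real (Set.Ioi t) ≤ (muPlus σ).real (Set.Ioi t) := by
    rw [muPlus_real_Ioi hσ, muMinus_real_Ioi hσ, mul_assoc]
    apply mul_le_mul_of_nonneg_left _ (dens_pos hσ t).le
    have a1 : tailLaplace σ (θ + 1) ≤ tailLaplace σ θ := by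
      apply setIntegral_mono_on (integrable_exp_quadratic hσ _).integrableOn
        (integrable_exp_quadratic hσ _).integrableOn measurableSet_Ioi
      intro y hy
      have : 0 < y := hy
      exact Real.exp_le_exp.2 (by nlinarith)
    have a2 : Real.exp (-t) ≤ 1 := Real.exp_le_one_iff.2 (by linarith)
    calc Real.exp (-t) * tailLaplace σ (θ + 1) ≤ 1 * tailLaplace σ θ :=
          mul_le_mul a2 a1 (tailLaplace_pos hσ _).le zero_le_one
      _ = _ := one_mul _
  have h2 : (muPlus σ).real (Set.Ioi t) ≤ dens σ t * (1 / θ) := by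
    rw [muPlus_real_Ioi hσ]
    exact mul_le_mul_of_nonneg_left (tailLaplace_le hσ hθ0) (dens_pos hσ t).le
  have h3 : dens σ t ≤ densConst σ * Real.exp (mean σ / 4) * Real.exp (-(2 * u ^ 2)) := by
    rw [dens_eq hσ, mul_assoc, ← Real.exp_add]
    gcongr
    have e1 : t / 2 - t ^ 2 / (4 * mean σ) =
        mean σ / 4 - (t - mean σ) ^ 2 / (4 * mean σ) := by field_simp; ring
    have e2 : (4 / σ * u) ^ 2 / (4 * mean σ) = 2 * u ^ 2 := by
      unfold mean; field_simp; norm_num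
    have e3 : (4 / σ * u) ^ 2 / (4 * mean σ) ≤ (t - mean σ) ^ 2 / (4 * mean σ) := by
      gcongr; linarith
    linarith
  have h4 : 1 / θ ≤ 2 * mean σ * σ / 4 / u := by
    rw [hθ, one_div_div]
    calc 2 * mean σ / (t - mean σ) ≤ 2 * mean σ / (4 / σ * u) := by gcongr; linarith
      _ = _ := by field_simp
  rw [tailProb_eq hσ ht0, muPlus_real_Ici hσ, muMinus_real_Ici hσ]
  calc _ ≤ 2 * (dens σ t * (1 / θ)) := by linarith
    _ ≤ 2 * (densConst σ * Real.exp (mean σ / 4) * Real.exp (-(2 * u ^ 2)) *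
        (2 * mean σ * σ / 4 / u)) := by gcongr
    _ = _ := by ring

end BIAWGN

namespace BIAWGN

/-! ### The bins form a partition -/

variable {σ : ℝ}

/-- Ordered positive cutoffs, and an admissible tail symbol. -/
structure OrderedCutoffs (L : ℕ) (Ltail : ℤ) (a : ℕ → ℝ) : Prop where
  one_le : 1 ≤ L
  le_tail : (L : ℤ) ≤ Ltail
  pos : 0 < a 1
  mono : StrictMonoOn a (Set.Icc 1 L)

section

variable {L : ℕ} {Ltail : ℤ} {a : ℕ → ℝ}

theorem OrderedCutoffs.le_of_le (h : OrderedCutoffs L Ltail a) {i j : ℕ} (hi : 1 ≤ i)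
    (hij : i ≤ j) (hj : j ≤ L) : a i ≤ a j :=
  h.mono.monotoneOn ⟨hi, hij.trans hj⟩ ⟨hi.trans hij, hj⟩ hij

theorem mem_symbols {k : ℤ} : k ∈ symbols L Ltail ↔
    (-(L : ℤ) < k ∧ k < L) ∨ k = -Ltail ∨ k = Ltail := by
  simp only [symbols, Finset.mem_union, Finset.mem_Ioo, Finset.mem_insert, Finset.mem_singleton]

theorem OrderedCutoffs.le_of_mem_posBin (h : OrderedCutoffs L Ltail a) {j : ℕ} (hj : 1 ≤ j)
    {x : ℝ} (hx : x ∈ posBin L Ltail a j) : a 1 ≤ x := by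
  unfold posBin at hx
  split_ifs at hx with h1 h2
  · exact (h.le_of_le le_rfl hj h1.le).trans hx.1
  · exact (h.le_of_le le_rfl h.one_le le_rfl).trans hx
  · exact hx.elim

theorem OrderedCutoffs.posBin_unique (h : OrderedCutoffs L Ltail a) {i j : ℕ} (hi : 1 ≤ i)
    (hj : 1 ≤ j) {x : ℝ} (hxi : x ∈ posBin L Ltail a i) (hxj : x ∈ posBin L Ltail a j) :
    i = j := by
  wlog hij : i < j generalizing i j
  · rcases (not_lt.1 hij).eq_or_lt with h' | h'
    · exact h'.symm
    · exact (this hj hi hxj hxi h').symm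
  exfalso
  unfold posBin at hxi hxj
  split_ifs at hxi hxj with h1 h2 h3 h4 h5 h6
  · exact absurd hxj.1 (not_le.2 (hxi.2.trans_le (h.le_of_le (by omega) hij (by omega))))
  · exact absurd (Set.mem_Ici.1 hxj)
      (not_le.2 (hxi.2.trans_le (h.le_of_le (by omega) (by omega) le_rfl)))
  · exact hxj
  · omega
  · omega
  · exact hxj
  · exact hxi
  · exact hxi
  · exact hxi

theorem OrderedCutoffs.exists_posBin (h : OrderedCutoffs L Ltail a) {x : ℝ} (hx : a 1 ≤ x) :
    ∃ j : ℕ, 1 ≤ j ∧ (j < L ∨ (j : ℤ) = Ltail) ∧ x ∈ posBin L Ltail a j := by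
  by_cases hL : a L ≤ x
  · refine ⟨Ltail.toNat, ?_, ?_, ?_⟩
    · have := h.one_le; have := h.le_tail; omega
    · have := h.le_tail; omega
    · have := h.le_tail
      have h1 : ((Ltail.toNat : ℕ) : ℤ) = Ltail := by omega
      have h2 : ¬ Ltail.toNat < L := by omega
      unfold posBin
      rw [if_neg h2, if_pos h1]
      exact hL
  · have hex : ∃ n, x < a (n + 1) ∧ 1 ≤ n ∧ n < L := by
      by_contra! hno
      have : ∀ n, 1 ≤ n → n ≤ L → a n ≤ x := by
        intro n hn
        induction n, hn using Nat.le_induction with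
        | base => exact fun _ => hx
        | succ n hn ih =>
          intro hle
          by_contra! hlt
          exact absurd (hno n hlt hn) (by omega)
      exact hL (this L h.one_le le_rfl)
    classical
    obtain ⟨h1, h2, h3⟩ := Nat.find_spec hex
    refine ⟨Nat.find hex, h2, Or.inl h3, ?_⟩
    unfold posBin
    rw [if_pos h3]
    refine ⟨?_, h1⟩
    rcases h2.eq_or_lt with h4 | h4
    · rw [← h4]; exact hx
    · by_contra! hlt
      have := Nat.find_min hex (m := Nat.find hex - 1) (by omega)
      apply this
      rw [Nat.sub_add_cancel h2]
      exact ⟨hlt, by omega, by omega⟩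

theorem OrderedCutoffs.bin_unique (h : OrderedCutoffs L Ltail a) {k l : ℤ} {x : ℝ}
    (hk : x ∈ bin L Ltail a k) (hl : x ∈ bin L Ltail a l) : k = l := by
  have ha := h.pos
  have hpos : ∀ {k : ℤ}, 0 < k → x ∈ bin L Ltail a k → x ∈ posBin L Ltail a k.natAbs ∧ a 1 ≤ x :=
    fun {k} hk hx => by
      rw [bin, if_neg hk.ne', if_pos hk] at hx
      exact ⟨hx, h.le_of_mem_posBin (by omega) hx⟩
  have hneg : ∀ {k : ℤ}, k < 0 → x ∈ bin L Ltail a k →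
      -x ∈ posBin L Ltail a k.natAbs ∧ a 1 ≤ -x := fun {k} hk hx => by
    rw [bin, if_neg hk.ne, if_neg hk.not_gt] at hx
    exact ⟨hx, h.le_of_mem_posBin (by omega) hx⟩
  have hzero : ∀ {k : ℤ}, k = 0 → x ∈ bin L Ltail a k → -a 1 < x ∧ x < a 1 := fun {k} hk hx => by
    rw [bin, if_pos hk] at hx
    exact hx
  rcases lt_trichotomy k 0 with hk0 | hk0 | hk0 <;> rcases lt_trichotomy l 0 with hl0 | hl0 | hl0
  · have := h.posBin_unique (by omega) (by omega) (hneg hk0 hk).1 (hneg hl0 hl).1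
    omega
  · linarith [(hneg hk0 hk).2, (hzero hl0 hl).1]
  · linarith [(hneg hk0 hk).2, (hpos hl0 hl).2]
  · linarith [(hneg hl0 hl).2, (hzero hk0 hk).1]
  · omega
  · linarith [(hpos hl0 hl).2, (hzero hk0 hk).2]
  · linarith [(hpos hk0 hk).2, (hneg hl0 hl).2]
  · linarith [(hpos hk0 hk).2, (hzero hl0 hl).2]
  · have := h.posBin_unique (by omega) (by omega) (hpos hk0 hk).1 (hpos hl0 hl).1
    omega

theorem OrderedCutoffs.exists_bin (h : OrderedCutoffs L Ltail a) (x : ℝ) :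
    ∃ k ∈ symbols L Ltail, x ∈ bin L Ltail a k := by
  have hL := h.one_le
  by_cases h1 : a 1 ≤ x
  · obtain ⟨j, hj, hjs, hjx⟩ := h.exists_posBin h1
    refine ⟨j, mem_symbols.2 (by omega), ?_⟩
    rw [bin, if_neg (by omega), if_pos (by omega), Int.natAbs_natCast]
    exact hjx
  by_cases h2 : a 1 ≤ -x
  · obtain ⟨j, hj, hjs, hjx⟩ := h.exists_posBin h2
    refine ⟨-j, mem_symbols.2 (by omega), ?_⟩
    rw [bin, if_neg (by omega), if_neg (by omega), Int.natAbs_neg, Int.natAbs_natCast]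
    exact hjx
  · refine ⟨0, mem_symbols.2 (by omega), ?_⟩
    rw [bin, if_pos rfl]
    exact ⟨by linarith, by linarith⟩

theorem OrderedCutoffs.quantize_eq (h : OrderedCutoffs L Ltail a) {k : ℤ}
    (hk : k ∈ symbols L Ltail) {x : ℝ} (hx : x ∈ bin L Ltail a k) :
    quantize L Ltail a x = k := by
  unfold quantize
  rw [Finset.sum_eq_single_of_mem k hk, if_pos hx]
  intro l _ hl
  rw [if_neg]
  exact fun hlx => hl (h.bin_unique hlx hx)

theorem OrderedCutoffs.preimage_quantize (h : OrderedCutoffs L Ltail a) {k : ℤ}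
    (hk : k ∈ symbols L Ltail) : quantize L Ltail a ⁻¹' {k} = bin L Ltail a k := by
  ext x
  constructor
  · intro hx
    obtain ⟨l, hl, hlx⟩ := h.exists_bin x
    have : quantize L Ltail a x = k := hx
    rw [h.quantize_eq hl hlx] at this
    rwa [← this]
  · exact h.quantize_eq hk

theorem OrderedCutoffs.preimage_quantize_of_notMem (h : OrderedCutoffs L Ltail a) {k : ℤ}
    (hk : k ∉ symbols L Ltail) : quantize L Ltail a ⁻¹' {k} = ∅ := by
  ext x
  simp only [Set.mem_empty_iff_false, iff_false]
  intro hx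
  obtain ⟨l, hl, hlx⟩ := h.exists_bin x
  have : quantize L Ltail a x = k := hx
  rw [h.quantize_eq hl hlx] at this
  exact hk (this ▸ hl)

theorem measurableSet_posBin (j : ℕ) : MeasurableSet (posBin L Ltail a j) := by
  unfold posBin
  split_ifs
  · exact measurableSet_Ico
  · exact measurableSet_Ici
  · exact MeasurableSet.empty

theorem measurableSet_bin (k : ℤ) : MeasurableSet (bin L Ltail a k) := by
  unfold bin
  split_ifs
  · exact measurableSet_Ioo
  · exact measurableSet_posBin _
  · exact (measurableSet_posBin _).preimage measurable_neg

theorem measurable_quantize : Measurable (quantize L Ltail a) := by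
  unfold quantize
  apply Finset.measurable_sum
  intro k _
  exact Measurable.ite (measurableSet_bin k) measurable_const measurable_const

theorem muPlus_ac_muMinus (hσ : 0 < σ) : muPlus σ ≪ muMinus σ := by
  rw [muMinus_withDensity hσ]
  exact withDensity_absolutelyContinuous' (by fun_prop)
    (ae_of_all _ fun x => (ENNReal.ofReal_pos.2 (Real.exp_pos _)).ne')

theorem muMinus_ac_muPlus (hσ : 0 < σ) : muMinus σ ≪ muPlus σ := by
  rw [muMinus_withDensity hσ]
  exact withDensity_absolutelyContinuous _ _

theorem muPlus_real_eq_neg (hσ : 0 < σ) {s : Set ℝ} (hs : MeasurableSet s) :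
    (muPlus σ).real s = (muMinus σ).real {x | -x ∈ s} := by
  have := muMinus_real_eq_neg hσ (s := {x | -x ∈ s}) (hs.preimage measurable_neg)
  simpa using this.symm

/-! ### The exact-lattice property and the quantized laws -/

/-- Positive central symbols hold by the cutoff recursion, and the tail symbol because `J T = Ltail`
is that equation solved for the symbol. Negative symbols follow by reflection, which swaps `μ₊` and
`μ₋`; the central bin is its own reflection. -/
theorem exactLattice_of_isCutoffs (hσ : 0 < σ) {T : ℝ} (h : OrderedCutoffs L Ltail a)
    (hT : IsTailChoice σ L T Ltail) (hT0 : 0 < T) (ha : IsCutoffs σ L T a) :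
    ExactLattice σ (spacing L T) L Ltail a := by
  have hL := h.one_le
  have hLr : (1 : ℝ) ≤ L := by exact_mod_cast hL
  have hlt := h.le_tail
  have key : ∀ j : ℕ, 1 ≤ j → (j < L ∨ (j : ℤ) = Ltail) →
      Real.log ((muPlus σ).real (posBin L Ltail a j) / (muMinus σ).real (posBin L Ltail a j)) =
        j * spacing L T := by
    intro j hj hjs
    rcases hjs with hjs | hjs
    · rw [posBin, if_pos hjs]
      exact ha.step j hj hjs
    · have h1 : ¬ j < L := by omega
      rw [posBin, if_neg h1, if_pos hjs, ha.last, muPlus_real_Ici hσ, muMinus_real_Ici hσ,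
        ← tailLLR_eq_log hσ]
      have h2 := hT.eq
      rw [← hjs, Int.cast_natCast] at h2
      rw [← h2, J, spacing]
      have : (L : ℝ) - 1 / 2 ≠ 0 := by linarith
      rw [mul_comm, ← mul_assoc, div_mul_cancel₀ _ this, mul_div_cancel₀ _ hT0.ne']
  intro k hk hpos
  rw [mem_symbols] at hk
  rcases lt_trichotomy k 0 with hk0 | hk0 | hk0
  · have h1 := key k.natAbs (by omega) (by omega)
    have hb : bin L Ltail a k = {x | -x ∈ posBin L Ltail a k.natAbs} := by
      rw [bin, if_neg hk0.ne, if_neg hk0.not_gt]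
    have h2 : ((k.natAbs : ℕ) : ℝ) = -k := by
      rw [Nat.cast_natAbs, abs_of_neg hk0, Int.cast_neg]
    rw [hb, ← muMinus_real_eq_neg hσ (measurableSet_posBin _),
      ← muPlus_real_eq_neg hσ (measurableSet_posBin _), ← inv_div, Real.log_inv, h1, h2]
    ring
  · have hb : bin L Ltail a k = Set.Ioo (-a 1) (a 1) := by rw [bin, if_pos hk0]
    have h1 : (muMinus σ).real (bin L Ltail a k) = (muPlus σ).real (bin L Ltail a k) := by
      rw [muMinus_real_eq_neg hσ (measurableSet_bin k), hb]
      congr 1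
      ext x
      simp only [Set.mem_ofPred_eq, Set.mem_Ioo]
      constructor <;> rintro ⟨h1, h2⟩ <;> constructor <;> linarith
    rw [h1, div_self hpos.ne', Real.log_one, hk0]
    simp
  · have hb : bin L Ltail a k = posBin L Ltail a k.natAbs := by
      rw [bin, if_neg hk0.ne', if_pos hk0]
    have h2 : ((k.natAbs : ℕ) : ℝ) = k := by
      rw [Nat.cast_natAbs, abs_of_pos hk0]
    rw [hb, key k.natAbs (by omega) (by omega), h2]

theorem quantLaw_one (hσ : 0 < σ) : quantLaw σ L Ltail a 1 =
    (muPlus σ).map (quantize L Ltail a) := by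
  rw [muPlus, Measure.map_map measurable_quantize (measurable_LLR hσ)]
  rfl

theorem quantLaw_neg_one (hσ : 0 < σ) : quantLaw σ L Ltail a (-1) =
    (muMinus σ).map (quantize L Ltail a) := by
  rw [muMinus, Measure.map_map measurable_quantize (measurable_LLR hσ)]
  rfl

theorem isProbabilityMeasure_quantLaw (hσ : 0 < σ) (x : ℝ) :
    IsProbabilityMeasure (quantLaw σ L Ltail a x) :=
  Measure.isProbabilityMeasure_map
    ((measurable_quantize.comp (measurable_LLR hσ)).aemeasurable)

theorem muMinus_bin (hσ : 0 < σ) {δ : ℝ} (hex : ExactLattice σ δ L Ltail a) {k : ℤ}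
    (hk : k ∈ symbols L Ltail) : muMinus σ (bin L Ltail a k) =
      ENNReal.ofReal (Real.exp (-(k * δ))) * muPlus σ (bin L Ltail a k) := by
  have := isProbabilityMeasure_muPlus hσ
  have := isProbabilityMeasure_muMinus hσ
  by_cases h0 : muPlus σ (bin L Ltail a k) = 0
  · rw [h0, mul_zero]
    exact muMinus_ac_muPlus hσ h0
  have hP : 0 < (muPlus σ).real (bin L Ltail a k) :=
    ENNReal.toReal_pos h0 (measure_ne_top _ _)
  have hM : 0 < (muMinus σ).real (bin L Ltail a k) :=
    ENNReal.toReal_pos (fun h => h0 (muPlus_ac_muMinus hσ h)) (measure_ne_top _ _)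
  have h1 := congrArg Real.exp (hex k hk hP)
  rw [Real.exp_log (div_pos hP hM), div_eq_iff hM.ne'] at h1
  rw [← ofReal_measureReal (measure_ne_top _ _), ← ofReal_measureReal (measure_ne_top _ _),
    ← ENNReal.ofReal_mul (Real.exp_pos _).le, h1, ← mul_assoc, ← Real.exp_add]
  simp

/-- The lattice property makes `k δ` the log-likelihood ratio of the quantized channel, so the
general information formulas apply to it. -/
theorem quantLaw_withDensity (hσ : 0 < σ) {δ : ℝ} (h : OrderedCutoffs L Ltail a)
    (hex : ExactLattice σ δ L Ltail a) :
    quantLaw σ L Ltail a (-1) = (quantLaw σ L Ltail a 1).withDensity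
      fun k : ℤ => ENNReal.ofReal (Real.exp (-((k : ℝ) * δ))) := by
  refine Measure.ext_of_singleton fun k => ?_
  rw [withDensity_apply _ (measurableSet_singleton k), Measure.restrict_singleton,
    lintegral_smul_measure, lintegral_dirac, quantLaw_one hσ, quantLaw_neg_one hσ,
    Measure.map_apply measurable_quantize (measurableSet_singleton k),
    Measure.map_apply measurable_quantize (measurableSet_singleton k)]
  by_cases hk : k ∈ symbols L Ltail
  · rw [h.preimage_quantize hk, muMinus_bin hσ hex hk, smul_eq_mul, mul_comm]
  · rw [h.preimage_quantize_of_notMem hk]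
    simp

end

/-! ### The capacity loss as an integral -/

theorem integral_muMinus (hσ : 0 < σ) (g : ℝ → ℝ) :
    ∫ x, g x ∂muMinus σ = ∫ x, Real.exp (-x) * g x ∂muPlus σ := by
  rw [muMinus_withDensity hσ]
  have := integral_withDensity_eq_integral_smul (μ := muPlus σ)
    (f := fun x => (Real.exp (-x)).toNNReal) (by fun_prop) g
  refine this.trans (integral_congr_ae (ae_of_all _ fun x => ?_))
  simp only [NNReal.smul_def, Real.coe_toNNReal _ (Real.exp_pos (-x)).le, smul_eq_mul]

theorem integrable_muMinus_iff (hσ : 0 < σ) (g : ℝ → ℝ) :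
    Integrable g (muMinus σ) ↔ Integrable (fun x => Real.exp (-x) * g x) (muPlus σ) := by
  rw [muMinus_withDensity hσ]
  have := integrable_withDensity_iff_integrable_smul (μ := muPlus σ)
    (f := fun x => (Real.exp (-x)).toNNReal) (by fun_prop) (g := g)
  refine this.trans (integrable_congr (ae_of_all _ fun x => ?_))
  simp only [NNReal.smul_def, Real.coe_toNNReal _ (Real.exp_pos (-x)).le, smul_eq_mul]

theorem integral_muMinus_eq_neg (hσ : 0 < σ) {g : ℝ → ℝ} (hg : Measurable g) :
    ∫ x, g x ∂muMinus σ = ∫ x, g (-x) ∂muPlus σ := by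
  rw [muMinus_eq_map_neg hσ, integral_map (by fun_prop) hg.aestronglyMeasurable]

@[fun_prop]
theorem measurable_softlog : Measurable softlog := by unfold softlog; fun_prop

theorem softlog_nonneg (x : ℝ) : 0 ≤ softlog x :=
  Real.log_nonneg (by linarith [Real.exp_pos (-x)])

theorem softlog_neg (x : ℝ) : softlog (-x) = x + softlog x := by
  have h : 1 + Real.exp (- -x) = Real.exp x * (1 + Real.exp (-x)) := by
    rw [mul_add, ← Real.exp_add]; simp [add_comm]
  have := Real.exp_pos (-x)
  rw [softlog, h, Real.log_mul (Real.exp_pos _).ne' (by positivity), Real.log_exp, softlog]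

theorem integrable_log_sub_softlog (hσ : 0 < σ) :
    Integrable (fun x => Real.log 2 - softlog x) (muPlus σ) ∧
    Integrable (fun x => Real.exp (-x) * (Real.log 2 - softlog (-x))) (muPlus σ) := by
  have := isProbabilityMeasure_muPlus hσ
  have hM := isProbabilityMeasure_muMinus hσ
  rw [muMinus_withDensity hσ] at hM
  have h1 := integrable_log_inv_mixDensity (P := muPlus σ) (ℒ := fun x => x) (p := 1 / 2)
    measurable_id (by norm_num)
  have h2 := integrable_exp_mul_log_mixDensity (P := muPlus σ) (ℒ := fun x => x) (p := 1 / 2)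
    measurable_id (by norm_num)
  simp only [log_inv_mixDensity_half, log_exp_div_mixDensity_half] at h1 h2
  exact ⟨h1, h2⟩

theorem integral_comp_LLR (hσ : 0 < σ) {g : ℝ → ℝ} (hg : Measurable g) :
    ∫ y, g (LLR σ y) ∂law σ 1 = ∫ x, g x ∂muPlus σ := by
  rw [muPlus, integral_map (measurable_LLR hσ).aemeasurable hg.aestronglyMeasurable]

/-- Reflection exchanges `μ₊` and `μ₋`, so the divergences of the two output laws from their uniform
mixture agree and the uniform input achieves capacity. -/
theorem capacity_eq (hσ : 0 < σ) : capacity σ =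
    1 / 2 * ((∫ x, (Real.log 2 - softlog x) ∂muPlus σ) +
      ∫ x, Real.exp (-x) * (Real.log 2 - softlog (-x)) ∂muPlus σ) := by
  have hLLR := measurable_LLR hσ
  have hprob : IsProbabilityMeasure
      ((law σ 1).withDensity fun y => ENNReal.ofReal (Real.exp (-LLR σ y))) := by
    rw [← law_neg_withDensity hσ]; infer_instance
  have e1 := integral_comp_LLR hσ (g := fun x => Real.log 2 - softlog x) (by fun_prop)
  have e2 := integral_comp_LLR hσ (g := fun x => Real.exp (-x) * (Real.log 2 - softlog (-x)))
    (by fun_prop)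
  have hsymm : ∫ y, Real.log (1 / mixDensity (1 / 2) (LLR σ y)) ∂law σ 1 =
      ∫ y, Real.exp (-LLR σ y) *
        Real.log (Real.exp (-LLR σ y) / mixDensity (1 / 2) (LLR σ y)) ∂law σ 1 := by
    simp only [log_inv_mixDensity_half, log_exp_div_mixDensity_half]
    rw [e1, e2, ← integral_muMinus hσ (fun x => Real.log 2 - softlog (-x)),
      integral_muMinus_eq_neg hσ (by fun_prop)]
    simp
  have hhalf : (1 / 2 : ℝ) ∈ Set.Ioo (0 : ℝ) 1 := by norm_num
  rw [capacity, law_neg_withDensity hσ, channelCapacity_eq_mutualInfo_half hLLR hsymm,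
    toReal_mutualInfo_withDensity hLLR hhalf, ENNReal.toReal_ofReal]
  · simp only [log_inv_mixDensity_half, log_exp_div_mixDensity_half]
    rw [e1, e2]
    ring
  · have h1 := integral_log_inv_mixDensity_nonneg (P := law σ 1) hLLR hhalf
    have h2 := integral_exp_mul_log_mixDensity_nonneg (P := law σ 1) hLLR hhalf
    linarith

section

variable {L : ℕ} {Ltail : ℤ} {a : ℕ → ℝ} {δ : ℝ}

/-- Values of `quantize` are sums over subsets of a finite symbol set, so its range is finite even
without disjointness of the bins. -/
theorem integrable_quantized (hσ : 0 < σ) (g : ℝ → ℝ) :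
    Integrable (fun x => g (quantize L Ltail a x * δ)) (muPlus σ) ∧
    Integrable (fun x => Real.exp (-x) * g (quantize L Ltail a x * δ)) (muPlus σ) := by
  have := isProbabilityMeasure_muPlus hσ
  have := isProbabilityMeasure_muMinus hσ
  have hm : Measurable fun x => g (quantize L Ltail a x * δ) :=
    (measurable_from_top (f := fun k : ℤ => g (k * δ))).comp measurable_quantize
  have hfin : (Set.range (quantize L Ltail a)).Finite := by
    refine Set.Finite.subset
      ((symbols L Ltail).powerset.image fun s => ∑ k ∈ s, k).finite_toSet ?_
    rintro _ ⟨x, rfl⟩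
    classical
    simp only [Finset.coe_image, Set.mem_image, Finset.mem_coe, Finset.mem_powerset]
    refine ⟨(symbols L Ltail).filter fun k => x ∈ bin L Ltail a k, Finset.filter_subset _ _, ?_⟩
    rw [Finset.sum_filter]
    unfold quantize
    congr
  obtain ⟨C, hC⟩ := (hfin.image fun k : ℤ => |g (k * δ)|).bddAbove
  have hb : ∀ x, ‖g (quantize L Ltail a x * δ)‖ ≤ C := fun x =>
    hC ⟨quantize L Ltail a x, ⟨x, rfl⟩, rfl⟩
  exact ⟨Integrable.of_bound hm.aestronglyMeasurable C (ae_of_all _ hb),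
    (integrable_muMinus_iff hσ _).1 (Integrable.of_bound hm.aestronglyMeasurable C (ae_of_all _ hb))⟩

theorem inducedCapacity_eq (hσ : 0 < σ) (h : OrderedCutoffs L Ltail a)
    (hex : ExactLattice σ δ L Ltail a) : inducedCapacity σ L Ltail a =
    1 / 2 * ((∫ x, (Real.log 2 - softlog (quantize L Ltail a x * δ)) ∂muPlus σ) +
      ∫ x, Real.exp (-x) * (Real.log 2 - softlog (-(quantize L Ltail a x * δ))) ∂muPlus σ) := by
  have hQ1 := isProbabilityMeasure_quantLaw (L := L) (Ltail := Ltail) (a := a) hσ 1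
  have hQ2 := isProbabilityMeasure_quantLaw (L := L) (Ltail := Ltail) (a := a) hσ (-1)
  have hd := quantLaw_withDensity hσ h hex
  rw [hd] at hQ2
  have hℒ : Measurable fun k : ℤ => (k : ℝ) * δ := measurable_from_top
  have hhalf : (1 / 2 : ℝ) ∈ Set.Ioo (0 : ℝ) 1 := by norm_num
  rw [inducedCapacity, hd, toReal_mutualInfo_withDensity hℒ hhalf, ENNReal.toReal_ofReal]
  · simp only [log_inv_mixDensity_half, log_exp_div_mixDensity_half]
    have e1 : ∫ k : ℤ, (Real.log 2 - softlog (k * δ)) ∂quantLaw σ L Ltail a 1 =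
        ∫ x, (Real.log 2 - softlog (quantize L Ltail a x * δ)) ∂muPlus σ := by
      rw [quantLaw_one hσ, integral_map measurable_quantize.aemeasurable
        (measurable_from_top (f := fun k : ℤ => Real.log 2 - softlog (k * δ))).aestronglyMeasurable]
    -- The weight `exp (-k δ)` is absorbed into the law for input `-`, pulled back to `μ₋`, and
    -- reopened as `exp (-x)`. Both information integrals now carry the same weights, so their
    -- difference is pointwise in `x`.
    have e2 : ∫ k : ℤ, Real.exp (-(k * δ)) * (Real.log 2 - softlog (-(k * δ)))
          ∂quantLaw σ L Ltail a 1 =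
        ∫ x, Real.exp (-x) * (Real.log 2 - softlog (-(quantize L Ltail a x * δ))) ∂muPlus σ := by
      rw [← integral_muMinus hσ fun x => Real.log 2 - softlog (-(quantize L Ltail a x * δ)),
        ← integral_map (φ := quantize L Ltail a)
          (f := fun k : ℤ => Real.log 2 - softlog (-(k * δ))) measurable_quantize.aemeasurable
          measurable_from_top.aestronglyMeasurable, ← quantLaw_neg_one hσ, hd]
      have := integral_withDensity_eq_integral_smul (μ := quantLaw σ L Ltail a 1)
        (f := fun k : ℤ => (Real.exp (-(k * δ))).toNNReal) measurable_from_top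
        (fun k : ℤ => Real.log 2 - softlog (-(k * δ)))
      refine Eq.symm (this.trans (integral_congr_ae (ae_of_all _ fun k => ?_)))
      simp only [NNReal.smul_def, Real.coe_toNNReal _ (Real.exp_pos (-(k * δ))).le, smul_eq_mul]
    rw [e1, e2]
    ring
  · have h1 := integral_log_inv_mixDensity_nonneg (P := quantLaw σ L Ltail a 1) hℒ hhalf
    have h2 := integral_exp_mul_log_mixDensity_nonneg (P := quantLaw σ L Ltail a 1) hℒ hhalf
    linarith

/-- The pointwise information loss when the log-likelihood ratio `x` is replaced by `c`. -/
def gap (x c : ℝ) : ℝ :=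
  softlog c - softlog x + Real.exp (-x) * (softlog (-c) - softlog (-x))

theorem integrable_gap_quantize (hσ : 0 < σ) :
    Integrable (fun x => gap x (quantize L Ltail a x * δ)) (muPlus σ) := by
  obtain ⟨i1, i2⟩ := integrable_log_sub_softlog hσ
  have i3 := (integrable_quantized (L := L) (Ltail := Ltail) (a := a) (δ := δ) hσ
    fun c => Real.log 2 - softlog c).1
  have i4 := (integrable_quantized (L := L) (Ltail := Ltail) (a := a) (δ := δ) hσ
    fun c => Real.log 2 - softlog (-c)).2
  refine (((i1.sub i3).add (i2.sub i4))).congr (ae_of_all _ fun x => ?_)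
  simp only [gap, Pi.add_apply, Pi.sub_apply]
  ring

theorem capacity_sub_inducedCapacity (hσ : 0 < σ) (h : OrderedCutoffs L Ltail a)
    (hex : ExactLattice σ δ L Ltail a) : capacity σ - inducedCapacity σ L Ltail a =
    1 / 2 * ∫ x, gap x (quantize L Ltail a x * δ) ∂muPlus σ := by
  obtain ⟨i1, i2⟩ := integrable_log_sub_softlog hσ
  have i3 := (integrable_quantized (L := L) (Ltail := Ltail) (a := a) (δ := δ) hσ
    fun c => Real.log 2 - softlog c).1
  have i4 := (integrable_quantized (L := L) (Ltail := Ltail) (a := a) (δ := δ) hσ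
    fun c => Real.log 2 - softlog (-c)).2
  have e : ∀ x, gap x (quantize L Ltail a x * δ) =
      ((Real.log 2 - softlog x) - (Real.log 2 - softlog (quantize L Ltail a x * δ))) +
      (Real.exp (-x) * (Real.log 2 - softlog (-x)) -
        Real.exp (-x) * (Real.log 2 - softlog (-(quantize L Ltail a x * δ)))) := fun x => by
    unfold gap; ring
  rw [capacity_eq hσ, inducedCapacity_eq hσ h hex]
  have j1 : Integrable (fun x => (Real.log 2 - softlog x) -
      (Real.log 2 - softlog (quantize L Ltail a x * δ))) (muPlus σ) := i1.sub i3
  have j2 : Integrable (fun x => Real.exp (-x) * (Real.log 2 - softlog (-x)) -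
      Real.exp (-x) * (Real.log 2 - softlog (-(quantize L Ltail a x * δ)))) (muPlus σ) :=
    i2.sub i4
  simp_rw [e]
  rw [integral_add j1 j2, integral_sub i1 i3, integral_sub i2 i4]
  ring

end

end BIAWGN

namespace BIAWGN

/-! ### Pointwise estimates of the information loss -/

variable {σ : ℝ}

/-- The posterior probability `1 / (1 + exp x)` of the input `-`. -/
def postMinus (x : ℝ) : ℝ := 1 / (1 + Real.exp x)

theorem postMinus_pos (x : ℝ) : 0 < postMinus x := by unfold postMinus; positivity

theorem postMinus_lt_one (x : ℝ) : postMinus x < 1 := by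
  have := Real.exp_pos x
  unfold postMinus
  rw [div_lt_one (by positivity)]
  linarith

@[fun_prop]
theorem continuous_postMinus : Continuous postMinus := by
  unfold postMinus
  exact continuous_const.div (by fun_prop) fun x => by positivity

/-- The cumulant generating function of a centred Bernoulli variable. -/
def bernoulliCgf (p t : ℝ) : ℝ := Real.log (1 + p * (Real.exp t - 1)) - p * t

theorem one_add_mul_exp_sub_one_pos {p : ℝ} (hp : p ∈ Set.Ioo (0 : ℝ) 1) (t : ℝ) :
    0 < 1 + p * (Real.exp t - 1) := by
  nlinarith [hp.1, hp.2, mul_pos hp.1 (Real.exp_pos t)]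

theorem hasDerivAt_bernoulliCgf {p : ℝ} (hp : p ∈ Set.Ioo (0 : ℝ) 1) (t : ℝ) :
    HasDerivAt (bernoulliCgf p)
      (p * (1 - p) * ((Real.exp t - 1) / (1 + p * (Real.exp t - 1)))) t := by
  have hD := one_add_mul_exp_sub_one_pos hp t
  have h1 : HasDerivAt (fun t => 1 + p * (Real.exp t - 1)) (p * Real.exp t) t :=
    (((Real.hasDerivAt_exp t).sub_const 1).const_mul p).const_add 1
  have h2 : HasDerivAt (bernoulliCgf p) (p * Real.exp t / (1 + p * (Real.exp t - 1)) - p * 1) t :=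
    (h1.log hD.ne').sub ((hasDerivAt_id t).const_mul p)
  convert h2 using 1
  field_simp
  ring

/-- The denominator of the derivative lies between 1 and `exp t`. Both bounds keep the factor `p (1
- p)`, so the error stays relative even when `p` degenerates. -/
theorem bernoulliCgf_bounds_of_nonneg {p t : ℝ} (hp : p ∈ Set.Ioo (0 : ℝ) 1) (ht : 0 ≤ t) :
    p * (1 - p) * (Real.exp (-t) - 1 + t) ≤ bernoulliCgf p t ∧
      bernoulliCgf p t ≤ p * (1 - p) * (Real.exp t - 1 - t) := by
  have hpp : 0 < p * (1 - p) := mul_pos hp.1 (by linarith [hp.2])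
  have h0 : bernoulliCgf p 0 = 0 := by simp [bernoulliCgf]
  have hfc : Continuous (bernoulliCgf p) :=
    continuous_iff_continuousAt.2 fun t => (hasDerivAt_bernoulliCgf hp t).continuousAt
  constructor
  · have hd : ∀ u, HasDerivAt (fun u => bernoulliCgf p u - p * (1 - p) * (Real.exp (-u) - 1 + u))
        (p * (1 - p) * ((Real.exp u - 1) / (1 + p * (Real.exp u - 1))) -
          p * (1 - p) * (Real.exp (-u) * (-1) + 1)) u := fun u =>
      (hasDerivAt_bernoulliCgf hp u).sub (((((hasDerivAt_neg u).exp).sub_const 1).add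
        (hasDerivAt_id u)).const_mul _)
    have hmono := monotoneOn_of_deriv_nonneg (convex_Ici (0 : ℝ))
      (continuous_iff_continuousAt.2 fun u => (hd u).continuousAt).continuousOn
      (fun u _ => (hd u).differentiableAt.differentiableWithinAt) (fun u hu => by
        rw [interior_Ici, Set.mem_Ioi] at hu
        rw [(hd u).deriv, ← mul_sub]
        apply mul_nonneg hpp.le
        have hD := one_add_mul_exp_sub_one_pos hp u
        have he : 1 < Real.exp u := Real.one_lt_exp_iff.2 hu
        have e1 : Real.exp (-u) * (-1) + 1 = (Real.exp u - 1) / Real.exp u := by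
          rw [Real.exp_neg]; field_simp; ring
        rw [e1, sub_nonneg]
        apply div_le_div_of_nonneg_left (by linarith) hD
        nlinarith [hp.1, hp.2])
    have := hmono Set.self_mem_Ici (Set.mem_Ici.2 ht) ht
    simp only [h0, neg_zero, Real.exp_zero] at this
    linarith
  · have hd : ∀ u, HasDerivAt (fun u => p * (1 - p) * (Real.exp u - 1 - u) - bernoulliCgf p u)
        (p * (1 - p) * (Real.exp u - 1) -
          p * (1 - p) * ((Real.exp u - 1) / (1 + p * (Real.exp u - 1)))) u := fun u =>
      ((((Real.hasDerivAt_exp u).sub_const 1).sub (hasDerivAt_id u)).const_mul _).sub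
        (hasDerivAt_bernoulliCgf hp u)
    have hmono := monotoneOn_of_deriv_nonneg (convex_Ici (0 : ℝ))
      (continuous_iff_continuousAt.2 fun u => (hd u).continuousAt).continuousOn
      (fun u _ => (hd u).differentiableAt.differentiableWithinAt) (fun u hu => by
        rw [interior_Ici, Set.mem_Ioi] at hu
        rw [(hd u).deriv, ← mul_sub]
        apply mul_nonneg hpp.le
        have hD := one_add_mul_exp_sub_one_pos hp u
        have he : 1 < Real.exp u := Real.one_lt_exp_iff.2 hu
        rw [sub_nonneg]
        apply div_le_self (by linarith)
        nlinarith [hp.1, hp.2])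
    have := hmono Set.self_mem_Ici (Set.mem_Ici.2 ht) ht
    simp only [h0, Real.exp_zero] at this
    linarith

/-- Exchanging the two outcomes of the Bernoulli variable; this reduces estimates to `t ≥ 0`. -/
theorem bernoulliCgf_neg {p : ℝ} (hp : p ∈ Set.Ioo (0 : ℝ) 1) (t : ℝ) :
    bernoulliCgf p t = bernoulliCgf (1 - p) (-t) := by
  have hp' : 1 - p ∈ Set.Ioo (0 : ℝ) 1 := ⟨by linarith [hp.2], by linarith [hp.1]⟩
  have hD := one_add_mul_exp_sub_one_pos hp' (-t)
  have h : 1 + p * (Real.exp t - 1) = Real.exp t * (1 + (1 - p) * (Real.exp (-t) - 1)) := by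
    have : Real.exp t * Real.exp (-t) = 1 := by rw [← Real.exp_add]; simp
    linear_combination (-(1 - p)) * this
  unfold bernoulliCgf
  rw [h, Real.log_mul (Real.exp_pos t).ne' hD.ne', Real.log_exp]
  ring

theorem abs_bernoulliCgf_sub_le {p t : ℝ} (hp : p ∈ Set.Ioo (0 : ℝ) 1) (ht : |t| ≤ 1) :
    |bernoulliCgf p t - p * (1 - p) * (t ^ 2 / 2)| ≤ p * (1 - p) * |t| ^ 3 := by
  wlog h0 : 0 ≤ t generalizing p t
  · have := this (p := 1 - p) (t := -t) ⟨by linarith [hp.2], by linarith [hp.1]⟩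
      (by rwa [abs_neg]) (by linarith)
    rw [← bernoulliCgf_neg hp, abs_neg, neg_sq, sub_sub_cancel, mul_comm (1 - p)] at this
    exact this
  have hpp : 0 < p * (1 - p) := mul_pos hp.1 (by linarith [hp.2])
  obtain ⟨h1, h2⟩ := bernoulliCgf_bounds_of_nonneg hp h0
  rw [abs_of_nonneg h0] at ht ⊢
  have e1 := Real.exp_bound (x := t) (by rwa [abs_of_nonneg h0]) (n := 3) (by norm_num)
  have e2 := Real.exp_bound (x := -t) (by rwa [abs_neg, abs_of_nonneg h0]) (n := 3) (by norm_num)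
  rw [abs_neg] at e2
  rw [abs_of_nonneg h0] at e1 e2
  norm_num [Finset.sum_range_succ, Nat.factorial] at e1 e2
  have e1' := (abs_le.1 e1).2
  have e2' := (abs_le.1 e2).1
  have h3 : 0 ≤ t ^ 3 := by positivity
  rw [abs_le]
  constructor
  · nlinarith
  · nlinarith

/-- The ratio of the two mixture densities, at `c` and at `x`, is the moment generating function at
`x - c` of a Bernoulli variable with the posterior probability at `x`. -/
theorem gap_eq (x c : ℝ) :
    gap x c = (1 + Real.exp (-x)) * bernoulliCgf (postMinus x) (x - c) := by
  have h1 := Real.exp_pos (-x)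
  have h2 := Real.exp_pos (-c)
  have e1 : postMinus x = Real.exp (-x) / (1 + Real.exp (-x)) := by
    unfold postMinus; rw [Real.exp_neg]; field_simp; ring
  have e2 : 1 + postMinus x * (Real.exp (x - c) - 1) =
      (1 + Real.exp (-c)) / (1 + Real.exp (-x)) := by
    have : Real.exp (-x) * Real.exp (x - c) = Real.exp (-c) := by
      rw [← Real.exp_add]; ring_nf
    rw [e1, ← this]
    field_simp
    ring
  have e3 : (1 + Real.exp (-x)) * postMinus x = Real.exp (-x) := by
    rw [e1]; field_simp
  unfold bernoulliCgf
  rw [e2, Real.log_div (by positivity) (by positivity), gap, softlog_neg, softlog_neg, softlog,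
    softlog]
  linear_combination (x - c) * e3

/-- The variance factor combines with the prefactor: `(1 + exp (-x)) p (1 - p) = p` for `p =
postMinus x`. -/
theorem abs_gap_sub_le {x c : ℝ} (h : |x - c| ≤ 1) :
    |gap x c - postMinus x * ((x - c) ^ 2 / 2)| ≤ postMinus x * |x - c| ^ 3 := by
  have hp : postMinus x ∈ Set.Ioo (0 : ℝ) 1 := ⟨postMinus_pos x, postMinus_lt_one x⟩
  have h1 := abs_bernoulliCgf_sub_le hp h
  have he := Real.exp_pos (-x)
  have e : (1 + Real.exp (-x)) * (postMinus x * (1 - postMinus x)) = postMinus x := by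
    unfold postMinus; rw [Real.exp_neg]; field_simp; ring
  have e' : gap x c - postMinus x * ((x - c) ^ 2 / 2) = (1 + Real.exp (-x)) *
      (bernoulliCgf (postMinus x) (x - c) -
        postMinus x * (1 - postMinus x) * ((x - c) ^ 2 / 2)) := by
    rw [gap_eq]
    linear_combination ((x - c) ^ 2 / 2) * e
  rw [e', abs_mul, abs_of_pos (show 0 < 1 + Real.exp (-x) by positivity)]
  calc _ ≤ (1 + Real.exp (-x)) * (postMinus x * (1 - postMinus x) * |x - c| ^ 3) := by gcongr
    _ = _ := by rw [← mul_assoc, e]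

/-- Gibbs' inequality for the posterior at `x` against the posterior at `c`: the tangent-line terms
cancel because each posterior sums to one. -/
theorem gap_nonneg (x c : ℝ) : 0 ≤ gap x c := by
  have key : ∀ u v : ℝ, 1 - (1 + Real.exp (-v)) / (1 + Real.exp (-u)) ≤ softlog u - softlog v :=
    fun u v => by
      have hu := Real.exp_pos (-u)
      have hv := Real.exp_pos (-v)
      have := Real.log_le_sub_one_of_pos
        (show 0 < (1 + Real.exp (-v)) / (1 + Real.exp (-u)) by positivity)
      rw [Real.log_div (by positivity) (by positivity)] at this
      unfold softlog
      linarith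
  have h1 := key c x
  have h2 := mul_le_mul_of_nonneg_left (key (-c) (-x)) (Real.exp_pos (-x)).le
  have e : 1 - (1 + Real.exp (-x)) / (1 + Real.exp (-c)) +
      Real.exp (-x) * (1 - (1 + Real.exp (- -x)) / (1 + Real.exp (- -c))) = 0 := by
    rw [neg_neg, neg_neg, Real.exp_neg, Real.exp_neg]
    field_simp
    ring
  unfold gap
  linarith

/-- Crude, but valid without any restriction on `x - c`, as the unbounded tail cells require. -/
theorem gap_le (x c : ℝ) : gap x c ≤ Real.exp (-c) + Real.exp (-x) * Real.exp c := by
  have hb : ∀ u, softlog u ≤ Real.exp (-u) := fun u => by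
    have := Real.log_le_sub_one_of_pos (show 0 < 1 + Real.exp (-u) by positivity)
    unfold softlog
    linarith
  have h1 := hb c
  have h2 := hb (-c)
  rw [neg_neg] at h2
  have h3 : Real.exp (-x) * (softlog (-c) - softlog (-x)) ≤ Real.exp (-x) * Real.exp c :=
    mul_le_mul_of_nonneg_left (by linarith [softlog_nonneg (-x)]) (Real.exp_pos _).le
  unfold gap
  linarith [softlog_nonneg x]

/-! ### The loss of one cell -/

/-- The density of the second-order information loss. -/
def lossDens (σ x : ℝ) : ℝ := dens σ x * postMinus x

theorem lossDens_pos (hσ : 0 < σ) (x : ℝ) : 0 < lossDens σ x :=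
  mul_pos (dens_pos hσ x) (postMinus_pos x)

@[fun_prop]
theorem continuous_lossDens (σ : ℝ) : Continuous (lossDens σ) := by unfold lossDens; fun_prop

theorem continuous_gap (c : ℝ) : Continuous fun x => gap x c := by
  have h : Continuous softlog := by
    unfold softlog
    exact Continuous.log (by fun_prop) fun x => by positivity
  unfold gap
  fun_prop

/-- The logarithmic Lipschitz constant of `lossDens` on `[-T - 1, T + 1]`, divided by `1 + T`. -/
def lipConst (σ : ℝ) : ℝ := 3 / 2 + 1 / (2 * mean σ)

/-- The exponent of the Gaussian density has slope `O(1 + T)` on this range, and `log postMinus` is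
1-Lipschitz. Over one cell the loss density therefore varies by a factor `exp (O((1 + T) δ))`. -/
theorem lossDens_le (hσ : 0 < σ) {T x y : ℝ} (hT : 0 ≤ T) (hx : |x| ≤ T + 1) (hy : |y| ≤ T + 1) :
    lossDens σ x ≤ lossDens σ y * Real.exp (lipConst σ * (1 + T) * |x - y|) := by
  have hm := mean_pos hσ
  have h1 : dens σ x ≤ dens σ y * Real.exp ((1 / 2 + 1 / (2 * mean σ) * (1 + T)) * |x - y|) := by
    rw [dens_eq hσ, dens_eq hσ, mul_assoc, ← Real.exp_add]
    have hc := densConst_pos hσ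
    gcongr
    have e1 : x / 2 - x ^ 2 / (4 * mean σ) - (y / 2 - y ^ 2 / (4 * mean σ)) =
        1 / 2 * (x - y) + 1 / (4 * mean σ) * ((-(x + y)) * (x - y)) := by field_simp; ring
    have e2 : -(x + y) * (x - y) ≤ 2 * (1 + T) * |x - y| := by
      have a1 : |-(x + y)| ≤ 2 * (1 + T) := by
        rw [abs_neg]
        exact (abs_add_le x y).trans (by linarith)
      calc -(x + y) * (x - y) ≤ |-(x + y) * (x - y)| := le_abs_self _
        _ = |-(x + y)| * |x - y| := abs_mul _ _
        _ ≤ _ := by gcongr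
    have e3 : 1 / (4 * mean σ) * ((-(x + y)) * (x - y)) ≤
        1 / (4 * mean σ) * (2 * (1 + T) * |x - y|) := by gcongr
    have e4 : 1 / (4 * mean σ) * (2 * (1 + T) * |x - y|) =
        1 / (2 * mean σ) * (1 + T) * |x - y| := by field_simp; ring
    linarith [le_abs_self (x - y)]
  have h2 : postMinus x ≤ postMinus y * Real.exp |x - y| := by
    unfold postMinus
    have hex := Real.exp_pos x
    have hey := Real.exp_pos y
    rw [one_div_mul_eq_div, div_le_div_iff₀ (by positivity) (by positivity)]
    have a1 : 1 ≤ Real.exp |x - y| := Real.one_le_exp (abs_nonneg _)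
    have a2 : Real.exp y ≤ Real.exp |x - y| * Real.exp x := by
      rw [← Real.exp_add]
      apply Real.exp_le_exp.2
      linarith [neg_abs_le (x - y)]
    linarith
  calc lossDens σ x ≤ (dens σ y * Real.exp ((1 / 2 + 1 / (2 * mean σ) * (1 + T)) * |x - y|)) *
        (postMinus y * Real.exp |x - y|) :=
        mul_le_mul h1 h2 (postMinus_pos x).le (mul_nonneg (dens_pos hσ y).le (Real.exp_pos _).le)
    _ = lossDens σ y * Real.exp ((3 / 2 + 1 / (2 * mean σ) * (1 + T)) * |x - y|) := by
        rw [show (3 / 2 + 1 / (2 * mean σ) * (1 + T)) * |x - y| =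
          (1 / 2 + 1 / (2 * mean σ) * (1 + T)) * |x - y| + |x - y| by ring, Real.exp_add, lossDens]
        ring
    _ ≤ _ := by
        have := lossDens_pos hσ y
        unfold lipConst
        gcongr
        nlinarith

theorem abs_sq_sub_mul_add_sq_div_sub_le {p q δ η : ℝ} (hδ : 0 < δ) (hη0 : 0 ≤ η)
    (hη : η ≤ 1 / 4) (hp : |p - δ / 2| ≤ η * δ) (hq : |q - δ / 2| ≤ η * δ) :
    |(p ^ 2 - p * q + q ^ 2) / 3 - δ ^ 2 / 12| ≤ 2 / 3 * η * δ ^ 2 := by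
  obtain ⟨α, rfl⟩ : ∃ α, p = δ / 2 + α := ⟨p - δ / 2, by ring⟩
  obtain ⟨β, rfl⟩ : ∃ β, q = δ / 2 + β := ⟨q - δ / 2, by ring⟩
  rw [add_sub_cancel_left] at hp hq
  have e : ((δ / 2 + α) ^ 2 - (δ / 2 + α) * (δ / 2 + β) + (δ / 2 + β) ^ 2) / 3 - δ ^ 2 / 12 =
      (δ / 2 * (α + β) + (α ^ 2 - α * β + β ^ 2)) / 3 := by ring
  have hy : 0 ≤ η * δ := by positivity
  have a1 := abs_le.1 ((abs_add_le α β).trans (add_le_add hp hq))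
  have b1 : α ^ 2 ≤ (η * δ) ^ 2 := sq_le_sq.2 (by rwa [abs_of_nonneg hy])
  have b2 : β ^ 2 ≤ (η * δ) ^ 2 := sq_le_sq.2 (by rwa [abs_of_nonneg hy])
  have b3 : |α * β| ≤ (η * δ) ^ 2 := by
    rw [abs_mul, sq]
    exact mul_le_mul hp hq (abs_nonneg _) hy
  have b4 := abs_le.1 b3
  have a5 : (η * δ) ^ 2 ≤ η / 4 * δ ^ 2 := by
    rw [mul_pow]
    exact mul_le_mul_of_nonneg_right (by nlinarith) (sq_nonneg δ)
  have a6 := mul_le_mul_of_nonneg_left a1.1 hδ.le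
  have a7 := mul_le_mul_of_nonneg_left a1.2 hδ.le
  have a8 : 0 ≤ η * δ ^ 2 := by positivity
  have s1 := sq_nonneg α
  have s2 := sq_nonneg β
  rw [e, abs_le]
  constructor <;> nlinarith

/-- The number `r` is the mean of `(x - c)²` under the uniform law on the cell. A density within
`exp (±ω)` of a constant changes this mean by a relative error `O(ω)`. -/
theorem abs_secondMoment_sub_le {G : ℝ → ℝ} (hGc : Continuous G) {p q c g r ω δ : ℝ}
    (hp0 : 0 < p) (hq0 : 0 < q) (hω0 : 0 ≤ ω) (hω : ω ≤ 1 / 2) (hg : 0 < g)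
    (hup : ∀ x ∈ Set.Icc (c - p) (c + q), G x ≤ Real.exp ω * g)
    (hlow : ∀ x ∈ Set.Icc (c - p) (c + q), Real.exp (-ω) * g ≤ G x)
    (hr : r = (p ^ 2 - p * q + q ^ 2) / 3) (hr1 : r ≤ δ ^ 2 / 4) :
    |(∫ x in (c - p)..(c + q), (x - c) ^ 2 * G x) - r * ∫ x in (c - p)..(c + q), G x| ≤
      ω * δ ^ 2 * ∫ x in (c - p)..(c + q), G x := by
  have hle : c - p ≤ c + q := by linarith
  set I := ∫ x in (c - p)..(c + q), G x with hI
  have hii : ∀ {g : ℝ → ℝ}, Continuous g → IntervalIntegrable g volume (c - p) (c + q) :=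
    fun hg => hg.intervalIntegrable _ _
  set A := ∫ x in (c - p)..(c + q), (x - c) ^ 2 * G x with hA
  have hmom : ∫ x in (c - p)..(c + q), (x - c) ^ 2 = (p ^ 3 + q ^ 3) / 3 := by
    rw [intervalIntegral.integral_comp_sub_right (fun x => x ^ 2) c, integral_pow]
    push_cast
    ring
  have hlen : ∫ x in (c - p)..(c + q), (1 : ℝ) = p + q := by
    rw [intervalIntegral.integral_const]
    simp
    ring
  have hAup : A ≤ Real.exp ω * g * ((p ^ 3 + q ^ 3) / 3) := by
    rw [← hmom, ← intervalIntegral.integral_const_mul]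
    apply intervalIntegral.integral_mono_on hle (hii (by fun_prop)) (hii (by fun_prop))
    intro x hx
    rw [mul_comm]
    exact mul_le_mul_of_nonneg_right (hup x hx) (sq_nonneg _)
  have hAlow : Real.exp (-ω) * g * ((p ^ 3 + q ^ 3) / 3) ≤ A := by
    rw [← hmom, ← intervalIntegral.integral_const_mul]
    apply intervalIntegral.integral_mono_on hle (hii (by fun_prop)) (hii (by fun_prop))
    intro x hx
    rw [mul_comm ((x - c) ^ 2)]
    exact mul_le_mul_of_nonneg_right (hlow x hx) (sq_nonneg _)
  have hIup : I ≤ Real.exp ω * g * (p + q) := by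
    rw [← hlen, ← intervalIntegral.integral_const_mul]
    apply intervalIntegral.integral_mono_on hle (hii hGc) (hii (by fun_prop))
    intro x hx
    rw [mul_one]
    exact hup x hx
  have hIlow : Real.exp (-ω) * g * (p + q) ≤ I := by
    rw [← hlen, ← intervalIntegral.integral_const_mul]
    apply intervalIntegral.integral_mono_on hle (hii (by fun_prop)) (hii hGc)
    intro x hx
    rw [mul_one]
    exact hlow x hx
  have hI0 : 0 < I := lt_of_lt_of_le
    (mul_pos (mul_pos (Real.exp_pos _) (hg)) (by linarith)) hIlow
  have hcube : (p ^ 3 + q ^ 3) / 3 = (p + q) * r := by rw [hr]; ring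
  have hr0 : 0 ≤ r := by rw [hr]; nlinarith [sq_nonneg (p - q), mul_pos hp0 hq0]
  have hexp1 : Real.exp ω ≤ Real.exp (-ω) * (1 + 4 * ω) := by
    have e : Real.exp ω = Real.exp (-ω) * Real.exp (2 * ω) := by rw [← Real.exp_add]; ring_nf
    have := (abs_le.1 (Real.abs_exp_sub_one_le (x := 2 * ω)
      (by rw [abs_of_nonneg (by positivity)]; linarith))).2
    rw [abs_of_nonneg (by positivity)] at this
    rw [e]
    gcongr
    linarith
  have hpq : 0 < p + q := by linarith
  have hA1 : A ≤ (1 + 4 * ω) * r * I := by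
    calc A ≤ Real.exp ω * g * ((p + q) * r) := by rw [← hcube]; exact hAup
      _ ≤ (Real.exp (-ω) * (1 + 4 * ω)) * g * ((p + q) * r) := by gcongr
      _ = (1 + 4 * ω) * r * (Real.exp (-ω) * g * (p + q)) := by ring
      _ ≤ _ := by gcongr
  have hA2 : r * I ≤ (1 + 4 * ω) * A := by
    calc r * I ≤ r * (Real.exp ω * g * (p + q)) := by gcongr
      _ ≤ r * ((Real.exp (-ω) * (1 + 4 * ω)) * g * (p + q)) := by gcongr
      _ = (1 + 4 * ω) * (Real.exp (-ω) * g * ((p + q) * r)) := by ring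
      _ ≤ _ := by rw [← hcube]; gcongr
  have a1 : 4 * ω * (r * I) ≤ ω * δ ^ 2 * I := by
    have := mul_le_mul_of_nonneg_right (mul_le_mul_of_nonneg_left hr1 hω0) hI0.le
    linarith
  have hrI : 0 ≤ r * I := by positivity
  rw [abs_le]
  constructor
  · by_contra! hlt
    have : A < r * I * (1 - 4 * ω) := by linarith
    have := mul_lt_mul_of_pos_left this (show 0 < 1 + 4 * ω by linarith)
    nlinarith [mul_nonneg (mul_nonneg hω0 hω0) hrI]
  · linarith

/-- Three errors are added: variation of the loss density over the cell (`ω`), unequal half-widths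
(`η`), and the cubic remainder of `gap` (`δ`). -/
theorem abs_cell_sub_le (hσ : 0 < σ) {T δ η c p q : ℝ} (hT : 0 ≤ T) (hδ : 0 < δ) (hδ1 : δ ≤ 1)
    (hη : η ≤ 1 / 4) (hp : |p - δ / 2| ≤ η * δ) (hq : |q - δ / 2| ≤ η * δ)
    (hc : |c| ≤ T) (hω : lipConst σ * (1 + T) * δ ≤ 1 / 2) :
    |(∫ x in (c - p)..(c + q), dens σ x * gap x c) -
        δ ^ 2 / 24 * ∫ x in (c - p)..(c + q), lossDens σ x| ≤
      (lipConst σ * (1 + T) * δ + η + δ) * δ ^ 2 * ∫ x in (c - p)..(c + q), lossDens σ x := by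
  have hm := mean_pos hσ
  have hη0 : 0 ≤ η := by
    by_contra! hneg
    have := (abs_nonneg _).trans hp
    nlinarith
  have hηδ : η * δ ≤ δ / 4 := by nlinarith
  have hp' := abs_le.1 hp
  have hq' := abs_le.1 hq
  have hp0 : 0 < p := by linarith
  have hq0 : 0 < q := by linarith
  have hp1 : p ≤ δ := by linarith
  have hq1 : q ≤ δ := by linarith
  have hle : c - p ≤ c + q := by linarith
  set ω := lipConst σ * (1 + T) * δ with hωdef
  have hlc : 0 < lipConst σ := by unfold lipConst; positivity
  have hω0 : 0 ≤ ω := by positivity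
  set G := lossDens σ with hG
  have hGpos : ∀ x, 0 < G x := lossDens_pos hσ
  have hGc : Continuous G := continuous_lossDens σ
  set I := ∫ x in (c - p)..(c + q), G x with hI
  have habs : ∀ x ∈ Set.Icc (c - p) (c + q), |x - c| ≤ δ := fun x hx =>
    abs_le.2 ⟨by linarith [hx.1], by linarith [hx.2]⟩
  have hbig : ∀ x ∈ Set.Icc (c - p) (c + q), |x| ≤ T + 1 := fun x hx => by
    have h1 : |x| ≤ |x - c| + |c| := by simpa using abs_add_le (x - c) c
    linarith [habs x hx]
  have hup : ∀ x ∈ Set.Icc (c - p) (c + q), G x ≤ Real.exp ω * G c := fun x hx => by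
    refine (lossDens_le hσ hT (hbig x hx) (by linarith)).trans ?_
    rw [mul_comm]
    have := (hGpos c).le
    gcongr
    rw [hωdef]
    have := habs x hx
    gcongr
  have hlow : ∀ x ∈ Set.Icc (c - p) (c + q), Real.exp (-ω) * G c ≤ G x := fun x hx => by
    have h1 := lossDens_le hσ hT (show |c| ≤ T + 1 by linarith) (hbig x hx)
    have h2 : Real.exp (lipConst σ * (1 + T) * |c - x|) ≤ Real.exp ω := by
      rw [hωdef]
      have := habs x hx
      rw [abs_sub_comm] at this
      gcongr
    rw [Real.exp_neg, inv_mul_le_iff₀ (Real.exp_pos _), mul_comm]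
    exact h1.trans (mul_le_mul_of_nonneg_left h2 (hGpos x).le)
  have hii : ∀ {g : ℝ → ℝ}, Continuous g → IntervalIntegrable g volume (c - p) (c + q) :=
    fun hg => hg.intervalIntegrable _ _
  set r := (p ^ 2 - p * q + q ^ 2) / 3 with hr
  have hr1 : r ≤ δ ^ 2 / 4 := by
    rw [hr]
    have a1 : p ≤ 3 / 4 * δ := by linarith
    have a2 : q ≤ 3 / 4 * δ := by linarith
    rcases le_total p q with h | h
    · nlinarith
    · nlinarith
  have hr2 := abs_sq_sub_mul_add_sq_div_sub_le hδ hη0 hη hp hq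
  rw [← hr] at hr2
  have hI0 : 0 ≤ I := intervalIntegral.integral_nonneg hle fun x _ => (hGpos x).le
  have hAr := abs_secondMoment_sub_le hGc hp0 hq0 hω0 hω (hGpos c) hup hlow hr hr1
  rw [← hI] at hAr
  set A := ∫ x in (c - p)..(c + q), (x - c) ^ 2 * G x with hA
  have hrem : |(∫ x in (c - p)..(c + q), dens σ x * gap x c) - 1 / 2 * A| ≤ δ ^ 3 * I := by
    have hgc := continuous_gap c
    rw [hA, ← intervalIntegral.integral_const_mul, ← intervalIntegral.integral_sub
      (hii (by fun_prop)) (hii (by fun_prop)), hI, ← intervalIntegral.integral_const_mul]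
    refine (intervalIntegral.abs_integral_le_integral_abs hle).trans ?_
    apply intervalIntegral.integral_mono_on hle (hii (by fun_prop)) (hii (by fun_prop))
    intro x hx
    have h1 := habs x hx
    have h2 := abs_gap_sub_le (h1.trans hδ1)
    have e : dens σ x * gap x c - 1 / 2 * ((x - c) ^ 2 * G x) =
        dens σ x * (gap x c - postMinus x * ((x - c) ^ 2 / 2)) := by
      rw [hG, lossDens]; ring
    rw [e, abs_mul, abs_of_pos (dens_pos hσ x)]
    calc dens σ x * |gap x c - postMinus x * ((x - c) ^ 2 / 2)| ≤
        dens σ x * (postMinus x * |x - c| ^ 3) :=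
          mul_le_mul_of_nonneg_left h2 (dens_pos hσ x).le
      _ = |x - c| ^ 3 * G x := by rw [hG, lossDens]; ring
      _ ≤ δ ^ 3 * G x := by
          have := (hGpos x).le
          gcongr
  have a1 := abs_le.1 hrem
  have a2 := abs_le.1 hAr
  have a3 := abs_le.1 hr2
  have a4 := mul_le_mul_of_nonneg_right a3.1 hI0
  have a5 := mul_le_mul_of_nonneg_right a3.2 hI0
  have p1 : 0 ≤ ω * δ ^ 2 * I := by positivity
  have p2 : 0 ≤ η * δ ^ 2 * I := by positivity
  rw [abs_le]
  constructor <;> linarith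

/-! ### The constant -/

theorem kappa_eq (hσ : 0 < σ) : kappa σ = ∫ x, postMinus x ^ 2 ∂muPlus σ := by
  have h1 : muPlus σ = (gaussianReal 0 1).map fun x => mean σ + sd σ * x := by
    have : (fun x : ℝ => mean σ + sd σ * x) = (fun x => mean σ + x) ∘ fun x => sd σ * x := rfl
    rw [muPlus_eq hσ, this, ← Measure.map_map (by fun_prop) (by fun_prop),
      gaussianReal_map_const_mul, gaussianReal_map_const_add]
    congr 1
    · ring
    · ext
      simp [sq_nonneg]
  rw [h1, integral_map (f := fun x => postMinus x ^ 2) (by fun_prop)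
    (continuous_postMinus.pow 2).aestronglyMeasurable, kappa]
  simp only [postMinus, div_pow, one_pow]

/-- Split `p = p² + p (1 - p)`. The second part is `exp (-x) * postMinus (-x)²`, whose `μ₊`-integral
becomes that of the first after passing to `μ₋` and reflecting. -/
theorem integral_postMinus (hσ : 0 < σ) : ∫ x, postMinus x ∂muPlus σ = 2 * kappa σ := by
  have := isProbabilityMeasure_muPlus hσ
  have hb : ∀ x, ‖postMinus x ^ 2‖ ≤ 1 := fun x => by
    rw [Real.norm_of_nonneg (sq_nonneg _)]
    exact pow_le_one₀ (postMinus_pos x).le (postMinus_lt_one x).le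
  have i1 : Integrable (fun x => postMinus x ^ 2) (muPlus σ) :=
    Integrable.of_bound (continuous_postMinus.pow 2).aestronglyMeasurable 1 (ae_of_all _ hb)
  have i2 : Integrable (fun x => Real.exp (-x) * postMinus (-x) ^ 2) (muPlus σ) := by
    have := isProbabilityMeasure_muMinus hσ
    refine (integrable_muMinus_iff hσ fun x => postMinus (-x) ^ 2).1 ?_
    exact Integrable.of_bound
      ((continuous_postMinus.comp continuous_neg).pow 2).aestronglyMeasurable 1
      (ae_of_all _ fun x => hb (-x))
  have e : ∀ x, postMinus x = postMinus x ^ 2 + Real.exp (-x) * postMinus (-x) ^ 2 := fun x => by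
    unfold postMinus
    rw [Real.exp_neg]
    field_simp
    ring
  rw [integral_congr_ae (ae_of_all _ e), integral_add i1 i2,
    ← integral_muMinus hσ fun x => postMinus (-x) ^ 2,
    integral_muMinus_eq_neg hσ (g := fun x => postMinus (-x) ^ 2)
      ((continuous_postMinus.comp continuous_neg).pow 2).measurable, kappa_eq hσ]
  simp only [neg_neg]
  ring

theorem kappa_pos (hσ : 0 < σ) : 0 < kappa σ := by
  have := isProbabilityMeasure_muPlus hσ
  rw [kappa_eq hσ]
  refine (integral_pos_iff_support_of_nonneg (fun x => sq_nonneg _) ?_).2 ?_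
  · exact Integrable.of_bound (continuous_postMinus.pow 2).aestronglyMeasurable 1
      (ae_of_all _ fun x => by
        rw [Real.norm_of_nonneg (sq_nonneg _)]
        exact pow_le_one₀ (postMinus_pos x).le (postMinus_lt_one x).le)
  · have : (Function.support fun x => postMinus x ^ 2) = Set.univ := by
      ext x; simp [(postMinus_pos x).ne']
    rw [this]
    simp

end BIAWGN

namespace BIAWGN

/-! ### The loss of the quantizer -/

variable {σ : ℝ}

section

variable {L : ℕ} {Ltail : ℤ} {a : ℕ → ℝ} {δ η : ℝ}

/-- Puts the three shapes of central bin in one form; endpoints are null, and for negative symbols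
left and right half-widths exchange roles. -/
theorem OrderedCutoffs.central_bin (hσ : 0 < σ) (h : OrderedCutoffs L Ltail a)
    (hdev : ∀ k ∈ Set.Icc 1 L, |a k - ((k : ℝ) - 1 / 2) * δ| ≤ η * δ) {k : ℤ}
    (hk : k ∈ Finset.Ioo (-(L : ℤ)) L) :
    ∃ p q : ℝ, |p - δ / 2| ≤ η * δ ∧ |q - δ / 2| ≤ η * δ ∧
      ∀ g : ℝ → ℝ, ∫ x in bin L Ltail a k, g x ∂muPlus σ =
        ∫ x in (k * δ - p)..(k * δ + q), dens σ x * g x := by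
  have hL := h.one_le
  have ha1 := h.pos
  rw [Finset.mem_Ioo] at hk
  rcases lt_trichotomy k 0 with hk0 | hk0 | hk0
  · obtain ⟨j, rfl⟩ : ∃ j : ℕ, k = -j := ⟨k.natAbs, by omega⟩
    have d1 := hdev j ⟨by omega, by omega⟩
    have d2 := hdev (j + 1) ⟨by omega, by omega⟩
    push_cast at d2 ⊢
    refine ⟨a (j + 1) - j * δ, j * δ - a j, ?_, ?_, fun g => ?_⟩
    · convert d2 using 2; ring
    · rw [abs_sub_comm]; convert d1 using 2; ring
    · have hle : a j ≤ a (j + 1) := h.le_of_le (by omega) (by omega) (by omega)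
      have hb : bin L Ltail a (-j) = Set.Ioc (-a (j + 1)) (-a j) := by
        ext x
        have hj : j < L := by omega
        simp only [bin, if_neg hk0.ne, if_neg hk0.not_gt, posBin, Int.natAbs_neg,
          Int.natAbs_natCast, if_pos hj, Set.mem_ofPred_eq, Set.mem_Ico, Set.mem_Ioc]
        constructor <;> rintro ⟨h1, h2⟩ <;> constructor <;> linarith
      rw [setIntegral_muPlus hσ _ (measurableSet_bin _), hb,
        intervalIntegral.integral_of_le (by linarith)]
      congr 2
      ring_nf
  · have d1 := hdev 1 ⟨le_rfl, hL⟩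
    subst hk0
    refine ⟨a 1, a 1, ?_, ?_, fun g => ?_⟩
    · convert d1 using 2; push_cast; ring
    · convert d1 using 2; push_cast; ring
    · have hb : bin L Ltail a 0 = Set.Ioo (-a 1) (a 1) := by rw [bin, if_pos rfl]
      rw [setIntegral_muPlus hσ _ (measurableSet_bin _), hb, ← integral_Ioc_eq_integral_Ioo,
        intervalIntegral.integral_of_le (by linarith)]
      simp
  · obtain ⟨j, rfl⟩ : ∃ j : ℕ, k = j := ⟨k.natAbs, by omega⟩
    have d1 := hdev j ⟨by omega, by omega⟩
    have d2 := hdev (j + 1) ⟨by omega, by omega⟩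
    push_cast at d2 ⊢
    refine ⟨j * δ - a j, a (j + 1) - j * δ, ?_, ?_, fun g => ?_⟩
    · rw [abs_sub_comm]; convert d1 using 2; ring
    · convert d2 using 2; ring
    · have hle : a j ≤ a (j + 1) := h.le_of_le (by omega) (by omega) (by omega)
      have hb : bin L Ltail a j = Set.Ico (a j) (a (j + 1)) := by
        have hj : j < L := by omega
        rw [bin, if_neg hk0.ne', if_pos hk0, posBin, Int.natAbs_natCast, if_pos hj]
      rw [setIntegral_muPlus hσ _ (measurableSet_bin _), hb, integral_Ico_eq_integral_Ioc,
        intervalIntegral.integral_of_le (by linarith)]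
      congr 2
      ring_nf

theorem OrderedCutoffs.integral_eq_sum (h : OrderedCutoffs L Ltail a)
    {g : ℝ → ℝ} (hg : Integrable g (muPlus σ)) :
    ∫ x, g x ∂muPlus σ = ∑ k ∈ symbols L Ltail, ∫ x in bin L Ltail a k, g x ∂muPlus σ := by
  rw [← integral_biUnion_finset _ (fun k _ => measurableSet_bin k)
    (fun k _ l _ hkl => Set.disjoint_left.2 fun x hk hl => hkl (h.bin_unique hk hl))
    (fun k _ => hg.integrableOn)]
  have : ⋃ k ∈ symbols L Ltail, bin L Ltail a k = Set.univ := by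
    ext x
    simpa using h.exists_bin x
  rw [this, Measure.restrict_univ]

theorem OrderedCutoffs.tail_bins (hσ : 0 < σ) (h : OrderedCutoffs L Ltail a)
    (hT : 0 < a L) {k : ℤ} (hk : k = -Ltail ∨ k = Ltail) :
    (muPlus σ).real (bin L Ltail a k) + (muMinus σ).real (bin L Ltail a k) =
      tailProb σ (a L) := by
  have hlt := h.le_tail
  have hL := h.one_le
  have hb : posBin L Ltail a Ltail.natAbs = Set.Ici (a L) := by
    rw [posBin, if_neg (by omega), if_pos (by omega)]
  rw [tailProb_eq hσ hT]
  rcases hk with hk | hk <;> rw [hk]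
  · have : bin L Ltail a (-Ltail) = {x | -x ∈ Set.Ici (a L)} := by
      rw [bin, if_neg (by omega), if_neg (by omega), Int.natAbs_neg, hb]
    rw [this, ← muMinus_real_eq_neg hσ measurableSet_Ici, ← muPlus_real_eq_neg hσ measurableSet_Ici,
      add_comm]
  · have : bin L Ltail a Ltail = Set.Ici (a L) := by
      rw [bin, if_neg (by omega), if_pos (by omega), hb]
    rw [this]

/-- On a cell with LLR `c`, the relation `μ₋ = exp (-c) μ₊` turns the integrated crude bound `exp
(-c) μ₊ + exp c μ₋` into `μ₋ + μ₊`. -/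
theorem setIntegral_gap_le (hσ : 0 < σ) (hex : ExactLattice σ δ L Ltail a) {k : ℤ}
    (hk : k ∈ symbols L Ltail) : ∫ x in bin L Ltail a k, gap x (k * δ) ∂muPlus σ ≤
      (muPlus σ).real (bin L Ltail a k) + (muMinus σ).real (bin L Ltail a k) := by
  have hP := isProbabilityMeasure_muPlus hσ
  have hM := isProbabilityMeasure_muMinus hσ
  have hMP : (muMinus σ).real (bin L Ltail a k) =
      Real.exp (-(k * δ)) * (muPlus σ).real (bin L Ltail a k) := by
    rw [measureReal_def, muMinus_bin hσ hex hk, ENNReal.toReal_mul,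
      ENNReal.toReal_ofReal (Real.exp_pos _).le, measureReal_def]
  have i1 : Integrable (fun x => Real.exp (-x)) (muPlus σ) := by
    have := (integrable_muMinus_iff hσ fun _ => 1).1 (integrable_const 1)
    simpa using this
  have i2 : Integrable (fun x => Real.exp (-(k * δ)) + Real.exp (-x) * Real.exp (k * δ))
      (muPlus σ) := (integrable_const _).add (i1.mul_const _)
  have hc := continuous_gap (k * δ)
  calc ∫ x in bin L Ltail a k, gap x (k * δ) ∂muPlus σ ≤
      ∫ x in bin L Ltail a k, (Real.exp (-(k * δ)) + Real.exp (-x) * Real.exp (k * δ))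
        ∂muPlus σ := by
        apply integral_mono _ i2.integrableOn (fun x => gap_le x _)
        exact (i2.mono' hc.aestronglyMeasurable (ae_of_all _ fun x => by
          rw [Real.norm_of_nonneg (gap_nonneg _ _)]; exact gap_le x _)).integrableOn
    _ = (muPlus σ).real (bin L Ltail a k) * Real.exp (-(k * δ)) +
        (muMinus σ).real (bin L Ltail a k) * Real.exp (k * δ) := by
        rw [integral_add (integrable_const _) (i1.mul_const _).integrableOn, integral_mul_const,
          ← muMinus_real_eq hσ (measurableSet_bin k)]
        simp
    _ = _ := by
        have e : Real.exp (-(k * δ)) * Real.exp (k * δ) = 1 := by rw [← Real.exp_add]; simp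
        rw [hMP]
        linear_combination (muPlus σ).real (bin L Ltail a k) * e

/-- The main terms sum to `δ² / 24` times the full integral of `postMinus`, so the tail cells are
included there as well and their share is charged to the error. -/
theorem abs_capacity_sub_sub_le (hσ : 0 < σ) (h : OrderedCutoffs L Ltail a) {T : ℝ} (hT : 0 < T)
    (haL : a L = T) (hδT : ((L : ℝ) - 1 / 2) * δ = T) (hδ : 0 < δ) (hδ1 : δ ≤ 1)
    (hex : ExactLattice σ δ L Ltail a) (hη : η ≤ 1 / 4)
    (hω : lipConst σ * (1 + T) * δ ≤ 1 / 2)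
    (hdev : ∀ k ∈ Set.Icc 1 L, |a k - ((k : ℝ) - 1 / 2) * δ| ≤ η * δ) :
    |(capacity σ - inducedCapacity σ L Ltail a) - kappa σ / 24 * δ ^ 2| ≤
      (lipConst σ * (1 + T) * δ + η + δ) * δ ^ 2 + 2 * tailProb σ T := by
  have hP := isProbabilityMeasure_muPlus hσ
  have hm := mean_pos hσ
  have hL := h.one_le
  have hη0 : 0 ≤ η := by
    have := (abs_nonneg _).trans (hdev 1 ⟨le_rfl, hL⟩)
    by_contra! hneg
    nlinarith
  have hlc : 0 < lipConst σ := by unfold lipConst; positivity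
  set ε := (lipConst σ * (1 + T) * δ + η + δ) * δ ^ 2 with hε
  have hε0 : 0 ≤ ε := by positivity
  have i1 := integrable_gap_quantize (L := L) (Ltail := Ltail) (a := a) (δ := δ) hσ
  have i2 : Integrable postMinus (muPlus σ) :=
    Integrable.of_bound continuous_postMinus.aestronglyMeasurable 1 (ae_of_all _ fun x => by
      rw [Real.norm_of_nonneg (postMinus_pos x).le]; exact (postMinus_lt_one x).le)
  set A : ℤ → ℝ := fun k => ∫ x in bin L Ltail a k, gap x (k * δ) ∂muPlus σ with hA
  set D : ℤ → ℝ := fun k => ∫ x in bin L Ltail a k, postMinus x ∂muPlus σ with hD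
  have hD0 : ∀ k, 0 ≤ D k := fun k => integral_nonneg fun x => (postMinus_pos x).le
  have hsum1 : ∫ x, gap x (quantize L Ltail a x * δ) ∂muPlus σ = ∑ k ∈ symbols L Ltail, A k := by
    rw [h.integral_eq_sum i1]
    refine Finset.sum_congr rfl fun k hk => setIntegral_congr_fun (measurableSet_bin k) ?_
    intro x hx
    simp only [h.quantize_eq hk hx]
  have hsum2 : 2 * kappa σ = ∑ k ∈ symbols L Ltail, D k := by
    rw [← integral_postMinus hσ, h.integral_eq_sum i2]
  have hcent : ∀ k ∈ Finset.Ioo (-(L : ℤ)) L, |A k - δ ^ 2 / 24 * D k| ≤ ε * D k := by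
    intro k hk
    obtain ⟨p, q, hp, hq, hg⟩ := h.central_bin hσ hdev hk
    have hkT : |(k : ℝ) * δ| ≤ T := by
      rw [abs_mul, abs_of_pos hδ, ← hδT]
      apply mul_le_mul_of_nonneg_right _ hδ.le
      have : |k| ≤ (L : ℤ) - 1 := by
        rw [Finset.mem_Ioo] at hk
        rw [abs_le]; omega
      have h' : |(k : ℝ)| ≤ (L : ℝ) - 1 := by exact_mod_cast this
      linarith
    have := abs_cell_sub_le hσ hT.le hδ hδ1 hη hp hq hkT hω
    simp only [hA, hD, hg]
    exact this
  -- In a tail cell both the true loss and its nominal second-order share are at most `Ψ(T)`.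
  have htail : ∀ k ∈ symbols L Ltail \ Finset.Ioo (-(L : ℤ)) L,
      |A k - δ ^ 2 / 24 * D k| ≤ 2 * tailProb σ T := by
    intro k hk
    rw [Finset.mem_sdiff] at hk
    have hk' : k = -Ltail ∨ k = Ltail := by
      have h1 := mem_symbols.1 hk.1
      rw [Finset.mem_Ioo] at hk
      tauto
    have h1 := setIntegral_gap_le hσ hex hk.1
    have h2 := h.tail_bins hσ (by rw [haL]; exact hT) hk'
    rw [h2, haL] at h1
    have h3 : 0 ≤ A k := integral_nonneg fun x => gap_nonneg _ _
    have h4 : D k ≤ tailProb σ T := by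
      calc D k ≤ ∫ x in bin L Ltail a k, (1 : ℝ) ∂muPlus σ :=
            integral_mono i2.integrableOn (integrable_const _) fun x => (postMinus_lt_one x).le
        _ = (muPlus σ).real (bin L Ltail a k) := by simp
        _ ≤ _ := by
          rw [← haL, ← h2]
          have : 0 ≤ (muMinus σ).real (bin L Ltail a k) := measureReal_nonneg
          linarith
    have h5 : δ ^ 2 ≤ 1 := pow_le_one₀ hδ.le hδ1
    have h6 := hD0 k
    rw [abs_le]
    constructor <;> nlinarith
  have hcard : (symbols L Ltail \ Finset.Ioo (-(L : ℤ)) L).card ≤ 2 := by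
    refine (Finset.card_le_card (t := {-Ltail, Ltail}) ?_).trans Finset.card_le_two
    intro k hk
    rw [Finset.mem_sdiff, mem_symbols, Finset.mem_Ioo] at hk
    simp only [Finset.mem_insert, Finset.mem_singleton]
    tauto
  have hsub : Finset.Ioo (-(L : ℤ)) L ⊆ symbols L Ltail := Finset.subset_union_left
  have hΨ : 0 ≤ tailProb σ T := measureReal_nonneg
  have hmain : |∑ k ∈ symbols L Ltail, (A k - δ ^ 2 / 24 * D k)| ≤
      ε * (2 * kappa σ) + 2 * (2 * tailProb σ T) := by
    refine (Finset.abs_sum_le_sum_abs _ _).trans ?_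
    rw [← Finset.sum_sdiff hsub, add_comm]
    apply add_le_add
    · calc ∑ k ∈ Finset.Ioo (-(L : ℤ)) L, |A k - δ ^ 2 / 24 * D k| ≤
          ∑ k ∈ Finset.Ioo (-(L : ℤ)) L, ε * D k := Finset.sum_le_sum hcent
        _ = ε * ∑ k ∈ Finset.Ioo (-(L : ℤ)) L, D k := by rw [Finset.mul_sum]
        _ ≤ _ := by
          rw [hsum2]
          gcongr
          exact fun k _ _ => hD0 k
    · refine (Finset.sum_le_card_nsmul _ _ _ htail).trans ?_
      rw [nsmul_eq_mul]
      gcongr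
      exact_mod_cast hcard
  have hκ : 2 * kappa σ ≤ 1 := by
    rw [← integral_postMinus hσ]
    calc ∫ x, postMinus x ∂muPlus σ ≤ ∫ x, (1 : ℝ) ∂muPlus σ :=
          integral_mono i2 (integrable_const _) fun x => (postMinus_lt_one x).le
      _ = 1 := by simp
  have e : (capacity σ - inducedCapacity σ L Ltail a) - kappa σ / 24 * δ ^ 2 =
      1 / 2 * ∑ k ∈ symbols L Ltail, (A k - δ ^ 2 / 24 * D k) := by
    rw [capacity_sub_inducedCapacity hσ h hex, hsum1, Finset.sum_sub_distrib, ← Finset.mul_sum,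
      ← hsum2]
    ring
  rw [e, abs_mul, abs_of_pos (by norm_num : (0 : ℝ) < 1 / 2)]
  nlinarith

end

/-! ### Asymptotics in the number of levels -/

/-- `√(log B)`. -/
def rootLog (L : ℕ) : ℝ := √(Real.log (levels L))

theorem tendsto_levels : Tendsto levels atTop atTop := by
  unfold levels
  exact tendsto_atTop_add_const_right _ _
    (tendsto_natCast_atTop_atTop.const_mul_atTop two_pos)

theorem tendsto_rootLog : Tendsto rootLog atTop atTop :=
  Real.tendsto_sqrt_atTop.comp (Real.tendsto_log_atTop.comp tendsto_levels)

theorem levels_pos (L : ℕ) : 0 < levels L := by unfold levels; positivity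

theorem rootLog_sq (L : ℕ) : rootLog L ^ 2 = Real.log (levels L) :=
  Real.sq_sqrt (Real.log_nonneg (by unfold levels; linarith [L.cast_nonneg (α := ℝ)]))

theorem isEquivalent_sub_half : (fun L : ℕ => (L : ℝ) - 1 / 2) ~[atTop] fun L => levels L / 2 := by
  have h : (fun L : ℕ => (L : ℝ) - 1 / 2) = (fun L => levels L / 2) + fun _ => (-1 : ℝ) := by
    ext L
    simp only [Pi.add_apply, levels]
    ring
  rw [h]
  apply IsEquivalent.refl.add_isLittleO
  exact isLittleO_const_left.2 (Or.inr
    (tendsto_norm_atTop_atTop.comp (tendsto_levels.atTop_div_const two_pos)))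

theorem Tstar_eq (σ : ℝ) (L : ℕ) : Tstar σ L = mean σ + 4 / σ * rootLog L := rfl

theorem isEquivalent_of_mem_Icc_Tstar (hσ : 0 < σ) {T : ℕ → ℝ}
    (hT : ∀ᶠ L in atTop, T L ∈ Set.Icc (Tstar σ L) (Tstar σ L + 1)) :
    T ~[atTop] fun L => 4 / σ * rootLog L := by
  have hm := mean_pos hσ
  have hlim : Tendsto (fun L => 4 / σ * rootLog L) atTop atTop :=
    tendsto_rootLog.const_mul_atTop (by positivity)
  have h1 : (T - fun L => 4 / σ * rootLog L) =O[atTop] fun _ => (1 : ℝ) := by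
    apply IsBigO.of_bound (mean σ + 1)
    filter_upwards [hT] with L hL
    rw [Tstar_eq] at hL
    rw [Pi.sub_apply, norm_one, mul_one, Real.norm_eq_abs, abs_le]
    constructor <;> linarith [hL.1, hL.2]
  exact h1.trans_isLittleO (isLittleO_const_left.2 (Or.inr (tendsto_norm_atTop_atTop.comp hlim)))

theorem isEquivalent_spacing (hσ : 0 < σ) {T : ℕ → ℝ}
    (hT : ∀ᶠ L in atTop, T L ∈ Set.Icc (Tstar σ L) (Tstar σ L + 1)) :
    (fun L => spacing L (T L)) ~[atTop] fun L => 8 / σ * (rootLog L / levels L) := by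
  have h := (isEquivalent_of_mem_Icc_Tstar hσ hT).div isEquivalent_sub_half
  refine h.congr_right (Eventually.of_forall fun L => ?_)
  have := levels_pos L
  simp only [Pi.div_apply]
  field_simp
  ring

/-- The window's position is of order `√(log B)`; the cruder `O(log B)` already makes its cube
negligible against `B`. -/
theorem tendsto_Tstar_cube_div (σ : ℝ) :
    Tendsto (fun L : ℕ => (Tstar σ L + 2) ^ 3 / ((L : ℝ) - 1 / 2)) atTop (𝓝 0) := by
  apply IsLittleO.tendsto_div_nhds_zero
  have hlog : Tendsto (fun L : ℕ => Real.log (levels L)) atTop atTop :=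
    Real.tendsto_log_atTop.comp tendsto_levels
  have h1 : (fun L : ℕ => Tstar σ L + 2) =O[atTop] fun L => Real.log (levels L) := by
    have e : (fun L : ℕ => Tstar σ L + 2) = fun L => (mean σ + 2) + 4 / σ * rootLog L := by
      ext L; rw [Tstar_eq]; ring
    rw [e]
    apply IsBigO.add
    · exact (isLittleO_const_left.2 (Or.inr (tendsto_norm_atTop_atTop.comp hlog))).isBigO
    · apply IsBigO.const_mul_left
      apply IsBigO.of_bound 1
      filter_upwards [tendsto_rootLog.eventually_ge_atTop 1] with L hL
      rw [← rootLog_sq, Real.norm_of_nonneg (by linarith), Real.norm_of_nonneg (by positivity)]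
      nlinarith
  have h2 : (fun L : ℕ => Real.log (levels L) ^ 3) =o[atTop] levels :=
    (Real.isLittleO_pow_log_id_atTop (n := 3)).comp_tendsto tendsto_levels
  have h3 : levels =O[atTop] fun L : ℕ => (L : ℝ) - 1 / 2 := by
    have := isEquivalent_sub_half.isBigO_symm
    refine IsBigO.trans ?_ this
    apply IsBigO.of_bound 2
    filter_upwards with L
    rw [norm_div, Real.norm_two]
    linarith
  exact ((h1.pow 3).trans_isLittleO h2).trans_isBigO h3

/-- One vanishing quantity serves twice: the cube controls the choice of the tail symbol, and it
dominates `(1 + T) δ`, since `1 + T ≤ Tstar + 2` throughout the window. -/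
theorem eventually_small (hσ : 0 < σ) {ε : ℝ} (hε : 0 < ε) : ∀ᶠ L : ℕ in atTop,
    1 ≤ L ∧ 3 * mean σ ≤ Tstar σ L ∧ 1 ≤ Tstar σ L ∧
    (Tstar σ L + 2) ^ 3 / ((L : ℝ) - 1 / 2) ≤ ε ∧
    ∀ T ∈ Set.Icc (Tstar σ L) (Tstar σ L + 1), (1 + T) * spacing L T ≤ ε := by
  have hlim : Tendsto (Tstar σ) atTop atTop :=
    tendsto_atTop_add_const_left _ _ (tendsto_rootLog.const_mul_atTop (by positivity))
  filter_upwards [eventually_ge_atTop 1, hlim.eventually_ge_atTop (3 * mean σ),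
    hlim.eventually_ge_atTop 1, (tendsto_Tstar_cube_div σ).eventually_le_const hε]
    with L h1 h2 h3 h4
  refine ⟨h1, h2, h3, h4, fun T hT => le_trans ?_ h4⟩
  have hL : (1 : ℝ) ≤ L := by exact_mod_cast h1
  unfold spacing
  rw [mul_div_assoc']
  have hT1 := hT.1
  have hT2 := hT.2
  apply div_le_div_of_nonneg_right _ (by linarith)
  calc (1 + T) * T ≤ (Tstar σ L + 2) * (Tstar σ L + 2) := by
        apply mul_le_mul <;> linarith
    _ ≤ (Tstar σ L + 2) ^ 3 := by
        rw [pow_succ, sq]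
        exact le_mul_of_one_le_right (by positivity) (by linarith)

theorem isBigO_tailProb (hσ : 0 < σ) {T : ℕ → ℝ}
    (hT : ∀ᶠ L in atTop, T L ∈ Set.Icc (Tstar σ L) (Tstar σ L + 1)) :
    (fun L => tailProb σ (T L)) =O[atTop] fun L => 1 / (levels L ^ 2 * rootLog L) := by
  apply IsBigO.of_bound
    (4 * densConst σ * Real.exp (mean σ / 4) * mean σ * σ / 4)
  filter_upwards [hT, tendsto_rootLog.eventually_gt_atTop 0] with L hL hr
  have hB := levels_pos L
  have h := tailProb_le hσ hr hL.1
  have e : Real.exp (-(2 * rootLog L ^ 2)) = 1 / levels L ^ 2 := by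
    rw [rootLog_sq, Real.exp_neg, mul_comm, Real.exp_mul, Real.exp_log hB, one_div]
    norm_num
  rw [e, div_div] at h
  rw [Real.norm_of_nonneg (by exact measureReal_nonneg), Real.norm_of_nonneg (by positivity)]
  exact h

/-- Relative to `δ²`, which has the order of `log B / B²`, the tail bound gains a factor `(log
B)^(-3/2)`. -/
theorem isLittleO_tailProb (hσ : 0 < σ) {T : ℕ → ℝ}
    (hT : ∀ᶠ L in atTop, T L ∈ Set.Icc (Tstar σ L) (Tstar σ L + 1)) :
    (fun L => tailProb σ (T L)) =o[atTop] fun L => spacing L (T L) ^ 2 := by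
  have h1 : (fun L => 1 / (levels L ^ 2 * rootLog L)) =o[atTop]
      fun L => (8 / σ * (rootLog L / levels L)) ^ 2 := by
    have h2 : (fun L => (rootLog L ^ 3)⁻¹ * (rootLog L / levels L) ^ 2) =o[atTop]
        fun L => 1 * (rootLog L / levels L) ^ 2 := by
      apply IsLittleO.mul_isBigO _ (isBigO_refl _ _)
      rw [isLittleO_one_iff]
      exact tendsto_inv_atTop_zero.comp
        ((tendsto_pow_atTop (by norm_num : (3 : ℕ) ≠ 0)).comp tendsto_rootLog)
    refine (IsLittleO.congr' h2 ?_ (Eventually.of_forall fun L => one_mul _)).trans_isBigO ?_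
    · filter_upwards [tendsto_rootLog.eventually_gt_atTop 0] with L hr
      have := levels_pos L
      field_simp
    · simp only [mul_pow]
      exact isBigO_self_const_mul (by positivity) _ _
  exact ((isBigO_tailProb hσ hT).trans_isLittleO h1).trans_isBigO
    ((isEquivalent_spacing hσ hT).pow 2).isBigO_symm

theorem isBigO_one_add_mul_spacing (hσ : 0 < σ) {T : ℕ → ℝ}
    (hT : ∀ᶠ L in atTop, T L ∈ Set.Icc (Tstar σ L) (Tstar σ L + 1)) :
    (fun L => (1 + T L) * spacing L (T L)) =O[atTop]
      fun L => Real.log (levels L) / levels L := by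
  have h1 : (fun L => 1 + T L) =O[atTop] rootLog := by
    apply IsBigO.add
    · exact (isLittleO_const_left.2 (Or.inr
        (tendsto_norm_atTop_atTop.comp tendsto_rootLog))).isBigO
    · exact (isEquivalent_of_mem_Icc_Tstar hσ hT).isBigO.trans (isBigO_const_mul_self _ _ _)
  have h2 : (fun L => spacing L (T L)) =O[atTop] fun L => rootLog L / levels L :=
    (isEquivalent_spacing hσ hT).isBigO.trans (isBigO_const_mul_self _ _ _)
  refine (h1.mul h2).congr_right fun L => ?_
  rw [← rootLog_sq]
  ring

theorem tendsto_one_add_mul_spacing (hσ : 0 < σ) {T : ℕ → ℝ}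
    (hT : ∀ᶠ L in atTop, T L ∈ Set.Icc (Tstar σ L) (Tstar σ L + 1)) :
    Tendsto (fun L => (1 + T L) * spacing L (T L)) atTop (𝓝 0) := by
  apply (isBigO_one_add_mul_spacing hσ hT).trans_tendsto
  exact (Real.isLittleO_log_id_atTop.tendsto_div_nhds_zero).comp tendsto_levels

/-- The small parameter below which the construction works. -/
def smallness (σ : ℝ) : ℝ := 1 / (7 * devConst σ + 2 * lipConst σ)

theorem smallness_pos (hσ : 0 < σ) : 0 < smallness σ := by
  have := four_lt_devConst hσ
  have := mean_pos hσ
  unfold smallness lipConst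
  positivity

theorem of_le_smallness (hσ : 0 < σ) {x : ℝ} (hx0 : 0 ≤ x) (hx : x ≤ smallness σ) :
    7 * devConst σ * x ≤ 1 ∧ lipConst σ * x ≤ 1 / 2 ∧ x ≤ 1 := by
  have hD := four_lt_devConst hσ
  have hm := mean_pos hσ
  have hl : 0 < lipConst σ := by unfold lipConst; positivity
  rw [smallness, le_div_iff₀ (by positivity)] at hx
  have h1 : 0 ≤ devConst σ * x := by positivity
  have h2 : 0 ≤ lipConst σ * x := by positivity
  refine ⟨by nlinarith, by nlinarith, by nlinarith⟩

theorem orderedCutoffs_cutoff (hσ : 0 < σ) {L : ℕ} (hL : 1 ≤ L) {T : ℝ} (hT : 0 < T)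
    (hsmall : 7 * devConst σ * ((1 + T) * spacing L T) ≤ 1) {Ltail : ℤ} (hLt : (L : ℤ) ≤ Ltail) :
    OrderedCutoffs L Ltail (cutoff σ L T) :=
  ⟨hL, hLt, cutoff_one_pos hσ hL hT hsmall, strictMonoOn_cutoff hσ hL hT hsmall⟩

/-- By uniqueness any family of cutoffs agrees with `cutoff` on `1, …, L`, so the deviation estimate
holds with `η` of order `(1 + T) δ`, and every relative error is of that order. -/
theorem abs_loss_sub_le (hσ : 0 < σ) {L : ℕ} (hL : 1 ≤ L) {T : ℝ} (hT : 0 < T) {Ltail : ℤ}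
    {a : ℕ → ℝ} (htail : IsTailChoice σ L T Ltail) (ha : IsCutoffs σ L T a)
    (hsmall : (1 + T) * spacing L T ≤ smallness σ) :
    |(capacity σ - inducedCapacity σ L Ltail a) - kappa σ / 24 * spacing L T ^ 2| ≤
      (lipConst σ + 7 / 4 * devConst σ + 1) * ((1 + T) * spacing L T) * spacing L T ^ 2 +
        2 * tailProb σ T := by
  have hδ := spacing_pos hL hT
  have hD := four_lt_devConst hσ
  have hx : spacing L T ≤ (1 + T) * spacing L T := le_mul_of_one_le_left hδ.le (by linarith)
  obtain ⟨s1, s2, s3⟩ := of_le_smallness hσ (by positivity) hsmall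
  have heq : ∀ k ∈ Set.Icc 1 L, a k = cutoff σ L T k := fun k hk => ha.eq_cutoff hσ hL hT s1 hk
  have hord : OrderedCutoffs L Ltail a := by
    have h := orderedCutoffs_cutoff hσ hL hT s1 htail.le
    refine ⟨hL, htail.le, ?_, fun i hi j hj hij => ?_⟩
    · rw [heq 1 ⟨le_rfl, hL⟩]; exact h.pos
    · rw [heq i hi, heq j hj]; exact h.mono hi hj hij
  have := abs_capacity_sub_sub_le (η := 7 / 4 * (devConst σ * ((1 + T) * spacing L T))) hσ hord hT
    ha.last (spacing_mul hL T) hδ (by linarith)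
    (exactLattice_of_isCutoffs hσ hord htail hT ha) (by linarith) (by linarith)
    (fun k hk => by rw [heq k hk]; exact abs_cutoff_sub_le hσ hL hT s1 hk)
  refine this.trans ?_
  gcongr
  linarith

theorem isEquivalent_loss (hσ : 0 < σ) {T : ℕ → ℝ} {Ltail : ℕ → ℤ} {a : ℕ → ℕ → ℝ}
    (h : ∀ᶠ L : ℕ in atTop, IsTailChoice σ L (T L) (Ltail L) ∧ IsCutoffs σ L (T L) (a L)) :
    (fun L => capacity σ - inducedCapacity σ L (Ltail L) (a L)) ~[atTop]
      fun L => 8 * kappa σ / (3 * σ ^ 2) * (Real.log (levels L) / levels L ^ 2) := by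
  have hκ := kappa_pos hσ
  have hT : ∀ᶠ L in atTop, T L ∈ Set.Icc (Tstar σ L) (Tstar σ L + 1) := h.mono fun L hL => hL.1.mem
  have h1 : (fun L => kappa σ / 24 * spacing L (T L) ^ 2) ~[atTop]
      fun L => 8 * kappa σ / (3 * σ ^ 2) * (Real.log (levels L) / levels L ^ 2) := by
    have e := (IsEquivalent.refl (u := fun _ : ℕ => kappa σ / 24) (l := atTop)).mul
      ((isEquivalent_spacing hσ hT).pow 2)
    refine e.congr_right (Eventually.of_forall fun L => ?_)
    have := levels_pos L
    simp only [Pi.mul_apply, Pi.pow_apply]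
    rw [← rootLog_sq]
    field_simp
    ring
  refine IsEquivalent.trans ?_ h1
  have h2 : (fun L => (lipConst σ + 7 / 4 * devConst σ + 1) * ((1 + T L) * spacing L (T L)) *
      spacing L (T L) ^ 2 + 2 * tailProb σ (T L)) =o[atTop] fun L => spacing L (T L) ^ 2 := by
    apply IsLittleO.add
    · have h3 : Tendsto (fun L => (lipConst σ + 7 / 4 * devConst σ + 1) *
          ((1 + T L) * spacing L (T L))) atTop (𝓝 0) := by
        simpa using (tendsto_one_add_mul_spacing hσ hT).const_mul
          (lipConst σ + 7 / 4 * devConst σ + 1)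
      have h4 := ((isLittleO_one_iff ℝ).2 h3).mul_isBigO
        (isBigO_refl (fun L => spacing L (T L) ^ 2) atTop)
      exact h4.congr_right fun L => one_mul _
    · exact (isLittleO_tailProb hσ hT).const_mul_left 2
  have h5 : (fun L => (capacity σ - inducedCapacity σ L (Ltail L) (a L)) -
      kappa σ / 24 * spacing L (T L) ^ 2) =o[atTop] fun L => spacing L (T L) ^ 2 := by
    refine IsBigO.trans_isLittleO (IsBigO.of_bound 1 ?_) h2
    filter_upwards [h, eventually_small hσ (smallness_pos hσ)] with L hL hs
    have hTpos : 0 < T L := by linarith [hL.1.mem.1, hs.2.2.1]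
    have := abs_loss_sub_le hσ hs.1 hTpos hL.1 hL.2 (hs.2.2.2.2 _ hL.1.mem)
    rw [one_mul, Real.norm_eq_abs]
    exact this.trans (le_abs_self _)
  exact h5.trans_isBigO (isBigO_self_const_mul (by positivity) _ _)

end BIAWGN

end

/-! ### Assembly of the existence and asymptotic statements. -/

theorem mainTheorem9 (σ : ℝ) (hσ : 0 < σ) :
    -- the construction is possible for all large `B = 2L + 1`, whatever the admissible choice of
    -- `T_B` and `L_tail`, and yields a quantizer with the exact induced-lattice property
    (∀ᶠ L : ℕ in atTop,
      (∃ (T : ℝ) (Ltail : ℤ), BIAWGN.IsTailChoice σ L T Ltail) ∧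
      ∀ (T : ℝ) (Ltail : ℤ), BIAWGN.IsTailChoice σ L T Ltail →
        ∃ a : ℕ → ℝ, BIAWGN.IsCutoffs σ L T a ∧
          (∀ a' : ℕ → ℝ, BIAWGN.IsCutoffs σ L T a' → ∀ k ∈ Set.Icc 1 L, a' k = a k) ∧
          0 < a 1 ∧ StrictMonoOn a (Set.Icc 1 L) ∧
          BIAWGN.ExactLattice σ (BIAWGN.spacing L T) L Ltail a) ∧
    -- asymptotics, for every family of quantizers obtained by the construction
    ∀ (T : ℕ → ℝ) (Ltail : ℕ → ℤ) (a : ℕ → ℕ → ℝ),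
      (∀ᶠ L : ℕ in atTop, BIAWGN.IsTailChoice σ L (T L) (Ltail L) ∧
        BIAWGN.IsCutoffs σ L (T L) (a L)) →
      (∀ᶠ L : ℕ in atTop, T L ∈ Set.Icc
        (2 / σ ^ 2 + 4 / σ * √(Real.log (BIAWGN.levels L)))
        (2 / σ ^ 2 + 4 / σ * √(Real.log (BIAWGN.levels L)) + 1)) ∧
      ((fun L => BIAWGN.spacing L (T L)) ~[atTop]
        fun L => 8 / σ * (√(Real.log (BIAWGN.levels L)) / BIAWGN.levels L)) ∧
      ((fun L => (1 + T L) * BIAWGN.spacing L (T L)) =O[atTop]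
        fun L => Real.log (BIAWGN.levels L) / BIAWGN.levels L) ∧
      Tendsto (fun L => (1 + T L) * BIAWGN.spacing L (T L)) atTop (𝓝 0) ∧
      ((fun L => BIAWGN.tailProb σ (T L)) =O[atTop]
        fun L => 1 / (BIAWGN.levels L ^ 2 * √(Real.log (BIAWGN.levels L)))) ∧
      ((fun L => BIAWGN.tailProb σ (T L)) =o[atTop] fun L => BIAWGN.spacing L (T L) ^ 2) ∧
      ((fun L => BIAWGN.capacity σ - BIAWGN.inducedCapacity σ L (Ltail L) (a L)) ~[atTop]
        fun L => 8 * BIAWGN.kappa σ / (3 * σ ^ 2) *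
          (Real.log (BIAWGN.levels L) / BIAWGN.levels L ^ 2)) ∧
      ((fun L => BIAWGN.capacity σ - BIAWGN.inducedCapacity σ L (Ltail L) (a L)) =Θ[atTop]
        fun L => Real.log (BIAWGN.levels L) / BIAWGN.levels L ^ 2) := by
  have hm := BIAWGN.mean_pos hσ
  have hκ := BIAWGN.kappa_pos hσ
  constructor
  · have hC : 0 < BIAWGN.excessConst σ * (2 * BIAWGN.mean σ) :=
      mul_pos (BIAWGN.excessConst_pos σ) (by positivity)
    -- Two thresholds are needed: the constant in the excess of the tail LLR, for existence of the
    -- tail symbol, and `smallness`, for the cutoff recursion.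
    filter_upwards [BIAWGN.eventually_small hσ hC,
      BIAWGN.eventually_small hσ (BIAWGN.smallness_pos hσ)] with L h1 h2
    obtain ⟨hL, hT3, hT1, hcube, -⟩ := h1
    have hLr : (1 : ℝ) ≤ L := by exact_mod_cast hL
    refine ⟨BIAWGN.exists_isTailChoice hσ hL hT3 (le_trans ?_ hcube) hT1, fun T Ltail hT => ?_⟩
    · apply div_le_div_of_nonneg_right _ (by linarith)
      exact pow_le_pow_left₀ (by linarith) (by linarith) 3
    · have hTpos : 0 < T := by linarith [hT.mem.1]
      have hδ := BIAWGN.spacing_pos hL hTpos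
      obtain ⟨s1, -, -⟩ := BIAWGN.of_le_smallness hσ (by positivity) (h2.2.2.2.2 T hT.mem)
      have hord := BIAWGN.orderedCutoffs_cutoff hσ hL hTpos s1 hT.le
      have hcut := BIAWGN.isCutoffs_cutoff hσ hL hTpos s1
      exact ⟨BIAWGN.cutoff σ L T, hcut, fun a' ha' k hk => ha'.eq_cutoff hσ hL hTpos s1 hk,
        hord.pos, hord.mono, BIAWGN.exactLattice_of_isCutoffs hσ hord hT hTpos hcut⟩
  · intro T Ltail a h
    have hT : ∀ᶠ L in atTop, T L ∈ Set.Icc (BIAWGN.Tstar σ L) (BIAWGN.Tstar σ L + 1) :=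
      h.mono fun L hL => hL.1.mem
    have hloss := BIAWGN.isEquivalent_loss hσ h
    refine ⟨hT, BIAWGN.isEquivalent_spacing hσ hT, BIAWGN.isBigO_one_add_mul_spacing hσ hT,
      BIAWGN.tendsto_one_add_mul_spacing hσ hT, BIAWGN.isBigO_tailProb hσ hT,
      BIAWGN.isLittleO_tailProb hσ hT, hloss, hloss.isTheta.trans ?_⟩
    exact (isTheta_const_mul_left (by positivity)).2 (isTheta_refl _ _)
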